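/- Let $c\ge 2$ and $\lambda>0$. For $x\in\mathbb{N}_0^c$ and $n\in\mathbb{N}_0$ let $\beta_n(x)=\sum_{i=1}^c (x^i-n)^+$, and write $x\preccurlyeq y$ if $\beta_n(x)\le\beta_n(y)$ for all $n\in\mathbb{N}_0$. All processes are adapted to a filtration $(\mathcal{F}_t)_{t\ge0}$, and Poisson processes are $(\mathcal{F}_t)$-Poisson processes. Let $e_i$ be the $i$-th unit vector of $\mathbb{R}^c$. A load balancing network is given by a policy which, possibly with auxiliary randomization, determines from the state $x\in\mathbb{N}_0^c$ just before an event and a queue $j$ a queue $i$ with $x^i\le x^j$ (at arrivals), or a queue $i$ with $x^i\ge x^j\ge1$ (at service completions). Its queue length process $X$ is an $(\mathcal{F}_t)$-Markov process with right-continuous paths with left limits in $\mathbb{N}_0^c$ such that: tasks arrive according to a Poisson process of intensity $\lambda$; at an arrival instant $t$, a queue $j$ is chosen uniformly, the policy determines from $X(t-)$ and $j$ a queue $i$ with $X^i(t-)\le X^j(t-)$, and $X(t)=X(t-)+e_i$; service completions have total intensity equal to the number of nonempty queues, each concerning a uniformly chosen one of these; when queue $j$ completes a service at $t$, the policy determines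 a queue $i$ with $X^i(t-)\ge X^j(t-)\ge1$, and $X(t)=X(t-)-e_i$; $X$ is constant between these events. The uniform routing (UR) network is the one with $i=j$ in both cases. Coupling construction. Draw $(X(0),Y(0))$ from any joint law on $\mathbb{N}_0^c\times\mathbb{N}_0^c$. Take two independent Poisson processes, of arrivals with intensity $\lambda$ and of potential service completions with intensity $c$, both independent of the initial states and marked by independent uniform draws in $\{1,\dots,c\}$ (and by independent uniform variables on $[0,1]$ for the auxiliary randomization of the policy). For a state $x$ let $s_x(k)$ be the index of the $k$-th queue when the queues are set in non-decreasing order of length, ties being broken by ascending index. At an arrival instant $t$ with mark $k$, set $j=s_{X(t-)}(k)$; the policy determines $i$ from $X(t-)$ and $j$, and $X(t)=X(t-)+e_i$; moreover $Y(t)=Y(t-)+e_{j'}$ with $j'=s_{Y(t-)}(k)$. At a potential service completion instant $t$ with mark $k$, set $j=s_{X(t-)}(k)$ and $j'=s_{Y(t-)}(k)$; if $X^j(t-)\ge1$, the policy determines $i$ from $X(t-)$ and $j$, and $X(t)=X(t-)-e_i$, else $X(t)=X(t-)$; if $Y^{j'}(t-)\ge1$ then $Y(t)=Y(t-)-e_{j'}$,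 else $Y(t)=Y(t-)$. Between these instants $X$ and $Y$ are constant. Theorem. For any policy and any joint law of the initial states, this construction can be carried out, and it yields a coupling of the queue length process of the load balancing network with this policy and of that of the UR network: $X$ is a queue length process of the load balancing network and $Y$ is a queue length process of the UR network, and each has the same law as any queue length process of the same network with the same initial law. Moreover, on every path, \[ X(0)\preccurlyeq Y(0)\ \Longrightarrow\ X(t)\preccurlyeq Y(t)\quad\text{for all } t\ge 0 . \] -/

import Mathlib

open MeasureTheory ProbabilityTheory Filter Topology
open scoped NNReal ENNReal

noncomputable section

namespace LoadBalancing

/-! ### States and the preorder -/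

/-- A network state: the vector of the lengths of the `c` queues. -/
abbrev State (c : ℕ) : Type := Fin c → ℕ

/-- `excess n x` is `∑ i, (x i - n)⁺` (truncated subtraction is the positive part). -/
def excess {c : ℕ} (n : ℕ) (x : State c) : ℕ := ∑ i, (x i - n)

/-- The preorder `x ≼ y` between network states. -/
def Preceq {c : ℕ} (x y : State c) : Prop := ∀ n : ℕ, excess n x ≤ excess n y

/-! ### Policies -/

/-- A load balancing policy on `c` queues, together with its work stealing rule.
Decisions are made from the current state, the index `j` of the queue under consideration, and a
uniform random variable `u` on `[0, 1]` (with which any law on the finite set of queues can be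
simulated):
* at an arrival, if `j` is the uniformly chosen queue, then the task goes to queue `route x j u`,
  which is not longer than queue `j`;
* at a service completion in the nonempty queue `j`, the queue length that decreases by one is that
  of `release x j u`, which is not shorter than queue `j`. -/
structure Policy (c : ℕ) where
  route : State c → Fin c → unitInterval → Fin c
  release : State c → Fin c → unitInterval → Fin c
  measurable_route : ∀ (x : State c) (j : Fin c), Measurable (route x j)
  measurable_release : ∀ (x : State c) (j : Fin c), Measurable (release x j)
  route_le : ∀ (x : State c) (j : Fin c) (u : unitInterval), x (route x j u) ≤ x j
  le_release : ∀ (x : State c) (j : Fin c) (u : unitInterval), 1 ≤ x j → x j ≤ x (release x j u)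

/-- Uniform routing: the task joins the uniformly chosen queue, and there is no work stealing. -/
def Policy.uniformRouting (c : ℕ) : Policy c where
  route _ j _ := j
  release _ j _ := j
  measurable_route _ _ := measurable_const
  measurable_release _ _ := measurable_const
  route_le _ _ _ := le_rfl
  le_release _ _ _ _ := le_rfl

/-- The probability that the policy routes to `i` an arriving task for which the uniformly chosen
queue is `j`, in state `x`. -/
def Policy.routeProb {c : ℕ} (pol : Policy c) (x : State c) (j i : Fin c) : ℝ :=
  (volume : Measure unitInterval).real {u | pol.route x j u = i}

/-- The probability that the policy releases a task from queue `i` when queue `j` completes a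
service, in state `x`. -/
def Policy.releaseProb {c : ℕ} (pol : Policy c) (x : State c) (j i : Fin c) : ℝ :=
  (volume : Measure unitInterval).real {u | pol.release x j u = i}

/-! ### Paths and processes -/

/-- Right-continuous paths with left limits. -/
def IsCadlag {S : Type*} [TopologicalSpace S] (x : ℝ≥0 → S) : Prop :=
  (∀ t, ContinuousWithinAt x (Set.Ici t) t) ∧ ∀ t, ∃ l, Tendsto x (𝓝[<] t) (𝓝 l)

section Processes

variable {Ω : Type*} {m : MeasurableSpace Ω}

/-- The usual conditions: the filtration is right-continuous and `F 0` contains all null sets. -/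
structure UsualConditions (F : Filtration ℝ≥0 m) (P : Measure Ω) : Prop where
  right_continuous : F.IsRightContinuous
  complete : ∀ B : Set Ω, P B = 0 → MeasurableSet[F 0] B

/-- The Markov property of `X` with respect to the filtration `F`. -/
def IsMarkov {S : Type*} [MeasurableSpace S] (F : Filtration ℝ≥0 m) (P : Measure Ω)
    (X : ℝ≥0 → Ω → S) : Prop :=
  ∀ s t : ℝ≥0, s ≤ t → ∀ B : Set S, MeasurableSet B →
    P[(X t ⁻¹' B).indicator (fun _ => (1 : ℝ)) | F s] =ᵐ[P]
      P[(X t ⁻¹' B).indicator (fun _ => (1 : ℝ)) | MeasurableSpace.comap (X s) inferInstance]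

/-- Adapted counting processes: null at `0`, nondecreasing, right-continuous. -/
structure IsCountingProcess (F : Filtration ℝ≥0 m) (N : ℝ≥0 → Ω → ℕ) : Prop where
  adapted : Adapted F N
  zero : ∀ ω, N 0 ω = 0
  mono : ∀ ω, Monotone fun t => N t ω
  right_continuous : ∀ ω t, ContinuousWithinAt (fun u => N u ω) (Set.Ici t) t

/-- `F`-Poisson processes of intensity `r`. -/
structure IsPoissonProcess (F : Filtration ℝ≥0 m) (P : Measure Ω) (r : ℝ≥0)
    (N : ℝ≥0 → Ω → ℕ) : Prop extends IsCountingProcess F N where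
  law : ∀ s t : ℝ≥0, s ≤ t →
    HasLaw (fun ω => N t ω - N s ω) (poissonMeasure (r * (t - s))) P
  indep : ∀ s t : ℝ≥0, s ≤ t →
    Indep (MeasurableSpace.comap (fun ω => N t ω - N s ω) inferInstance) (F s) P

/-- The counting process `N` has the `F`-intensity `a`, i.e. `N t - ∫₀ᵗ a u du` is an
`F`-martingale. -/
def HasIntensity (F : Filtration ℝ≥0 m) (P : Measure Ω) (N : ℝ≥0 → Ω → ℕ)
    (a : ℝ≥0 → Ω → ℝ) : Prop :=
  Martingale (fun (t : ℝ≥0) ω => (N t ω : ℝ) - ∫ u in (0 : ℝ)..t, a u.toNNReal ω) F P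

/-! ### Load balancing networks -/

/-- The dynamics of a load balancing network with queue length process `X` in terms of counting
processes of its events:
`A j i t` is the number of arrivals up to time `t` for which queue `j` is the uniformly chosen queue
and the task is routed to queue `i`, and `S j i t` is the number of service completions up to time
`t` in queue `j` for which the length of queue `i` is reduced.
An event of a given type happens at time `t` when the corresponding process jumps at `t`. -/
structure NetworkEvents {c : ℕ} (F : Filtration ℝ≥0 m) (P : Measure Ω) (lam : ℝ≥0)
    (pol : Policy c) (X : ℝ≥0 → Ω → State c) (A S : Fin c → Fin c → ℝ≥0 → Ω → ℕ) : Prop where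
  counting_arrival : ∀ j i, IsCountingProcess F (A j i)
  counting_service : ∀ j i, IsCountingProcess F (S j i)
  /-- Events happen one at a time. -/
  simple : ∀ ω t, ∑ j, ∑ i, (A j i t ω + S j i t ω) ≤
    Function.leftLim (fun u => ∑ j, ∑ i, (A j i u ω + S j i u ω)) t + 1
  /-- The queue lengths change only at events. -/
  no_event : ∀ ω t, (∀ j i, A j i t ω = Function.leftLim (fun u => A j i u ω) t ∧
      S j i t ω = Function.leftLim (fun u => S j i u ω) t) →
    X t ω = Function.leftLim (fun u => X u ω) t
  /-- A task is routed to a queue which is not longer than the uniformly chosen queue. -/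
  arrival : ∀ ω t j i, Function.leftLim (fun u => A j i u ω) t < A j i t ω →
    Function.leftLim (fun u => X u ω) t i ≤ Function.leftLim (fun u => X u ω) t j ∧
    X t ω = Function.leftLim (fun u => X u ω) t + Pi.single i 1
  /-- At a service completion in a (nonempty) queue, the length of a queue which is not shorter
  is reduced. -/
  service : ∀ ω t j i, Function.leftLim (fun u => S j i u ω) t < S j i t ω →
    1 ≤ Function.leftLim (fun u => X u ω) t j ∧
    Function.leftLim (fun u => X u ω) t j ≤ Function.leftLim (fun u => X u ω) t i ∧
    X t ω + Pi.single i 1 = Function.leftLim (fun u => X u ω) t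
  /-- Tasks arrive according to a Poisson process of intensity `lam`. -/
  poisson_arrivals : IsPoissonProcess F P lam fun t ω => ∑ j, ∑ i, A j i t ω
  /-- At each arrival, queue `j` is chosen uniformly, and then `i` according to the policy. -/
  intensity_arrival : ∀ j i, HasIntensity F P (A j i)
    fun t ω => lam / c * pol.routeProb (X t ω) j i
  /-- Each nonempty queue `j` completes services with intensity `1` (i.e. the total intensity is
  the number of nonempty queues, and each completion concerns a uniformly chosen one of these), and
  then `i` is determined according to the policy. -/
  intensity_service : ∀ j i, HasIntensity F P (S j i)
    fun t ω => if 1 ≤ X t ω j then pol.releaseProb (X t ω) j i else 0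

/-- `X` is the queue length process of a load balancing network with `c` queues, arrival intensity
`lam` and policy `pol`. -/
structure IsNetwork {c : ℕ} (F : Filtration ℝ≥0 m) (P : Measure Ω) (lam : ℝ≥0)
    (pol : Policy c) (X : ℝ≥0 → Ω → State c) : Prop where
  adapted : Adapted F X
  cadlag : ∀ ω, IsCadlag fun t => X t ω
  markov : IsMarkov F P X
  events : ∃ A S : Fin c → Fin c → ℝ≥0 → Ω → ℕ, NetworkEvents F P lam pol X A S

end Processes

/-! ### Marked Poisson processes -/

/-- A random sequence of instants `T n ω` bearing marks `mark n ω` in `E`. -/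
structure MarkedPoints (Ω E : Type*) where
  T : ℕ → Ω → ℝ≥0
  mark : ℕ → Ω → E

/-- The number of points with instant in `(s, t]` and mark in `B`. -/
def MarkedPoints.count {Ω E : Type*} (N : MarkedPoints Ω E) (s t : ℝ≥0) (B : Set E) (ω : Ω) : ℕ :=
  Set.ncard {n : ℕ | s < N.T n ω ∧ N.T n ω ≤ t ∧ N.mark n ω ∈ B}

/-- The σ-algebra generated by the points with instants in `(s, t]` and their marks. -/
@[reducible] def MarkedPoints.sigmaIoc {Ω E : Type*} [MeasurableSpace E] (N : MarkedPoints Ω E)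
    (s t : ℝ≥0) : MeasurableSpace Ω :=
  ⨆ (u : ℝ≥0) (_ : s ≤ u ∧ u ≤ t) (B : Set E) (_ : MeasurableSet B),
    MeasurableSpace.comap (N.count s u B) inferInstance

/-- `N` is an `F`-Poisson process of intensity `r` marked by draws of law `ν`. -/
structure IsMarkedPoisson {Ω E : Type*} {m : MeasurableSpace Ω} [MeasurableSpace E]
    (F : Filtration ℝ≥0 m) (P : Measure Ω) (r : ℝ≥0) (ν : Measure E)
    (N : MarkedPoints Ω E) : Prop where
  pos : ∀ n ω, 0 < N.T n ω
  strictMono : ∀ ω, StrictMono fun n => N.T n ω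
  tendsto : ∀ ω, Tendsto (fun n => N.T n ω) atTop atTop
  adapted : ∀ (t : ℝ≥0) (B : Set E), MeasurableSet B → Measurable[F t] (N.count 0 t B)
  /-- The points in `(s, t]` are independent of the past up to time `s`. -/
  indep : ∀ s t : ℝ≥0, s ≤ t → Indep (N.sigmaIoc s t) (F s) P
  law : ∀ s t : ℝ≥0, s ≤ t → ∀ B : Set E, MeasurableSet B →
    HasLaw (N.count s t B) (poissonMeasure (r * (ν B).toNNReal * (t - s))) P
  /-- The numbers of points with marks in disjoint sets are independent. -/
  indep_marks : ∀ s t : ℝ≥0, s ≤ t → ∀ (k : ℕ) (B : Fin k → Set E),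
    (∀ l, MeasurableSet (B l)) → Pairwise (fun l l' => Disjoint (B l) (B l')) →
    iIndepFun (fun l => N.count s t (B l)) P

/-! ### The coupling -/

/-- Marks: a rank in `{1, …, c}` (an element of `Fin c`), and an auxiliary variable used
for the possible random choices of the policy. -/
abbrev Mark (c : ℕ) : Type := Fin c × unitInterval

/-- Uniform draws of the rank and, independently, of the auxiliary variable. -/
def markLaw (c : ℕ) : Measure (Mark c) := (uniformOn (Set.univ : Set (Fin c))).prod volume

/-- The index of the `k`-th queue when the queues are set in nondecreasing order of length, ties
being broken by ascending index. -/
def rankedQueue {c : ℕ} (x : State c) (k : Fin c) : Fin c := Tuple.sort x k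

/-- The process `X` evolves under policy `pol` according to the marked arrivals `arr` and the marked
potential service completions `srv`, the ranks being used in the sorted state just before. -/
structure Follows {Ω : Type*} {c : ℕ} (pol : Policy c) (arr srv : MarkedPoints Ω (Mark c))
    (X : ℝ≥0 → Ω → State c) : Prop where
  cadlag : ∀ ω, IsCadlag fun t => X t ω
  arrival : ∀ ω n, ∀ x : State c, x = Function.leftLim (fun u => X u ω) (arr.T n ω) →
    X (arr.T n ω) ω =
      x + Pi.single (pol.route x (rankedQueue x (arr.mark n ω).1) (arr.mark n ω).2) 1
  /-- The ranked queue is nonempty: the service completion is effective. -/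
  service : ∀ ω n, ∀ x : State c, x = Function.leftLim (fun u => X u ω) (srv.T n ω) →
    1 ≤ x (rankedQueue x (srv.mark n ω).1) →
    X (srv.T n ω) ω +
      Pi.single (pol.release x (rankedQueue x (srv.mark n ω).1) (srv.mark n ω).2) 1 = x
  /-- The ranked queue is empty: nothing happens. -/
  idle : ∀ ω n, ∀ x : State c, x = Function.leftLim (fun u => X u ω) (srv.T n ω) →
    x (rankedQueue x (srv.mark n ω).1) = 0 → X (srv.T n ω) ω = x
  no_event : ∀ ω t, (∀ n, t ≠ arr.T n ω) → (∀ n, t ≠ srv.T n ω) →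
    X t ω = Function.leftLim (fun u => X u ω) t

/-- The coupling construction of the process `X`, under policy `pol`, and of the process `Y`, under
uniform routing: both are driven by the same marked Poisson process `arr` of arrivals, of intensity
`lam`, and the same marked Poisson process `srv` of potential service completions, of intensity `c`,
which are independent (and thus have a.s. no common instant; the exceptional null event is
discarded). The initial states may have any joint law, and are independent of `arr` and of `srv`
since they are `F 0`-measurable. -/
structure IsCoupling {Ω : Type*} {m : MeasurableSpace Ω} {c : ℕ} (F : Filtration ℝ≥0 m)
    (P : Measure Ω) (lam : ℝ≥0) (pol : Policy c) (arr srv : MarkedPoints Ω (Mark c))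
    (X Y : ℝ≥0 → Ω → State c) : Prop where
  arrivals : IsMarkedPoisson F P lam (markLaw c) arr
  services : IsMarkedPoisson F P c (markLaw c) srv
  indep : Indep (⨆ t, arr.sigmaIoc 0 t) (⨆ t, srv.sigmaIoc 0 t) P
  no_common : ∀ ω n n', arr.T n ω ≠ srv.T n' ω
  adapted_fst : Adapted F X
  adapted_snd : Adapted F Y
  follows_fst : Follows pol arr srv X
  follows_snd : Follows (Policy.uniformRouting c) arr srv Y

end LoadBalancing

end

noncomputable section

namespace LoadBalancing

/-! ### Càdlàg paths in discrete spaces -/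

section Paths

/-! The order is preserved for a deterministic reason. At an event of rank `k`, `excess n` changes
by at most one in each state, and the inequality at level `n` is threatened only if `x` alone grows
at an arrival or `y` alone shrinks at a completion. In the first case the queue of rank `k` has
length at least `n` in `x` and less than `n` in `y`. In the second, at least `n + 1` in `y` and less
than `n + 1` in `x`. Since lengths increase with rank, the numbers of queues above that threshold
then compare strictly (`card_lt_card_of_rankedQueue`). These numbers are the differences of
consecutive excesses (`excess_eq_add`), so the inequality at the adjacent level forces a strict one
at level `n`, and the unit change is absorbed. `Preceq.arrival` and `Preceq.service` carry this, and
`Follows.preceq` propagates it along càdlàg paths.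

Each coupled process has the right dynamics because sorting is a permutation: a uniform rank
designates a uniform queue in whatever state precedes the event. The points whose mark lies in a set
`B x` depending on the state `x` just before form a counting process of intensity `r * ν (B (X t))`
(`IsMarkedPoisson.hasIntensity_thinned`). This is proved by freezing the state at the left ends of
the cells of a fine grid and passing to the limit in Riemann sums. `Follows.networkEvents` collects
the events.

The law is unique because the rates are bounded. Dynkin's formula (`JumpDynamics.setIntegral_sub`),
iterated, expands the expectation of `f (X t)` on an event of `F s` into the exponential series of a
bounded generator applied at `X s`. The Markov property and the finite-dimensional laws follow
(`JumpDynamics.isMarkov`, `JumpDynamics.identDistrib`).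

For existence, each unit interval receives a Poisson number of independent uniform marked points.
The characteristic functional `integral_exp_cloudSum` gives the Poisson laws of the counts and their
independence over disjoint sets. The points are enumerated in increasing order, the paths are built
by recursion along them, and adaptedness comes from an Euler scheme that is exact on fine grids.
Completion and right limits then yield the usual conditions. -/

theorem leftLim_zero {S : Type*} [TopologicalSpace S] (x : ℝ≥0 → S) : Function.leftLim x 0 = x 0 :=
  leftLim_eq_of_eq_bot x (by
    have : Set.Iio (0 : ℝ≥0) = ∅ := by ext; simp
    rw [this, nhdsWithin_empty])

theorem neBot_nhdsWithin_Iio {t : ℝ≥0} (ht : 0 < t) : (𝓝[<] t).NeBot :=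
  nhdsLT_neBot_of_exists_lt ⟨0, ht⟩

variable {S : Type*} [TopologicalSpace S] [DiscreteTopology S]

/-- A discrete-valued càdlàg path is locally constant on both sides of every instant. -/
theorem IsCadlag.eventually_nhds {x : ℝ≥0 → S} (hx : IsCadlag x) (t : ℝ≥0) :
    ∀ᶠ u in 𝓝 t, (u < t → x u = Function.leftLim x t) ∧ (t ≤ u → x u = x t) := by
  have h1 : ∀ᶠ u in 𝓝[≥] t, x u = x t := by
    have := hx.1 t
    rw [ContinuousWithinAt, nhds_discrete, tendsto_pure] at this
    exact this
  have h2 : ∀ᶠ u in 𝓝[<] t, x u = Function.leftLim x t := by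
    rcases eq_or_ne (𝓝[<] t) ⊥ with h | h
    · rw [h]; exact eventually_bot
    · have : (𝓝[<] t).NeBot := ⟨h⟩
      obtain ⟨l, hl⟩ := hx.2 t
      rw [leftLim_eq_of_tendsto hl]
      rwa [nhds_discrete, tendsto_pure] at hl
  rw [eventually_nhdsWithin_iff] at h1 h2
  filter_upwards [h1, h2] with u hu1 hu2
  exact ⟨fun h => hu2 h, fun h => hu1 h⟩

theorem isCadlag_of_monotone {x : ℝ≥0 → ℕ} (hm : Monotone x)
    (hr : ∀ t, ContinuousWithinAt x (Set.Ici t) t) : IsCadlag x :=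
  ⟨hr, fun t => ⟨_, hm.tendsto_leftLim t⟩⟩

/-- Induction along a path: a property which is inherited by some right neighbourhood, and by the
limit from the left, holds at all times. -/
theorem forall_of_right_of_left {p : ℝ≥0 → Prop} (h0 : p 0)
    (hright : ∀ t, p t → ∀ᶠ u in 𝓝[>] t, p u) (hleft : ∀ t, 0 < t → (∀ u < t, p u) → p t) :
    ∀ t, p t := by
  by_contra! hcon
  obtain ⟨b, hb⟩ := hcon
  -- The property holds strictly before the infimum `τ` of the failures, hence at `τ` by the left
  -- limit rule, hence a little beyond, which contradicts the choice of `τ`.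
  set A : Set ℝ≥0 := {t | ¬ p t} with hA
  have hne : A.Nonempty := ⟨b, hb⟩
  set τ := sInf A
  have hlt : ∀ u < τ, p u := fun u hu => by
    by_contra h
    exact absurd (csInf_le (OrderBot.bddBelow A) h) (not_le.2 hu)
  have hτ : p τ := by
    rcases eq_or_lt_of_le (zero_le (a := τ)) with h | h
    · rw [← h]; exact h0
    · exact hleft τ h hlt
  have hr := hright τ hτ
  rw [eventually_nhdsWithin_iff] at hr
  have hge : ∀ᶠ u in 𝓝 τ, τ ≤ u → p u := by
    filter_upwards [hr] with u hu hle
    rcases eq_or_lt_of_le hle with h | h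
    · rw [← h]; exact hτ
    · exact hu h
  obtain ⟨ε, hε, hball⟩ := exists_Ico_subset_of_mem_nhds hge ⟨τ + 1, by simp⟩
  obtain ⟨a, haA, ha⟩ := exists_lt_of_csInf_lt hne hε
  exact haA (hball ⟨csInf_le (OrderBot.bddBelow A) haA, ha⟩ (csInf_le (OrderBot.bddBelow A) haA))

/-- A relation between instants which holds locally holds uniformly on compact time intervals. -/
theorem exists_pos_forall_of_local {R : ℝ≥0 → ℝ≥0 → Prop}
    (hR : ∀ u, ∀ᶠ p in 𝓝 (u, u), p.1 ≤ p.2 → R p.1 p.2) (t : ℝ≥0) :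
    ∃ δ > (0 : ℝ), ∀ a b, a ≤ b → b ≤ t → (b : ℝ) - a < δ → R a b := by
  have h1 : ∀ u : ℝ≥0, ∃ ε > (0 : ℝ), ∀ a ∈ Metric.ball u ε, ∀ b ∈ Metric.ball u ε, a ≤ b → R a b := by
    intro u
    obtain ⟨ε, hε, h⟩ := Metric.eventually_nhds_iff_ball.1 (hR u)
    refine ⟨ε, hε, fun a ha b hb hab => h (a, b) ?_ hab⟩
    rw [Metric.mem_ball, Prod.dist_eq]
    exact max_lt ha hb
  choose ε hε hball using h1
  -- A Lebesgue number of the cover of `[0, t]` by the good balls serves as the uniform mesh.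
  obtain ⟨δ, hδ, h⟩ := lebesgue_number_lemma_of_metric (s := Set.Icc 0 t)
    (c := fun u : ℝ≥0 => Metric.ball u (ε u)) isCompact_Icc (fun u => Metric.isOpen_ball)
    (fun u _ => Set.mem_iUnion.2 ⟨u, Metric.mem_ball_self (hε u)⟩)
  refine ⟨δ, hδ, fun a b hab hbt hlt => ?_⟩
  obtain ⟨u, hu⟩ := h a ⟨zero_le, hab.trans hbt⟩
  refine hball u a (hu (Metric.mem_ball_self hδ)) b (hu ?_) hab
  rw [Metric.mem_ball, NNReal.dist_eq, abs_of_nonneg (sub_nonneg.2 (NNReal.coe_le_coe.2 hab))]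
  exact hlt

end Paths

/-! ### Uniform grids -/

/-- The `k`-th point of the uniform grid of `[s, t]` with `n` steps. -/
def grid (s t : ℝ≥0) (n k : ℕ) : ℝ≥0 := s + k * ((t - s) / n)

@[simp] theorem grid_zero (s t : ℝ≥0) (n : ℕ) : grid s t n 0 = s := by simp [grid]

theorem grid_self {s t : ℝ≥0} (h : s ≤ t) {n : ℕ} (hn : n ≠ 0) : grid s t n n = t := by
  have : (n : ℝ≥0) ≠ 0 := by exact_mod_cast hn
  rw [grid, mul_div_cancel₀ _ this, add_tsub_cancel_of_le h]

theorem grid_mono (s t : ℝ≥0) (n : ℕ) : Monotone (grid s t n) := fun k l h => by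
  have : (k : ℝ≥0) ≤ l := by exact_mod_cast h
  unfold grid; gcongr

theorem le_grid (s t : ℝ≥0) (n k : ℕ) : s ≤ grid s t n k := by simp [grid]

theorem grid_le {s t : ℝ≥0} (h : s ≤ t) {n k : ℕ} (hk : k ≤ n) : grid s t n k ≤ t := by
  rcases Nat.eq_zero_or_pos n with rfl | hn
  · simpa [grid] using h
  · exact (grid_mono s t n hk).trans (grid_self h hn.ne').le

theorem coe_grid {s t : ℝ≥0} (h : s ≤ t) (n k : ℕ) :
    (grid s t n k : ℝ) = s + k * (((t : ℝ) - s) / n) := by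
  simp [grid, NNReal.coe_sub h]

theorem grid_succ_sub {s t : ℝ≥0} (h : s ≤ t) (n k : ℕ) :
    (grid s t n (k + 1) : ℝ) - grid s t n k = ((t : ℝ) - s) / n := by
  rw [coe_grid h, coe_grid h]; push_cast; ring

/-- This is how sums over jumps are handled without listing the jumps: an identity valid across each
single instant holds on every cell of a fine grid, and the cells then telescope. -/
theorem eventually_grid {R : ℝ≥0 → ℝ≥0 → Prop}
    (hR : ∀ u, ∀ᶠ p in 𝓝 (u, u), p.1 ≤ p.2 → R p.1 p.2) {s t : ℝ≥0} (h : s ≤ t) :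
    ∀ᶠ n in atTop, ∀ k < n, R (grid s t n k) (grid s t n (k + 1)) := by
  obtain ⟨δ, hδ, hball⟩ := exists_pos_forall_of_local hR t
  have := (tendsto_const_div_atTop_nhds_zero_nat ((t : ℝ) - s)).eventually_lt_const hδ
  filter_upwards [this] with n hn k hk
  refine hball _ _ (grid_mono s t n k.le_succ) (grid_le h hk) ?_
  rw [grid_succ_sub h]; exact hn

/-- To check a relation locally, given paths which are locally constant on both sides of each
instant, it suffices to check it across each instant. -/
theorem local_of_eventually {R : ℝ≥0 → ℝ≥0 → Prop} {u : ℝ≥0} {L : ℝ≥0 → Prop} {U : ℝ≥0 → Prop}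
    (hLU : ∀ᶠ v in 𝓝 u, (v < u → L v) ∧ (u ≤ v → U v))
    (hLL : ∀ a b, L a → L b → a ≤ b → b < u → R a b)
    (hUU : ∀ a b, U a → U b → u ≤ a → a ≤ b → R a b)
    (hL : ∀ a b, L a → U b → a < u → u ≤ b → R a b) :
    ∀ᶠ p in 𝓝 (u, u), p.1 ≤ p.2 → R p.1 p.2 := by
  rw [nhds_prod_eq]
  filter_upwards [hLU.prod_mk hLU] with p hp hle
  rcases lt_or_ge p.1 u with h1 | h1
  · rcases lt_or_ge p.2 u with h2 | h2
    · exact hLL _ _ (hp.1.1 h1) (hp.2.1 h2) hle h2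
    · exact hL _ _ (hp.1.1 h1) (hp.2.2 h2) h1 h2
  · exact hUU _ _ (hp.1.2 h1) (hp.2.2 (h1.trans hle)) h1 hle


/-! ### Preservation of the preorder -/

section Preorder

variable {c : ℕ}

/-- The excesses determine the numbers of long queues by differencing, which is the source of strict
inequalities below. -/
theorem excess_eq_add (n : ℕ) (x : State c) :
    excess n x = excess (n + 1) x + (Finset.univ.filter fun i => n + 1 ≤ x i).card := by
  rw [excess, excess, Finset.card_filter, ← Finset.sum_add_distrib]
  refine Finset.sum_congr rfl fun i _ => ?_
  split_ifs <;> omega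

theorem excess_add_single (n : ℕ) (x : State c) (i : Fin c) :
    excess n (x + Pi.single i 1) = excess n x + if n ≤ x i then 1 else 0 := by
  unfold excess
  rw [← Finset.add_sum_erase _ _ (Finset.mem_univ i),
    ← Finset.add_sum_erase Finset.univ (fun j => x j - n) (Finset.mem_univ i)]
  have : ∑ j ∈ Finset.univ.erase i, ((x + Pi.single i 1 : State c) j - n) =
      ∑ j ∈ Finset.univ.erase i, (x j - n) :=
    Finset.sum_congr rfl fun j hj => by simp [Pi.single_eq_of_ne (Finset.ne_of_mem_erase hj)]
  rw [this]
  simp only [Pi.add_apply, Pi.single_eq_same]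
  split_ifs <;> omega

theorem rankedQueue_mono (x : State c) : Monotone fun k => x (rankedQueue x k) :=
  Tuple.monotone_sort x

theorem card_filter_rankedQueue (x : State c) (p : ℕ → Prop) [DecidablePred p] :
    (Finset.univ.filter fun k => p (x (rankedQueue x k))).card =
      (Finset.univ.filter fun i => p (x i)).card := by
  rw [Finset.card_filter, Finset.card_filter]
  exact Equiv.sum_comp (Tuple.sort x) fun i => if p (x i) then 1 else 0

/-- If the queue of rank `k` has length less than `n` in state `x` and at least `n` in state `y`,
then fewer queues have length at least `n` in state `x` than in state `y`. -/
theorem card_lt_card_of_rankedQueue {x y : State c} {k : Fin c} {n : ℕ}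
    (hx : x (rankedQueue x k) < n) (hy : n ≤ y (rankedQueue y k)) :
    (Finset.univ.filter fun i => n ≤ x i).card < (Finset.univ.filter fun i => n ≤ y i).card := by
  rw [← card_filter_rankedQueue x fun a => n ≤ a, ← card_filter_rankedQueue y fun a => n ≤ a]
  -- Ranks at which `x` reaches `n` lie beyond `k`, where `y` also reaches `n` by monotonicity. Rank
  -- `k` itself makes the inclusion strict.
  refine Finset.card_lt_card (Finset.ssubset_iff_of_subset (fun l hl => ?_) |>.2 ⟨k, ?_, ?_⟩)
  · simp only [Finset.mem_filter, Finset.mem_univ, true_and] at hl ⊢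
    refine hy.trans (rankedQueue_mono y (le_of_not_gt fun h => ?_))
    exact absurd (rankedQueue_mono x h.le) (by simp only; omega)
  · simpa using hy
  · simpa using hx

/-- Only the case `n ≤ x i` with the ranked queue of `y` below `n` is in doubt. Then `n` is positive
and `x` has more queues of length at least `n` than `y`, so the inequality at level `n - 1` leaves a
slack of one at level `n`. -/
theorem Preceq.arrival {x y : State c} (h : Preceq x y) (k i : Fin c)
    (hi : x i ≤ x (rankedQueue x k)) :
    Preceq (x + Pi.single i 1) (y + Pi.single (rankedQueue y k) 1) := by
  intro n
  have hn := h n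
  rw [excess_add_single, excess_add_single]
  split_ifs with h1 h2
  · omega
  · rcases n with _ | n
    · omega
    have h3 := card_lt_card_of_rankedQueue (not_le.1 h2) (h1.trans hi)
    have h4 := h n
    rw [excess_eq_add n x, excess_eq_add n y] at h4
    omega
  · omega
  · omega

/-- Only a decrease of `y` not matched by `x` is in doubt. Then `y` has more queues of length at
least `n + 1` than `x`, so the inequality at level `n + 1` leaves a slack of one at level `n`. The
released queue of `x` is at least as long as the ranked one, so it does lose excess whenever the
ranked queue exceeds `n`. -/
theorem Preceq.service {x y x' y' : State c} (h : Preceq x y) (k : Fin c)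
    (hx : (∃ i, x (rankedQueue x k) ≤ x i ∧ x' + Pi.single i 1 = x) ∨
      (x (rankedQueue x k) = 0 ∧ x' = x))
    (hy : y' + Pi.single (rankedQueue y k) 1 = y ∨ (y (rankedQueue y k) = 0 ∧ y' = y)) :
    Preceq x' y' := by
  intro n
  have hn := h n
  have hx' : excess n x' ≤ excess n x ∧
      (n + 1 ≤ x (rankedQueue x k) → excess n x = excess n x' + 1) := by
    rcases hx with ⟨i, hi, rfl⟩ | ⟨h0, rfl⟩
    · rw [excess_add_single]
      simp only [Pi.add_apply, Pi.single_eq_same] at hi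
      split_ifs with h1
      · omega
      · simp only [Pi.add_apply] at *
        omega
    · exact ⟨le_rfl, fun h1 => by omega⟩
  have hy' : excess n y' = excess n y ∨
      (n + 1 ≤ y (rankedQueue y k) ∧ excess n y = excess n y' + 1) := by
    rcases hy with hy | ⟨h0, rfl⟩
    · have h1 := congrFun hy (rankedQueue y k)
      simp only [Pi.add_apply, Pi.single_eq_same] at h1
      have h2 := excess_add_single n y' (rankedQueue y k)
      rw [hy] at h2
      split_ifs at h2 <;> omega
    · exact Or.inl rfl
  rcases hy' with hy' | ⟨hy1, hy2⟩
  · omega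
  · by_cases h1 : n + 1 ≤ x (rankedQueue x k)
    · have := hx'.2 h1; omega
    · have h3 := card_lt_card_of_rankedQueue (not_le.1 h1) hy1
      have h4 := h (n + 1)
      rw [excess_eq_add n x, excess_eq_add n y] at hn
      rw [excess_eq_add n x] at hx'
      rw [excess_eq_add n y] at hy2
      omega

/-- Induction along the path: both processes are driven by the same points, so at each instant the
left limits are ordered and undergo the same type of event with the same rank. -/
theorem Follows.preceq {Ω : Type*} {pol : Policy c} {arr srv : MarkedPoints Ω (Mark c)}
    {X Y : ℝ≥0 → Ω → State c} (hX : Follows pol arr srv X)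
    (hY : Follows (Policy.uniformRouting c) arr srv Y) (ω : Ω) (h0 : Preceq (X 0 ω) (Y 0 ω)) :
    ∀ t, Preceq (X t ω) (Y t ω) := by
  refine forall_of_right_of_left h0 (fun t ht => ?_) fun t ht hlt => ?_
  · refine eventually_nhdsWithin_iff.2 ?_
    filter_upwards [(hX.cadlag ω).eventually_nhds t, (hY.cadlag ω).eventually_nhds t]
      with u h1 h2 hu
    rw [h1.2 hu.le, h2.2 hu.le]; exact ht
  set x := Function.leftLim (fun u => X u ω) t with hx
  set y := Function.leftLim (fun u => Y u ω) t with hy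
  have hxy : Preceq x y := by
    have := neBot_nhdsWithin_Iio ht
    have h1 : ∀ᶠ u in 𝓝[<] t, X u ω = x ∧ Y u ω = y := by
      refine eventually_nhdsWithin_iff.2 ?_
      filter_upwards [(hX.cadlag ω).eventually_nhds t, (hY.cadlag ω).eventually_nhds t]
        with u h1 h2 hu
      exact ⟨h1.1 hu, h2.1 hu⟩
    obtain ⟨u, ⟨h1, h2⟩, hu⟩ := (h1.and self_mem_nhdsWithin).exists
    rw [← h1, ← h2]; exact hlt u hu
  by_cases ha : ∃ n, t = arr.T n ω
  · obtain ⟨n, rfl⟩ := ha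
    rw [hX.arrival ω n x hx, hY.arrival ω n y hy]
    exact hxy.arrival _ _ (pol.route_le _ _ _)
  by_cases hs : ∃ n, t = srv.T n ω
  · obtain ⟨n, rfl⟩ := hs
    refine hxy.service (srv.mark n ω).1 ?_ ?_
    · rcases Nat.eq_zero_or_pos (x (rankedQueue x (srv.mark n ω).1)) with h | h
      · exact Or.inr ⟨h, hX.idle ω n x hx h⟩
      · exact Or.inl ⟨_, pol.le_release _ _ _ h, hX.service ω n x hx h⟩
    · rcases Nat.eq_zero_or_pos (y (rankedQueue y (srv.mark n ω).1)) with h | h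
      · exact Or.inr ⟨h, hY.idle ω n y hy h⟩
      · exact Or.inl (hY.service ω n y hy h)
  rw [hX.no_event ω t (by simpa using ha) (by simpa using hs),
    hY.no_event ω t (by simpa using ha) (by simpa using hs)]
  exact hxy

end Preorder


/-! ### Measurability and Riemann sums along càdlàg paths -/

section Riemann

theorem abs_intervalIntegral_le {S : Type*} {x : ℝ≥0 → S} {a : S → ℝ} {K : ℝ}
    (ha : ∀ y, |a y| ≤ K) {s t : ℝ} (h : s ≤ t) :
    |∫ u in s..t, a (x u.toNNReal)| ≤ K * (t - s) := by
  have := intervalIntegral.norm_integral_le_of_norm_le_const (a := s) (b := t) (C := K)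
    (f := fun u => a (x u.toNNReal)) fun u _ => ha _
  rwa [abs_of_nonneg (sub_nonneg.2 h)] at this

variable {S : Type*} [TopologicalSpace S] [DiscreteTopology S]

/-- Each instant has a neighbourhood in which it is the only possible discontinuity. By the Lindelöf
property countably many such neighbourhoods cover the line, so every discontinuity is one of their
centres. -/
theorem IsCadlag.countable_not_eventually_eq {x : ℝ≥0 → S} (hx : IsCadlag x) :
    {u | ¬ ∀ᶠ v in 𝓝 u, x v = x u}.Countable := by
  choose O hO hOo hOm using fun u => eventually_nhds_iff.1 (hx.eventually_nhds u)
  obtain ⟨s, hs, hcov⟩ := TopologicalSpace.countable_cover_nhds fun u => (hOo u).mem_nhds (hOm u)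
  refine hs.mono fun v hv => ?_
  obtain ⟨u, hu, hvu⟩ : ∃ u ∈ s, v ∈ O u := by
    simpa using (hcov ▸ Set.mem_univ v : v ∈ ⋃ u ∈ s, O u)
  rcases lt_trichotomy v u with h | h | h
  · refine absurd ?_ hv
    filter_upwards [(hOo u).mem_nhds hvu, Iio_mem_nhds h] with w hw hwu
    rw [(hO u w hw).1 hwu, (hO u v hvu).1 h]
  · exact h ▸ hu
  · refine absurd ?_ hv
    filter_upwards [(hOo u).mem_nhds hvu, Ioi_mem_nhds h] with w hw hwu
    rw [(hO u w hw).2 (le_of_lt hwu), (hO u v hvu).2 h.le]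

variable [MeasurableSpace S] [DiscreteMeasurableSpace S] [Countable S]

/-- Joint measurability, needed for Fubini's theorem, comes from rounding time up to a grid: the
rounded instants approach from the right, where the path is eventually constant. -/
theorem measurable_uncurry_of_isCadlag {Ω : Type*} [MeasurableSpace Ω] {X : ℝ≥0 → Ω → S}
    (hX : ∀ t, Measurable (X t)) (hc : ∀ ω, IsCadlag fun t => X t ω) :
    Measurable fun p : ℝ≥0 × Ω => X p.1 p.2 := by
  set q : ℕ → ℝ≥0 → ℝ≥0 := fun n u => (⌊u * (n + 1)⌋₊ + 1) / (n + 1) with hq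
  have hpos : ∀ n : ℕ, (0 : ℝ≥0) < n + 1 := fun n => by positivity
  have hlt : ∀ n u, u ≤ q n u := fun n u => by
    rw [hq, le_div_iff₀ (hpos n)]; exact (Nat.lt_floor_add_one _).le
  have hle : ∀ n u, q n u ≤ u + 1 / (n + 1) := fun n u => by
    rw [hq, div_le_iff₀ (hpos n), add_mul, one_div, inv_mul_cancel₀ (hpos n).ne']
    gcongr
    exact Nat.floor_le zero_le
  have hten : ∀ u, Tendsto (fun n => q n u) atTop (𝓝 u) := fun u => by
    refine tendsto_of_tendsto_of_tendsto_of_le_of_le tendsto_const_nhds ?_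
      (fun n => hlt n u) (fun n => hle n u)
    have : Tendsto (fun n : ℕ => (1 : ℝ≥0) / (n + 1)) atTop (𝓝 0) := by
      rw [← NNReal.tendsto_coe]; push_cast; exact tendsto_one_div_add_atTop_nhds_zero_nat
    simpa using tendsto_const_nhds.add this
  refine measurable_to_countable' fun y => ?_
  have hset : (fun p : ℝ≥0 × Ω => X p.1 p.2) ⁻¹' {y} =
      {p | ∀ᶠ n in atTop, X (q n p.1) p.2 = y} := by
    ext ⟨u, ω⟩
    have hev : ∀ᶠ n in atTop, X (q n u) ω = X u ω := by
      filter_upwards [(hten u).eventually ((hc ω).eventually_nhds u)] with n hn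
      exact hn.2 (hlt n u)
    simp only [Set.mem_preimage, Set.mem_singleton_iff, Set.mem_ofPred_eq]
    constructor
    · rintro rfl; exact hev
    · intro h
      obtain ⟨n, hn1, hn2⟩ := (h.and hev).exists
      rw [← hn2, hn1]
  have hm : ∀ n, MeasurableSet {p : ℝ≥0 × Ω | X (q n p.1) p.2 = y} := fun n => by
    have h1 : Measurable fun p : ℕ × Ω => X ((p.1 + 1) / (n + 1)) p.2 :=
      measurable_from_prod_countable_right fun k => hX ((k + 1) / (n + 1))
    have h2 : Measurable fun p : ℝ≥0 × Ω => (⌊p.1 * (n + 1)⌋₊, p.2) :=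
      (Nat.measurable_floor.comp (measurable_fst.mul_const _)).prodMk measurable_snd
    exact (h1.comp h2) (measurableSet_singleton y)
  rw [hset]
  have : {p : ℝ≥0 × Ω | ∀ᶠ n in atTop, X (q n p.1) p.2 = y} =
      ⋃ N : ℕ, ⋂ n ≥ N, {p | X (q n p.1) p.2 = y} := by
    ext p; simp [eventually_atTop]
  rw [this]
  exact MeasurableSet.iUnion fun N => MeasurableSet.biInter (Set.to_countable _) fun n _ => hm n

theorem IsCadlag.measurable {x : ℝ≥0 → S} (hx : IsCadlag x) : Measurable x :=
  (measurable_uncurry_of_isCadlag (Ω := Unit) (X := fun t _ => x t) (fun _ => measurable_const)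
    fun _ => hx).comp (measurable_id.prodMk (measurable_const (a := ())))

theorem IsCadlag.intervalIntegrable {x : ℝ≥0 → S} (hx : IsCadlag x) {a : S → ℝ} {K : ℝ}
    (ha : ∀ y, |a y| ≤ K) (s t : ℝ) :
    IntervalIntegrable (fun u => a (x u.toNNReal)) volume s t := by
  have hm : Measurable fun u : ℝ => a (x u.toNNReal) :=
    Measurable.of_discrete.comp (hx.measurable.comp measurable_real_toNNReal)
  refine (intervalIntegrable_const (c := K)).mono_fun' hm.aestronglyMeasurable ?_
  exact ae_of_all _ fun u => ha _

/-- Riemann sums along a càdlàg path with values in a countable discrete space. -/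
theorem IsCadlag.tendsto_sum_grid {x : ℝ≥0 → S} (hx : IsCadlag x) {g a : S → ℝ} {C K : ℝ}
    (hg : ∀ y, |g y| ≤ C) (ha : ∀ y, |a y| ≤ K) {s t : ℝ≥0} (hst : s ≤ t) :
    Tendsto (fun n : ℕ => ∑ k ∈ Finset.range n, g (x (grid s t n k)) *
      ∫ u in (grid s t n k : ℝ)..(grid s t n (k + 1)), a (x u.toNNReal)) atTop
      (𝓝 (∫ u in (s : ℝ)..t, g (x u.toNNReal) * a (x u.toNNReal))) := by
  rcases hst.eq_or_lt with rfl | hlt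
  · simp [grid]
  have hd : (0 : ℝ) < (t : ℝ) - s := sub_pos.2 (NNReal.coe_lt_coe.2 hlt)
  -- The index of the cell containing `u`. The ceiling minus one makes the cells open on the left
  -- and closed on the right, as interval integrals require.
  set j : ℕ → ℝ → ℕ := fun n u => ⌈(u - s) * n / ((t : ℝ) - s)⌉₊ - 1 with hj
  have hjeq : ∀ n : ℕ, 0 < n → ∀ k : ℕ, ∀ u : ℝ, (grid s t n k : ℝ) < u → u ≤ grid s t n (k + 1) →
      j n u = k := by
    intro n hn k u h1 h2
    have hn' : (0 : ℝ) < n := by exact_mod_cast hn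
    rw [coe_grid hst] at h1 h2
    have h3 : ⌈(u - s) * n / ((t : ℝ) - s)⌉₊ = k + 1 := by
      rw [Nat.ceil_eq_iff (Nat.succ_ne_zero k)]
      constructor
      · rw [lt_div_iff₀ hd]
        have : (k : ℝ) * ((t : ℝ) - s) / n < u - s := by
          rw [mul_div_assoc]; linarith
        rw [div_lt_iff₀ hn'] at this
        simpa using this
      · rw [div_le_iff₀ hd]
        have : u - s ≤ ((k + 1 : ℕ) : ℝ) * ((t : ℝ) - s) / n := by
          rw [mul_div_assoc]; linarith
        rw [le_div_iff₀ hn'] at this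
        exact this
    rw [hj]; simp only [h3]; omega
  have hxm : Measurable fun u : ℝ => x u.toNNReal := hx.measurable.comp measurable_real_toNNReal
  have hsum : ∀ n : ℕ, 0 < n → ∑ k ∈ Finset.range n, g (x (grid s t n k)) *
      ∫ u in (grid s t n k : ℝ)..(grid s t n (k + 1)), a (x u.toNNReal) =
      ∫ u in (s : ℝ)..t, g (x (grid s t n (j n u))) * a (x u.toNNReal) := by
    intro n hn
    have hcongr : ∀ k : ℕ, Set.EqOn (fun u : ℝ => g (x (grid s t n k)) * a (x u.toNNReal))
        (fun u => g (x (grid s t n (j n u))) * a (x u.toNNReal))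
        (Set.uIoc (grid s t n k : ℝ) (grid s t n (k + 1))) := by
      intro k u hu
      rw [Set.uIoc_of_le (NNReal.coe_le_coe.2 (grid_mono s t n k.le_succ))] at hu
      simp only [hjeq n hn k u hu.1 hu.2]
    have hint : ∀ k < n, IntervalIntegrable
        (fun u : ℝ => g (x (grid s t n (j n u))) * a (x u.toNNReal)) volume
        (grid s t n k : ℝ) (grid s t n (k + 1)) := fun k _ =>
      ((hx.intervalIntegrable ha _ _).const_mul _).congr (hcongr k)
    have := intervalIntegral.sum_integral_adjacent_intervals hint
    rw [grid_self hst hn.ne', grid_zero] at this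
    rw [← this]
    refine Finset.sum_congr rfl fun k _ => ?_
    rw [← intervalIntegral.integral_const_mul]
    exact intervalIntegral.integral_congr_ae (ae_of_all _ (hcongr k))
  refine Tendsto.congr' (f₁ := fun n => ∫ u in (s : ℝ)..t, g (x (grid s t n (j n u))) *
    a (x u.toNNReal)) ?_ ?_
  · filter_upwards [eventually_gt_atTop 0] with n hn using (hsum n hn).symm
  refine intervalIntegral.tendsto_integral_filter_of_dominated_convergence (fun _ => C * K)
    (Eventually.of_forall fun n => ?_) (Eventually.of_forall fun n => ae_of_all _ fun u _ => ?_)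
    intervalIntegrable_const ?_
  · have h1 : Measurable fun u => g (x (grid s t n (j n u))) := by
      have : Measurable (j n) := by
        have h0 : Measurable fun u : ℝ => ⌈(u - s) * n / ((t : ℝ) - s)⌉₊ := by fun_prop
        exact (Measurable.of_discrete (f := fun m : ℕ => m - 1)).comp h0
      exact (Measurable.of_discrete (f := fun m => g (x (grid s t n m)))).comp this
    exact (h1.mul (Measurable.of_discrete.comp hxm)).aestronglyMeasurable
  · rw [Real.norm_eq_abs, abs_mul]
    exact mul_le_mul (hg _) (ha _) (abs_nonneg _) ((abs_nonneg _).trans (hg (x 0)))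
  -- Discontinuities are countable, hence Lebesgue-null. Elsewhere the path at the left end of the
  -- cell of `u` eventually equals the path at `u`.
  · have hD := (hx.countable_not_eventually_eq.image ((↑) : ℝ≥0 → ℝ)).ae_notMem volume
    filter_upwards [hD] with u hu hut
    rw [Set.uIoc_of_le (NNReal.coe_le_coe.2 hst)] at hut
    have hu0 : 0 ≤ u := s.2.trans hut.1.le
    have hev : ∀ᶠ v in 𝓝 u.toNNReal, x v = x u.toNNReal := by
      by_contra h
      exact hu ⟨u.toNNReal, h, Real.coe_toNNReal u hu0⟩
    have hten : Tendsto (fun n => grid s t n (j n u)) atTop (𝓝 u.toNNReal) := by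
      rw [← NNReal.tendsto_coe, Real.coe_toNNReal u hu0]
      have hlow : Tendsto (fun n : ℕ => u - ((t : ℝ) - s) / n) atTop (𝓝 u) := by
        simpa using tendsto_const_nhds.sub (tendsto_const_div_atTop_nhds_zero_nat ((t : ℝ) - s))
      have key : ∀ n : ℕ, 0 < n → u - ((t : ℝ) - s) / n ≤ grid s t n (j n u) ∧
          (grid s t n (j n u) : ℝ) ≤ u := by
        intro n hn
        have hn' : (0 : ℝ) < n := by exact_mod_cast hn
        set v := (u - s) * n / ((t : ℝ) - s) with hv
        have hvpos : 0 < v := by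
          have := hut.1
          rw [hv]; exact div_pos (mul_pos (by linarith) hn') hd
        have huv : u = s + v * (((t : ℝ) - s) / n) := by
          rw [hv]; field_simp; ring
        have hj1 : 1 ≤ ⌈v⌉₊ := Nat.one_le_ceil_iff.2 hvpos
        have hjv : (j n u : ℝ) = ⌈v⌉₊ - 1 := by
          rw [hj]; simp only; rw [Nat.cast_sub hj1, Nat.cast_one]
        have h1 : v ≤ ⌈v⌉₊ := Nat.le_ceil v
        have h2 : (⌈v⌉₊ : ℝ) < v + 1 := Nat.ceil_lt_add_one hvpos.le
        have hdn : 0 < ((t : ℝ) - s) / n := by positivity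
        rw [coe_grid hst, hjv]
        constructor <;> nlinarith
      refine tendsto_of_tendsto_of_tendsto_of_le_of_le' hlow tendsto_const_nhds ?_ ?_
      · filter_upwards [eventually_gt_atTop 0] with n hn using (key n hn).1
      · filter_upwards [eventually_gt_atTop 0] with n hn using (key n hn).2
    refine tendsto_const_nhds.congr' ?_
    filter_upwards [hten.eventually hev] with n hn
    rw [hn]

end Riemann


/-! ### Integration against counting processes with an intensity -/

section Intensity

variable {Ω : Type*} {m : MeasurableSpace Ω} {P : Measure Ω} {F : Filtration ℝ≥0 m}

/-- Martingale increments are orthogonal to bounded factors known at the start of the increment. -/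
theorem setIntegral_mul_martingale_sub [IsFiniteMeasure P] {M : ℝ≥0 → Ω → ℝ}
    (hM : Martingale M F P) {a b : ℝ≥0} (hab : a ≤ b) {Z : Ω → ℝ} (hZ : Measurable[F a] Z) {C : ℝ}
    (hC : ∀ ω, |Z ω| ≤ C) {G : Set Ω} (hG : MeasurableSet[F a] G) :
    ∫ ω in G, Z ω * (M b ω - M a ω) ∂P = 0 := by
  have hint : Integrable (M b - M a) P := (hM.integrable b).sub (hM.integrable a)
  have hint' : Integrable (Z * (M b - M a)) P :=
    hint.bdd_mul (hZ.mono (F.le a) le_rfl).aestronglyMeasurable (ae_of_all _ hC)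
  have h1 : P[Z * (M b - M a) | F a] =ᵐ[P] Z * P[M b - M a | F a] :=
    condExp_mul_of_stronglyMeasurable_left hZ.stronglyMeasurable hint' hint
  have h2 : P[M b - M a | F a] =ᵐ[P] 0 := by
    refine (condExp_sub (hM.integrable b) (hM.integrable a) _).trans ?_
    filter_upwards [hM.2 a b hab, hM.2 a a le_rfl] with ω h1 h2
    simp [h1, h2]
  have h3 := setIntegral_condExp (F.le a) hint' hG
  rw [show (fun ω => Z ω * (M b ω - M a ω)) = Z * (M b - M a) from rfl, ← h3]
  rw [setIntegral_congr_ae (g := fun _ => (0 : ℝ)) (F.le a _ hG)]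
  · simp
  · filter_upwards [h1, h2] with ω h1 h2 _
    rw [h1, Pi.mul_apply, h2]; simp

variable {S : Type*} [TopologicalSpace S] [DiscreteTopology S]
  [MeasurableSpace S] [DiscreteMeasurableSpace S] [Countable S]
  {X : ℝ≥0 → Ω → S} {N : ℝ≥0 → Ω → ℕ} {r : S → ℝ} {K : ℝ}

/-- The integral is a limit of Riemann sums that look at the process only at instants up to `t`. -/
theorem measurable_intervalIntegral (hX : Adapted F X) (hc : ∀ ω, IsCadlag fun t => X t ω)
    (hr : ∀ y, |r y| ≤ K) {s t : ℝ≥0} (hst : s ≤ t) :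
    Measurable[F t] fun ω => ∫ u in (s : ℝ)..t, r (X u.toNNReal ω) := by
  refine @measurable_of_tendsto_metrizable _ _ (F t) _ _ _ _
    (fun n ω => ∑ k ∈ Finset.range n, r (X (grid s t n k) ω) *
      ∫ u in (grid s t n k : ℝ)..(grid s t n (k + 1)), (1 : ℝ)) _ (fun n => ?_) ?_
  · refine Finset.measurable_sum _ fun k hk => Measurable.mul_const ?_ _
    exact Measurable.of_discrete.comp
      ((hX _).mono (F.mono (grid_le hst (Finset.mem_range.1 hk).le)) le_rfl)
  · refine tendsto_pi_nhds.2 fun ω => ?_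
    simpa using (hc ω).tendsto_sum_grid hr (a := fun _ => 1) (K := 1) (by simp) hst

theorem abs_setIntegral_le [IsProbabilityMeasure P] {f : Ω → ℝ} {C : ℝ} (hC0 : 0 ≤ C)
    (hf : ∀ ω, |f ω| ≤ C) (G : Set Ω) : |∫ ω in G, f ω ∂P| ≤ C := by
  have h := norm_setIntegral_le_of_norm_le_const (μ := P) (s := G) (f := f) (C := C)
    (measure_lt_top _ _) fun ω _ => hf ω
  refine h.trans ?_
  exact mul_le_of_le_one_right hC0 measureReal_le_one

theorem HasIntensity.integrable [IsFiniteMeasure P] (hN : HasIntensity F P N fun t ω => r (X t ω))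
    (hX : Adapted F X) (hc : ∀ ω, IsCadlag fun t => X t ω) (hr : ∀ y, |r y| ≤ K) (t : ℝ≥0) :
    Integrable (fun ω => (N t ω : ℝ)) P := by
  have h1 := Martingale.integrable hN t
  have h2 : Integrable (fun ω => ∫ u in (0 : ℝ)..t, r (X u.toNNReal ω)) P := by
    refine Integrable.of_bound (C := K * t) ?_ (ae_of_all _ fun ω => ?_)
    · have := measurable_intervalIntegral hX hc hr (zero_le (a := t))
      exact (this.mono (F.le t) le_rfl).aestronglyMeasurable
    · simpa using abs_intervalIntegral_le (x := fun u => X u ω) hr t.2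
  exact (h1.add h2).congr (ae_of_all _ fun ω => by simp)

/-- With the factor `g` frozen at the left end `a`, a counting increment may be replaced by its
compensator. On grids this avoids stochastic integrals. -/
theorem HasIntensity.setIntegral_mul_sub [IsFiniteMeasure P]
    (hN : HasIntensity F P N fun t ω => r (X t ω))
    (hX : Adapted F X) (hc : ∀ ω, IsCadlag fun t => X t ω) (hr : ∀ y, |r y| ≤ K)
    {a b : ℝ≥0} (hab : a ≤ b) {g : S → ℝ} {C : ℝ} (hg : ∀ y, |g y| ≤ C) {G : Set Ω}
    (hG : MeasurableSet[F a] G) :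
    ∫ ω in G, g (X a ω) * ((N b ω : ℝ) - N a ω) ∂P =
      ∫ ω in G, g (X a ω) * (∫ u in (a : ℝ)..b, r (X u.toNNReal ω)) ∂P := by
  have hZ : Measurable[F a] fun ω => g (X a ω) := Measurable.of_discrete.comp (hX a)
  have hZm : AEStronglyMeasurable (fun ω => g (X a ω)) P :=
    (hZ.mono (F.le a) le_rfl).aestronglyMeasurable
  have key := setIntegral_mul_martingale_sub hN hab hZ (fun ω => hg _) hG
  have hi1 : Integrable (fun ω => g (X a ω) * ((N b ω : ℝ) - N a ω)) P :=
    ((hN.integrable hX hc hr b).sub (hN.integrable hX hc hr a)).bdd_mul hZm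
      (ae_of_all _ fun ω => hg _)
  have hi2 : Integrable (fun ω => g (X a ω) * ∫ u in (a : ℝ)..b, r (X u.toNNReal ω)) P := by
    refine Integrable.bdd_mul ?_ hZm (ae_of_all _ fun ω => hg _)
    refine Integrable.of_bound (C := K * (b - a)) ?_ (ae_of_all _ fun ω => ?_)
    · exact ((measurable_intervalIntegral hX hc hr hab).mono (F.le b) le_rfl).aestronglyMeasurable
    · exact abs_intervalIntegral_le (x := fun u => X u ω) hr (NNReal.coe_le_coe.2 hab)
  rw [← sub_eq_zero, ← integral_sub hi1.integrableOn hi2.integrableOn, ← key]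
  refine integral_congr_ae (ae_of_all _ fun ω => ?_)
  have := intervalIntegral.integral_add_adjacent_intervals
    ((hc ω).intervalIntegrable hr 0 a) ((hc ω).intervalIntegrable hr a b)
  simp only
  rw [← this]; ring

theorem tendsto_setIntegral_sum_grid [IsProbabilityMeasure P]
    (hX : Adapted F X) (hc : ∀ ω, IsCadlag fun t => X t ω) (hr : ∀ y, |r y| ≤ K)
    {s t : ℝ≥0} (hst : s ≤ t) {g : S → ℝ} {C : ℝ} (hg : ∀ y, |g y| ≤ C) (G : Set Ω) :
    Tendsto (fun n : ℕ => ∫ ω in G, (∑ k ∈ Finset.range n, g (X (grid s t n k) ω) *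
      ∫ u in (grid s t n k : ℝ)..(grid s t n (k + 1)), r (X u.toNNReal ω)) ∂P) atTop
      (𝓝 (∫ ω in G, (∫ u in (s : ℝ)..t, g (X u.toNNReal ω) * r (X u.toNNReal ω)) ∂P)) := by
  refine tendsto_integral_of_dominated_convergence (fun _ => C * (K * (t - s))) (fun n => ?_)
    (integrable_const _) (fun n => ae_of_all _ fun ω => ?_) (ae_of_all _ fun ω => ?_)
  · refine Finset.aestronglyMeasurable_fun_sum _ fun k hk => ?_
    refine AEStronglyMeasurable.mul ?_ ?_
    · exact (Measurable.of_discrete.comp ((hX _).mono (F.le _) le_rfl)).aestronglyMeasurable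
    · exact ((measurable_intervalIntegral hX hc hr (grid_mono s t n k.le_succ)).mono (F.le _)
        le_rfl).aestronglyMeasurable
  · rw [Real.norm_eq_abs]
    refine (Finset.abs_sum_le_sum_abs _ _).trans ?_
    have hC : 0 ≤ C := (abs_nonneg _).trans (hg (X 0 ω))
    calc _ ≤ ∑ k ∈ Finset.range n, C * (K * ((t - s : ℝ) / n)) := by
          refine Finset.sum_le_sum fun k _ => ?_
          rw [abs_mul]
          refine mul_le_mul (hg _) ?_ (abs_nonneg _) hC
          rw [← grid_succ_sub hst n k]
          exact abs_intervalIntegral_le (x := fun u => X u ω) hr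
            (NNReal.coe_le_coe.2 (grid_mono s t n k.le_succ))
      _ ≤ _ := by
          rw [Finset.sum_const, Finset.card_range, nsmul_eq_mul]
          rcases Nat.eq_zero_or_pos n with rfl | hn
          -- With no cells the sum is empty, and only the nonnegativity of the bound is at stake.
          · have hK : 0 ≤ K := (abs_nonneg _).trans (hr (X 0 ω))
            have : (0 : ℝ) ≤ t - s := sub_nonneg.2 (NNReal.coe_le_coe.2 hst)
            simp; positivity
          · have : (n : ℝ) ≠ 0 := by positivity
            field_simp; rfl
  · exact (hc ω).tendsto_sum_grid hg hr hst

end Intensity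


/-! ### Jump processes with state-dependent intensities -/

section JumpDynamics

/-- The process `X` jumps from `y` to `target κ y` whenever the counting process `N κ`, of intensity
`rate κ (X t)`, jumps. -/
structure JumpDynamics {Ω : Type*} {m : MeasurableSpace Ω} {S : Type*} [TopologicalSpace S]
    [MeasurableSpace S] {κ : Type*} (F : Filtration ℝ≥0 m) (P : Measure Ω) (X : ℝ≥0 → Ω → S)
    (N : κ → ℝ≥0 → Ω → ℕ) (target : κ → S → S) (rate : κ → S → ℝ) : Prop where
  adapted : Adapted F X
  cadlag : ∀ ω, IsCadlag fun t => X t ω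
  counting : ∀ k, IsCountingProcess F (N k)
  intensity : ∀ k, HasIntensity F P (N k) fun t ω => rate k (X t ω)
  jump : ∀ ω t, ((∀ k, N k t ω = Function.leftLim (fun u => N k u ω) t) ∧
      X t ω = Function.leftLim (fun u => X u ω) t) ∨
    ∃ k, N k t ω = Function.leftLim (fun u => N k u ω) t + 1 ∧
      (∀ l, l ≠ k → N l t ω = Function.leftLim (fun u => N l u ω) t) ∧
      X t ω = target k (Function.leftLim (fun u => X u ω) t)

theorem IsCountingProcess.isCadlag {Ω : Type*} {m : MeasurableSpace Ω} {F : Filtration ℝ≥0 m}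
    {N : ℝ≥0 → Ω → ℕ} (hN : IsCountingProcess F N) (ω : Ω) : IsCadlag fun t => N t ω :=
  isCadlag_of_monotone (hN.mono ω) (hN.right_continuous ω)

/-- The generator of the jump process. -/
def generator {S κ : Type*} [Fintype κ] (target : κ → S → S) (rate : κ → S → ℝ) (f : S → ℝ) :
    S → ℝ := fun y => ∑ k, (f (target k y) - f y) * rate k y

/-- The semigroup of the jump process. -/
def semigroup {S κ : Type*} [Fintype κ] (target : κ → S → S) (rate : κ → S → ℝ) (τ : ℝ)
    (f : S → ℝ) : S → ℝ :=
  fun y => ∑' n : ℕ, τ ^ n / n.factorial * (generator target rate)^[n] f y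

variable {Ω : Type*} {m : MeasurableSpace Ω} {P : Measure Ω} {F : Filtration ℝ≥0 m}
  {S : Type*} [TopologicalSpace S] [DiscreteTopology S]
  [MeasurableSpace S] [DiscreteMeasurableSpace S] [Countable S]
  {κ : Type*} [Fintype κ] {X : ℝ≥0 → Ω → S}
  {N : κ → ℝ≥0 → Ω → ℕ} {target : κ → S → S} {rate : κ → S → ℝ} {K : ℝ}

/-! ### Boundedness of the generator and convergence of its exponential series -/

section Bounds

variable {S κ : Type*} [Fintype κ] {target : κ → S → S} {rate : κ → S → ℝ} {K : ℝ}

/-- The constant `2 * Fintype.card κ * K` bounds the norm of the generator on bounded functions: two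
values of `f` for each type of jump, weighted by a rate of at most `K`. Boundedness makes the
exponential series converge. -/
theorem abs_generator_le (hr : ∀ k y, |rate k y| ≤ K) {f : S → ℝ} {C : ℝ} (hf : ∀ y, |f y| ≤ C)
    (y : S) : |generator target rate f y| ≤ 2 * Fintype.card κ * K * C := by
  have hC : 0 ≤ C := (abs_nonneg _).trans (hf y)
  refine (Finset.abs_sum_le_sum_abs _ _).trans ?_
  calc _ ≤ ∑ _k : κ, (2 * C) * K := by
        refine Finset.sum_le_sum fun k _ => ?_
        rw [abs_mul]
        refine mul_le_mul ?_ (hr _ _) (abs_nonneg _) (by positivity)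
        have h1 := abs_sub (f (target k y)) (f y)
        linarith [hf (target k y), hf y]
    _ = _ := by rw [Finset.sum_const, Finset.card_univ, nsmul_eq_mul]; ring

theorem abs_iterate_generator_le (hr : ∀ k y, |rate k y| ≤ K) {f : S → ℝ} {C : ℝ}
    (hf : ∀ y, |f y| ≤ C) (n : ℕ) (y : S) :
    |(generator target rate)^[n] f y| ≤ (2 * Fintype.card κ * K) ^ n * C := by
  induction n generalizing y with
  | zero => simpa using hf y
  | succ n ih =>
    rw [Function.iterate_succ_apply']
    refine (abs_generator_le hr ih y).trans_eq ?_
    ring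

theorem abs_semigroup_term_le (hr : ∀ k y, |rate k y| ≤ K) {f : S → ℝ} {C τ : ℝ}
    (hf : ∀ y, |f y| ≤ C) (hτ : 0 ≤ τ) (n : ℕ) (y : S) :
    |τ ^ n / n.factorial * (generator target rate)^[n] f y| ≤
      C * ((2 * Fintype.card κ * K * τ) ^ n / n.factorial) := by
  rw [abs_mul, abs_of_nonneg (by positivity)]
  have := abs_iterate_generator_le (target := target) hr hf n y
  calc _ ≤ τ ^ n / n.factorial * ((2 * Fintype.card κ * K) ^ n * C) := by gcongr
    _ = _ := by rw [mul_pow _ τ]; ring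

theorem hasSum_semigroup (hr : ∀ k y, |rate k y| ≤ K) {f : S → ℝ} {C τ : ℝ}
    (hf : ∀ y, |f y| ≤ C) (hτ : 0 ≤ τ) (y : S) :
    HasSum (fun n : ℕ => τ ^ n / n.factorial * (generator target rate)^[n] f y)
      (semigroup target rate τ f y) := by
  refine Summable.hasSum ?_
  refine Summable.of_norm_bounded
    (g := fun n : ℕ => C * ((2 * Fintype.card κ * K * τ) ^ n / n.factorial)) ?_
    fun n => abs_semigroup_term_le hr hf hτ n y
  exact (Real.summable_pow_div_factorial _).mul_left _

theorem abs_sum_semigroup_le (hr : ∀ k y, |rate k y| ≤ K) (hK : 0 ≤ K) {f : S → ℝ} {C τ : ℝ}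
    (hf : ∀ y, |f y| ≤ C) (hτ : 0 ≤ τ) (n : ℕ) (y : S) :
    |∑ i ∈ Finset.range n, τ ^ i / i.factorial * (generator target rate)^[i] f y| ≤
      C * Real.exp (2 * Fintype.card κ * K * τ) := by
  have hC : 0 ≤ C := (abs_nonneg _).trans (hf y)
  refine (Finset.abs_sum_le_sum_abs _ _).trans ?_
  refine (Finset.sum_le_sum fun i _ => abs_semigroup_term_le hr hf hτ i y).trans ?_
  rw [← Finset.mul_sum]
  gcongr
  exact Real.sum_le_exp_of_nonneg (by positivity) n

theorem abs_semigroup_le (hr : ∀ k y, |rate k y| ≤ K) (hK : 0 ≤ K) {f : S → ℝ} {C τ : ℝ}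
    (hf : ∀ y, |f y| ≤ C) (hτ : 0 ≤ τ) (y : S) :
    |semigroup target rate τ f y| ≤ C * Real.exp (2 * Fintype.card κ * K * τ) :=
  le_of_tendsto (hasSum_semigroup hr hf hτ y).tendsto_sum_nat.abs
    (Eventually.of_forall fun n => abs_sum_semigroup_le hr hK hf hτ n y)

end Bounds

omit [DiscreteMeasurableSpace S] [Countable S] in
/-- On fine grids, the increments of `f ∘ X` are sums over the jumps. -/
theorem JumpDynamics.eventually_sub_eq (h : JumpDynamics F P X N target rate) (f : S → ℝ)
    {s t : ℝ≥0} (hst : s ≤ t) (ω : Ω) :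
    ∀ᶠ n in atTop, f (X t ω) - f (X s ω) = ∑ k, ∑ i ∈ Finset.range n,
      (f (target k (X (grid s t n i) ω)) - f (X (grid s t n i) ω)) *
        ((N k (grid s t n (i + 1)) ω : ℝ) - N k (grid s t n i) ω) := by
  classical
  set R : ℝ≥0 → ℝ≥0 → Prop := fun a b => f (X b ω) - f (X a ω) =
    ∑ k, (f (target k (X a ω)) - f (X a ω)) * ((N k b ω : ℝ) - N k a ω) with hRdef
  have hR : ∀ u, ∀ᶠ p in 𝓝 (u, u), p.1 ≤ p.2 → R p.1 p.2 := by
    intro u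
    refine local_of_eventually
      (L := fun v => X v ω = Function.leftLim (fun u => X u ω) u ∧
        ∀ k, N k v ω = Function.leftLim (fun u => N k u ω) u)
      (U := fun v => X v ω = X u ω ∧ ∀ k, N k v ω = N k u ω) ?_ ?_ ?_ ?_
    · filter_upwards [(h.cadlag ω).eventually_nhds u,
        eventually_all.2 fun k => ((h.counting k).isCadlag ω).eventually_nhds u] with v h1 h2
      exact ⟨fun hv => ⟨h1.1 hv, fun k => (h2 k).1 hv⟩, fun hv => ⟨h1.2 hv, fun k => (h2 k).2 hv⟩⟩
    · rintro a b ⟨ha1, ha2⟩ ⟨hb1, hb2⟩ - -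
      simp [hRdef, ha1, hb1, ha2, hb2]
    · rintro a b ⟨ha1, ha2⟩ ⟨hb1, hb2⟩ - -
      simp [hRdef, ha1, hb1, ha2, hb2]
    · rintro a b ⟨ha1, ha2⟩ ⟨hb1, hb2⟩ - -
      simp only [hRdef, ha1, ha2, hb1, hb2]
      -- At most one counter jumps at `u`, and by exactly one, so at most one term of the sum
      -- survives, and it equals the jump of `f ∘ X`.
      rcases h.jump ω u with ⟨h1, h2⟩ | ⟨k, h1, h2, h3⟩
      · simp [← h1, h2]
      · rw [Finset.sum_eq_single k]
        · rw [h1, h3]; push_cast; ring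
        · intro l _ hl
          rw [h2 l hl]; simp
        · simp
  filter_upwards [eventually_grid hR hst, eventually_gt_atTop 0] with n hn hpos
  rw [Finset.sum_comm, ← Finset.sum_congr rfl fun i hi => hn i (Finset.mem_range.1 hi),
    Finset.sum_range_sub fun i => f (X (grid s t n i) ω), grid_self hst hpos.ne', grid_zero]

/-- Dynkin's formula on events of the past. The increment of `f ∘ X` is a sum over grid cells of
frozen jump sizes times counting increments. These may be replaced by compensators cell by cell, and
the Riemann sums converge to the integral of the generator. -/
theorem JumpDynamics.setIntegral_sub [IsProbabilityMeasure P]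
    (h : JumpDynamics F P X N target rate) (hr : ∀ k y, |rate k y| ≤ K)
    {f : S → ℝ} {C : ℝ} (hf : ∀ y, |f y| ≤ C) {s t : ℝ≥0} (hst : s ≤ t) {G : Set Ω}
    (hG : MeasurableSet[F s] G) :
    ∫ ω in G, (f (X t ω) - f (X s ω)) ∂P =
      ∫ ω in G, (∫ u in (s : ℝ)..t, generator target rate f (X u.toNNReal ω)) ∂P := by
  have hg : ∀ k y, |f (target k y) - f y| ≤ 2 * C := fun k y => by
    have := abs_sub (f (target k y)) (f y)
    linarith [hf (target k y), hf y]
  have hNint := fun k t => (h.intensity k).integrable h.adapted h.cadlag (hr k) t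
  have hterm : ∀ k a b, Integrable (fun ω => (f (target k (X a ω)) - f (X a ω)) *
      ((N k b ω : ℝ) - N k a ω)) P := fun k a b => by
    refine ((hNint k b).sub (hNint k a)).bdd_mul (c := 2 * C) ?_ (ae_of_all _ fun ω => hg _ _)
    exact ((Measurable.of_discrete (f := fun y => f (target k y) - f y)).comp
      ((h.adapted a).mono (F.le _) le_rfl)).aestronglyMeasurable
  -- the left-hand side is the limit of the sums over the grids
  have hleft : Tendsto (fun n : ℕ => ∫ ω in G, (∑ k, ∑ i ∈ Finset.range n,
      (f (target k (X (grid s t n i) ω)) - f (X (grid s t n i) ω)) *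
        ((N k (grid s t n (i + 1)) ω : ℝ) - N k (grid s t n i) ω)) ∂P) atTop
      (𝓝 (∫ ω in G, (f (X t ω) - f (X s ω)) ∂P)) := by
    -- The counters are monotone, so the absolute sums telescope and are dominated by `2 * C` times
    -- the integrable numbers of jumps in `(s, t]`.
    refine tendsto_integral_of_dominated_convergence
      (fun ω => ∑ k, 2 * C * ((N k t ω : ℝ) - N k s ω)) (fun n => ?_) ?_ (fun n => ?_) ?_
    · exact (integrable_finsetSum _ fun k _ => integrable_finsetSum _ fun i _ =>
        hterm k _ _).aestronglyMeasurable.restrict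
    · exact (integrable_finsetSum _ fun k _ =>
        ((hNint k t).sub (hNint k s)).const_mul _).integrableOn
    · refine ae_of_all _ fun ω => ?_
      rw [Real.norm_eq_abs]
      refine (Finset.abs_sum_le_sum_abs _ _).trans (Finset.sum_le_sum fun k _ => ?_)
      refine (Finset.abs_sum_le_sum_abs _ _).trans ?_
      have hmono := fun {a b : ℝ≥0} (hab : a ≤ b) => (h.counting k).mono ω hab
      have hC : 0 ≤ 2 * C := (abs_nonneg _).trans (hg k (X 0 ω))
      calc _ ≤ ∑ i ∈ Finset.range n, 2 * C * ((N k (grid s t n (i + 1)) ω : ℝ) -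
            N k (grid s t n i) ω) := by
            refine Finset.sum_le_sum fun i _ => ?_
            have h1 : (0 : ℝ) ≤ (N k (grid s t n (i + 1)) ω : ℝ) - N k (grid s t n i) ω :=
              sub_nonneg.2 (by exact_mod_cast hmono (grid_mono s t n i.le_succ))
            rw [abs_mul, abs_of_nonneg h1]
            exact mul_le_mul_of_nonneg_right (hg _ _) h1
        _ = 2 * C * ((N k (grid s t n n) ω : ℝ) - N k s ω) := by
            rw [← Finset.mul_sum, Finset.sum_range_sub fun i => (N k (grid s t n i) ω : ℝ),
              grid_zero]
        _ ≤ _ := by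
            have h1 : (N k (grid s t n n) ω : ℝ) ≤ N k t ω := by
              exact_mod_cast hmono (grid_le hst le_rfl)
            gcongr
    · refine ae_of_all _ fun ω => ?_
      refine tendsto_const_nhds.congr' ?_
      filter_upwards [h.eventually_sub_eq f hst ω] with n hn using hn
  have hright : Tendsto (fun n : ℕ => ∫ ω in G, (∑ k, ∑ i ∈ Finset.range n,
      (f (target k (X (grid s t n i) ω)) - f (X (grid s t n i) ω)) *
        ((N k (grid s t n (i + 1)) ω : ℝ) - N k (grid s t n i) ω)) ∂P) atTop
      (𝓝 (∑ k, ∫ ω in G, (∫ u in (s : ℝ)..t, (f (target k (X u.toNNReal ω)) - f (X u.toNNReal ω)) *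
        rate k (X u.toNNReal ω)) ∂P)) := by
    have := tendsto_finsetSum (Finset.univ : Finset κ) fun k _ =>
      tendsto_setIntegral_sum_grid (P := P) h.adapted h.cadlag (hr k) hst (hg k) G
    refine this.congr fun n => ?_
    rw [integral_finsetSum _ fun k _ => (integrable_finsetSum _ fun i _ =>
        hterm k _ _).integrableOn]
    refine Finset.sum_congr rfl fun k _ => ?_
    rw [integral_finsetSum _ fun i _ => (hterm k _ _).integrableOn, integral_finsetSum]
    · refine Finset.sum_congr rfl fun i _ => ?_
      exact ((h.intensity k).setIntegral_mul_sub h.adapted h.cadlag (hr k)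
        (grid_mono s t n i.le_succ) (g := fun y => f (target k y) - f y) (hg k)
        (F.mono (le_grid s t n i) _ hG)).symm
    · intro i _
      refine Integrable.integrableOn ?_
      refine Integrable.bdd_mul (c := 2 * C) ?_ ?_ (ae_of_all _ fun ω => hg _ _)
      · have hab : grid s t n i ≤ grid s t n (i + 1) := grid_mono s t n i.le_succ
        refine Integrable.of_bound (C := K * (grid s t n (i + 1) - grid s t n i)) ?_
          (ae_of_all _ fun ω => ?_)
        · exact ((measurable_intervalIntegral h.adapted h.cadlag (hr k) hab).mono (F.le _)
            le_rfl).aestronglyMeasurable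
        · exact abs_intervalIntegral_le (x := fun u => X u ω) (hr k) (NNReal.coe_le_coe.2 hab)
      · exact ((Measurable.of_discrete (f := fun y => f (target k y) - f y)).comp
          ((h.adapted _).mono (F.le _) le_rfl)).aestronglyMeasurable
  rw [tendsto_nhds_unique hleft hright]
  have hb : ∀ k y, |(f (target k y) - f y) * rate k y| ≤ 2 * C * K := fun k y => by
    rw [abs_mul]
    exact mul_le_mul (hg k y) (hr k y) (abs_nonneg _) ((abs_nonneg _).trans (hg k y))
  rw [← integral_finsetSum]
  · refine integral_congr_ae (ae_of_all _ fun ω => ?_)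
    simp only [generator]
    rw [intervalIntegral.integral_finsetSum]
    intro k _
    exact (h.cadlag ω).intervalIntegrable (hb k) _ _
  · intro k _
    refine Integrable.integrableOn ?_
    refine Integrable.of_bound (C := 2 * C * K * (t - s)) ?_ (ae_of_all _ fun ω => ?_)
    · exact ((measurable_intervalIntegral h.adapted h.cadlag (hb k) hst).mono (F.le _)
        le_rfl).aestronglyMeasurable
    · exact abs_intervalIntegral_le (x := fun u => X u ω) (hb k) (NNReal.coe_le_coe.2 hst)

end JumpDynamics


/-! ### Transition semigroup, Markov property and uniqueness in law -/

section JumpDynamics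

variable {Ω : Type*} {m : MeasurableSpace Ω} {P : Measure Ω} {F : Filtration ℝ≥0 m}
  {S : Type*} [TopologicalSpace S] [DiscreteTopology S]
  [MeasurableSpace S] [DiscreteMeasurableSpace S] [Countable S]
  {κ : Type*} [Fintype κ] {X : ℝ≥0 → Ω → S}
  {N : κ → ℝ≥0 → Ω → ℕ} {target : κ → S → S} {rate : κ → S → ℝ} {K : ℝ}

theorem intervalIntegrable_setIntegral [IsProbabilityMeasure P] (hX : ∀ t, Measurable (X t))
    (hc : ∀ ω, IsCadlag fun t => X t ω) {f : S → ℝ} {C : ℝ} (hf : ∀ y, |f y| ≤ C) (hC : 0 ≤ C)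
    (G : Set Ω) (s t : ℝ) :
    IntervalIntegrable (fun u : ℝ => ∫ ω in G, f (X u.toNNReal ω) ∂P) volume s t := by
  have h1 : Measurable fun p : ℝ × Ω => f (X p.1.toNNReal p.2) :=
    (Measurable.of_discrete (f := f)).comp ((measurable_uncurry_of_isCadlag hX hc).comp
      ((measurable_real_toNNReal.comp measurable_fst).prodMk measurable_snd))
  refine (intervalIntegrable_const (c := C)).mono_fun' ?_ (ae_of_all _ fun u => ?_)
  · exact (h1.stronglyMeasurable.integral_prod_right (ν := P.restrict G)).aestronglyMeasurable
  · exact abs_setIntegral_le hC (fun ω => hf _) G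

theorem setIntegral_intervalIntegral_comm [IsProbabilityMeasure P] (hX : ∀ t, Measurable (X t))
    (hc : ∀ ω, IsCadlag fun t => X t ω) {f : S → ℝ} {C : ℝ} (hf : ∀ y, |f y| ≤ C)
    (G : Set Ω) {s t : ℝ} (hst : s ≤ t) :
    ∫ ω in G, (∫ u in s..t, f (X u.toNNReal ω)) ∂P =
      ∫ u in s..t, (∫ ω in G, f (X u.toNNReal ω) ∂P) := by
  have h1 : Measurable fun p : Ω × ℝ => f (X p.2.toNNReal p.1) :=
    (Measurable.of_discrete (f := f)).comp ((measurable_uncurry_of_isCadlag hX hc).comp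
      ((measurable_real_toNNReal.comp measurable_snd).prodMk measurable_fst))
  simp only [intervalIntegral.integral_of_le hst]
  refine integral_integral_swap ?_
  exact Integrable.of_bound h1.aestronglyMeasurable C (ae_of_all _ fun p => hf _)

theorem JumpDynamics.setIntegral_eq_add [IsProbabilityMeasure P]
    (h : JumpDynamics F P X N target rate) (hr : ∀ k y, |rate k y| ≤ K)
    {f : S → ℝ} {C : ℝ} (hf : ∀ y, |f y| ≤ C) {s t : ℝ≥0} (hst : s ≤ t) {G : Set Ω}
    (hG : MeasurableSet[F s] G) :
    ∫ ω in G, f (X t ω) ∂P = ∫ ω in G, f (X s ω) ∂P +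
      ∫ u in (s : ℝ)..t, (∫ ω in G, generator target rate f (X u.toNNReal ω) ∂P) := by
  have hm : ∀ t, Measurable (X t) := fun t => (h.adapted t).mono (F.le t) le_rfl
  have hint : ∀ t, Integrable (fun ω => f (X t ω)) P := fun t =>
    Integrable.of_bound (Measurable.of_discrete.comp (hm t)).aestronglyMeasurable C
      (ae_of_all _ fun ω => hf _)
  rw [← setIntegral_intervalIntegral_comm hm h.cadlag (abs_generator_le hr hf) G
    (NNReal.coe_le_coe.2 hst), ← h.setIntegral_sub hr hf hst hG,
    integral_sub (hint t).integrableOn (hint s).integrableOn]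
  ring

/-- A Taylor expansion with remainder, by iterating Dynkin's formula: the remainder of order `n + 1`
for `f` is the time integral of the remainder of order `n` for its image under the generator. Each
stage contributes a factor `2 * Fintype.card κ * K` and one more integration of a power, whence the
factorial. -/
theorem JumpDynamics.abs_setIntegral_sub_le [IsProbabilityMeasure P]
    (h : JumpDynamics F P X N target rate) (hr : ∀ k y, |rate k y| ≤ K) (hK : 0 ≤ K)
    {s : ℝ≥0} {G : Set Ω} (hG : MeasurableSet[F s] G) (n : ℕ)
    {f : S → ℝ} {C : ℝ} (hC : 0 ≤ C) (hf : ∀ y, |f y| ≤ C) {t : ℝ≥0} (hst : s ≤ t) :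
    |∫ ω in G, f (X t ω) ∂P - ∑ i ∈ Finset.range n, ((t : ℝ) - s) ^ i / i.factorial *
      ∫ ω in G, (generator target rate)^[i] f (X s ω) ∂P| ≤
      C * ((2 * Fintype.card κ * K * (t - s)) ^ n / n.factorial) := by
  have hm : ∀ t, Measurable (X t) := fun t => (h.adapted t).mono (F.le t) le_rfl
  induction n generalizing f C t with
  | zero => simpa using abs_setIntegral_le hC (fun ω => hf (X t ω)) G
  | succ n ih =>
    set M := 2 * Fintype.card κ * K with hM
    have hM0 : 0 ≤ M := by positivity
    have hLf := abs_generator_le (target := target) hr hf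
    have hfac : ∀ i : ℕ, ((i + 1).factorial : ℝ) = (i + 1) * i.factorial := fun i => by
      rw [Nat.factorial_succ]; push_cast; ring
    have hpow : ∀ (i : ℕ) (a : ℝ), ∫ u in (s : ℝ)..t, (u - s) ^ i / i.factorial * a =
        ((t : ℝ) - s) ^ (i + 1) / (i + 1).factorial * a := fun i a => by
      rw [intervalIntegral.integral_mul_const, intervalIntegral.integral_div,
        intervalIntegral.integral_comp_sub_right fun u => u ^ i, integral_pow, hfac]
      have := Nat.factorial_pos i
      field_simp
      ring
    have hii : ∀ (i : ℕ) (a : ℝ),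
        IntervalIntegrable (fun u : ℝ => (u - s) ^ i / i.factorial * a) volume s t := fun i a =>
      Continuous.intervalIntegrable (by fun_prop) _ _
    have hid : ∫ ω in G, f (X t ω) ∂P - ∑ i ∈ Finset.range (n + 1),
        ((t : ℝ) - s) ^ i / i.factorial * ∫ ω in G, (generator target rate)^[i] f (X s ω) ∂P =
        ∫ u in (s : ℝ)..t, ((∫ ω in G, generator target rate f (X u.toNNReal ω) ∂P) -
          ∑ i ∈ Finset.range n, (u - s) ^ i / i.factorial *
            ∫ ω in G, (generator target rate)^[i] (generator target rate f) (X s ω) ∂P) := by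
      rw [intervalIntegral.integral_sub
        (intervalIntegrable_setIntegral hm h.cadlag hLf (by positivity) G _ _),
        intervalIntegral.integral_finsetSum fun i _ => hii i _, h.setIntegral_eq_add hr hf hst hG,
        Finset.sum_range_succ']
      · simp only [hpow, Function.iterate_succ_apply, pow_zero, Nat.factorial_zero, Nat.cast_one,
          div_one, one_mul, Function.iterate_zero, id]
        ring
      · exact Continuous.intervalIntegrable (by fun_prop) _ _
    rw [hid]
    have hle : (s : ℝ) ≤ t := NNReal.coe_le_coe.2 hst
    have hnorm := intervalIntegral.norm_integral_le_of_norm_le (a := (s : ℝ)) (b := t) (μ := volume)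
      (f := fun u => (∫ ω in G, generator target rate f (X u.toNNReal ω) ∂P) -
          ∑ i ∈ Finset.range n, (u - s) ^ i / i.factorial *
            ∫ ω in G, (generator target rate)^[i] (generator target rate f) (X s ω) ∂P)
      (g := fun u => (u - s) ^ n / n.factorial * (M * C * M ^ n)) hle
      (ae_of_all _ fun u hu => ?_) (hii n _)
    · rw [Real.norm_eq_abs] at hnorm
      refine hnorm.trans_eq ?_
      rw [hpow, mul_pow M]; ring
    · have hu0 : 0 ≤ u := s.2.trans hu.1.le
      have hsu : s ≤ u.toNNReal := by
        rw [← NNReal.coe_le_coe, Real.coe_toNNReal u hu0]; exact hu.1.le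
      have := ih (f := generator target rate f) (C := M * C) (by positivity) hLf hsu
      rw [Real.coe_toNNReal u hu0] at this
      rw [Real.norm_eq_abs]
      refine this.trans_eq ?_
      rw [mul_pow M]; ring

/-- The transition semigroup of a jump process. -/
theorem JumpDynamics.setIntegral_eq_semigroup [IsProbabilityMeasure P]
    (h : JumpDynamics F P X N target rate) (hr : ∀ k y, |rate k y| ≤ K) (hK : 0 ≤ K)
    {f : S → ℝ} {C : ℝ} (hf : ∀ y, |f y| ≤ C) (hC : 0 ≤ C) {s t : ℝ≥0} (hst : s ≤ t) {G : Set Ω}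
    (hG : MeasurableSet[F s] G) :
    ∫ ω in G, f (X t ω) ∂P = ∫ ω in G, semigroup target rate (t - s) f (X s ω) ∂P := by
  have hm : ∀ t, Measurable (X t) := fun t => (h.adapted t).mono (F.le t) le_rfl
  have hτ : (0 : ℝ) ≤ t - s := sub_nonneg.2 (NNReal.coe_le_coe.2 hst)
  have hint : ∀ i, Integrable (fun ω => (generator target rate)^[i] f (X s ω)) P := fun i =>
    Integrable.of_bound (Measurable.of_discrete.comp (hm s)).aestronglyMeasurable _
      (ae_of_all _ fun ω => abs_iterate_generator_le hr hf i _)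
  have h1 : Tendsto (fun n => ∑ i ∈ Finset.range n, ((t : ℝ) - s) ^ i / i.factorial *
      ∫ ω in G, (generator target rate)^[i] f (X s ω) ∂P) atTop (𝓝 (∫ ω in G, f (X t ω) ∂P)) := by
    have h0 := (FloorSemiring.tendsto_pow_div_factorial_atTop
      (2 * Fintype.card κ * K * ((t : ℝ) - s))).const_mul C
    rw [mul_zero] at h0
    rw [tendsto_iff_norm_sub_tendsto_zero]
    refine squeeze_zero (fun n => norm_nonneg _) (fun n => ?_) h0
    rw [norm_sub_rev]
    exact h.abs_setIntegral_sub_le hr hK hG n hC hf hst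
  refine tendsto_nhds_unique h1 ?_
  have h2 : Tendsto (fun n => ∫ ω in G, (∑ i ∈ Finset.range n, ((t : ℝ) - s) ^ i / i.factorial *
      (generator target rate)^[i] f (X s ω)) ∂P) atTop
      (𝓝 (∫ ω in G, semigroup target rate (t - s) f (X s ω) ∂P)) := by
    refine tendsto_integral_of_dominated_convergence
      (fun _ => C * Real.exp (2 * Fintype.card κ * K * (t - s))) (fun n => ?_)
      (integrable_const _) (fun n => ae_of_all _ fun ω => abs_sum_semigroup_le hr hK hf hτ n _)
      (ae_of_all _ fun ω => (hasSum_semigroup hr hf hτ _).tendsto_sum_nat)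
    exact (integrable_finsetSum _ fun i _ =>
      (hint i).const_mul _).aestronglyMeasurable.restrict
  refine h2.congr fun n => ?_
  rw [integral_finsetSum _ fun i _ => ((hint i).const_mul _).integrableOn]
  simp only [integral_const_mul]

/-- The semigroup applied at `X s` has the right integrals over all events of `F s` and is already
measurable for `X s`. It is therefore a version of both conditional expectations. -/
theorem JumpDynamics.isMarkov [IsProbabilityMeasure P]
    (h : JumpDynamics F P X N target rate) (hr : ∀ k y, |rate k y| ≤ K) (hK : 0 ≤ K) :
    IsMarkov F P X := by
  classical
  intro s t hst B hB
  have hm : ∀ t, Measurable (X t) := fun t => (h.adapted t).mono (F.le t) le_rfl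
  have hτ : (0 : ℝ) ≤ t - s := sub_nonneg.2 (NNReal.coe_le_coe.2 hst)
  set f : S → ℝ := B.indicator fun _ => 1 with hfdef
  have hf : ∀ y, |f y| ≤ 1 := fun y => by
    rw [hfdef, Set.indicator_apply]; split_ifs <;> simp
  have hfX : (X t ⁻¹' B).indicator (fun _ => (1 : ℝ)) = fun ω => f (X t ω) := by
    ext ω; simp [hfdef, Set.indicator_apply]
  have hint : ∀ t (g : S → ℝ) (C : ℝ), (∀ y, |g y| ≤ C) → Integrable (fun ω => g (X t ω)) P :=
    fun t g C hg => Integrable.of_bound (Measurable.of_discrete.comp (hm t)).aestronglyMeasurable C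
      (ae_of_all _ fun ω => hg _)
  have hQ := abs_semigroup_le (target := target) hr hK hf hτ
  have hcomap : MeasurableSpace.comap (X s) inferInstance ≤ F s := (h.adapted s).comap_le
  rw [hfX]
  have key : ∀ m' : MeasurableSpace Ω, MeasurableSpace.comap (X s) inferInstance ≤ m' →
      m' ≤ F s → (fun ω => semigroup target rate (t - s) f (X s ω)) =ᵐ[P]
        P[fun ω => f (X t ω) | m'] := by
    intro m' h1 h2
    refine ae_eq_condExp_of_forall_setIntegral_eq (h2.trans (F.le s)) (hint t f 1 hf)
      (fun G _ _ => (hint s _ _ hQ).integrableOn) (fun G hG _ => ?_) ?_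
    · exact (h.setIntegral_eq_semigroup hr hK hf zero_le_one hst (h2 _ hG)).symm
    · have : Measurable[m'] (X s) := (comap_measurable (X s)).mono h1 le_rfl
      have h3 : StronglyMeasurable[m'] fun ω => semigroup target rate (t - s) f (X s ω) :=
        ((Measurable.of_discrete (f := semigroup target rate (t - s) f)).comp this).stronglyMeasurable
      exact h3.aestronglyMeasurable
  exact (key _ hcomap le_rfl).symm.trans (key _ le_rfl hcomap)

/-- Jump processes with the same rates and the same initial law have the same finite-dimensional
laws. -/
theorem JumpDynamics.setIntegral_congr [IsProbabilityMeasure P]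
    (h : JumpDynamics F P X N target rate) (hr : ∀ k y, |rate k y| ≤ K) (hK : 0 ≤ K)
    {Ω' : Type*} {m' : MeasurableSpace Ω'} {P' : Measure Ω'} {F' : Filtration ℝ≥0 m'}
    [IsProbabilityMeasure P'] {X' : ℝ≥0 → Ω' → S} {N' : κ → ℝ≥0 → Ω' → ℕ}
    (h' : JumpDynamics F' P' X' N' target rate) (h0 : P'.map (X' 0) = P.map (X 0))
    (x : ℝ≥0 → S) (I : Finset ℝ≥0) :
    ∀ (u : ℝ≥0), (∀ v ∈ I, v ≤ u) → ∀ (f : S → ℝ) (C : ℝ), 0 ≤ C → (∀ y, |f y| ≤ C) →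
      ∫ ω in {ω | ∀ v ∈ I, X v ω = x v}, f (X u ω) ∂P =
        ∫ ω in {ω | ∀ v ∈ I, X' v ω = x v}, f (X' u ω) ∂P' := by
  classical
  have hm : ∀ t, Measurable (X t) := fun t => (h.adapted t).mono (F.le t) le_rfl
  have hm' : ∀ t, Measurable (X' t) := fun t => (h'.adapted t).mono (F'.le t) le_rfl
  induction I using Finset.induction_on_max with
  | empty =>
    intro u _ f C hC hf
    simp only [Finset.notMem_empty, false_imp_iff, implies_true, Set.ofPred_true]
    rw [h.setIntegral_eq_semigroup hr hK hf hC (zero_le (a := u)) MeasurableSet.univ,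
      h'.setIntegral_eq_semigroup hr hK hf hC (zero_le (a := u)) MeasurableSet.univ,
      setIntegral_univ, setIntegral_univ,
      ← integral_map (hm 0).aemeasurable Measurable.of_discrete.aestronglyMeasurable, ← h0,
      integral_map (hm' 0).aemeasurable Measurable.of_discrete.aestronglyMeasurable]
  | insert a I hlt ih =>
    intro u hu f C hC hf
    have hau : a ≤ u := hu a (Finset.mem_insert_self a I)
    have hτ : (0 : ℝ) ≤ u - a := sub_nonneg.2 (NNReal.coe_le_coe.2 hau)
    have hmeas : MeasurableSet[F a] {ω | ∀ v ∈ insert a I, X v ω = x v} := by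
      have : {ω | ∀ v ∈ insert a I, X v ω = x v} = ⋂ v ∈ insert a I, X v ⁻¹' {x v} := by
        ext; simp
      rw [this]
      refine Finset.measurableSet_biInter _ fun v hv => ?_
      have hva : v ≤ a := by
        rcases Finset.mem_insert.1 hv with rfl | hv
        · exact le_rfl
        · exact (hlt v hv).le
      exact F.mono hva _ (h.adapted v (measurableSet_singleton _))
    have hmeas' : MeasurableSet[F' a] {ω | ∀ v ∈ insert a I, X' v ω = x v} := by
      have : {ω | ∀ v ∈ insert a I, X' v ω = x v} = ⋂ v ∈ insert a I, X' v ⁻¹' {x v} := by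
        ext; simp
      rw [this]
      refine Finset.measurableSet_biInter _ fun v hv => ?_
      have hva : v ≤ a := by
        rcases Finset.mem_insert.1 hv with rfl | hv
        · exact le_rfl
        · exact (hlt v hv).le
      exact F'.mono hva _ (h'.adapted v (measurableSet_singleton _))
    rw [h.setIntegral_eq_semigroup hr hK hf hC hau hmeas,
      h'.setIntegral_eq_semigroup hr hK hf hC hau hmeas']
    -- Conditioning at the latest instant `a` replaces `f (X u)` by `Q (X a)`. The constraint at `a`
    -- is absorbed into the test function as an indicator, and the induction hypothesis applies with
    -- final instant `a`.
    set Q := semigroup target rate (u - a) f with hQ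
    have hQb : ∀ y, |({x a} : Set S).indicator Q y| ≤
        C * Real.exp (2 * Fintype.card κ * K * (u - a)) := fun y => by
      rw [Set.indicator_apply]
      split_ifs
      · exact abs_semigroup_le hr hK hf hτ y
      · simp only [abs_zero]; positivity
    have hI := ih a (fun v hv => (hlt v hv).le) _ _ (by positivity) hQb
    have e1 : {ω | ∀ v ∈ insert a I, X v ω = x v} =
        {ω | ∀ v ∈ I, X v ω = x v} ∩ X a ⁻¹' {x a} := by
      ext ω; simp [and_comm]
    have e2 : {ω | ∀ v ∈ insert a I, X' v ω = x v} =
        {ω | ∀ v ∈ I, X' v ω = x v} ∩ X' a ⁻¹' {x a} := by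
      ext ω; simp [and_comm]
    rw [e1, e2, ← setIntegral_indicator (hm a (measurableSet_singleton _)),
      ← setIntegral_indicator (hm' a (measurableSet_singleton _))]
    exact hI

/-- The law on path space is the projective limit of its finite-dimensional marginals, and these
live on countable sets, so it suffices to compare the masses of singletons. -/
theorem JumpDynamics.identDistrib [IsProbabilityMeasure P]
    (h : JumpDynamics F P X N target rate) (hr : ∀ k y, |rate k y| ≤ K) (hK : 0 ≤ K)
    {Ω' : Type*} {m' : MeasurableSpace Ω'} {P' : Measure Ω'} {F' : Filtration ℝ≥0 m'}
    [IsProbabilityMeasure P'] {X' : ℝ≥0 → Ω' → S} {N' : κ → ℝ≥0 → Ω' → ℕ}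
    (h' : JumpDynamics F' P' X' N' target rate) (h0 : P'.map (X' 0) = P.map (X 0)) :
    IdentDistrib (fun ω t => X t ω) (fun ω t => X' t ω) P P' := by
  have hm : ∀ t, Measurable (X t) := fun t => (h.adapted t).mono (F.le t) le_rfl
  have hm' : ∀ t, Measurable (X' t) := fun t => (h'.adapted t).mono (F'.le t) le_rfl
  have hp : AEMeasurable (fun ω t => X t ω) P := (measurable_pi_lambda _ hm).aemeasurable
  have hp' : AEMeasurable (fun ω t => X' t ω) P' := (measurable_pi_lambda _ hm').aemeasurable
  refine ⟨hp, hp', ?_⟩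
  refine (isProjectiveLimit_map hp).unique ?_
  convert isProjectiveLimit_map hp' using 1
  ext1 I
  rcases isEmpty_or_nonempty S with hS | ⟨⟨y₀⟩⟩
  · obtain ⟨ω⟩ := nonempty_of_isProbabilityMeasure P
    exact (hS.false (X 0 ω)).elim
  refine Measure.ext_of_singleton fun y => ?_
  -- The value `y₀` outside `I` plays no role; it only extends `y` to all instants.
  set x : ℝ≥0 → S := fun v => if hv : v ∈ I then y ⟨v, hv⟩ else y₀ with hx
  have key := h.setIntegral_congr hr hK h' h0 x I (I.sup id) (fun v hv => Finset.le_sup (f := id) hv)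
    (fun _ => 1) 1 zero_le_one (by simp)
  simp only [integral_const, smul_eq_mul, mul_one, measureReal_restrict_apply_univ] at key
  have e : {ω | ∀ v ∈ I, X v ω = x v} = (fun ω => I.restrict fun t => X t ω) ⁻¹' {y} := by
    ext ω
    simp only [Set.mem_ofPred_eq, Set.mem_preimage, Set.mem_singleton_iff, funext_iff,
      Subtype.forall, Finset.restrict]
    refine forall₂_congr fun v hv => ?_
    simp [hx, hv]
  have e' : {ω | ∀ v ∈ I, X' v ω = x v} = (fun ω => I.restrict fun t => X' t ω) ⁻¹' {y} := by
    ext ω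
    simp only [Set.mem_ofPred_eq, Set.mem_preimage, Set.mem_singleton_iff, funext_iff,
      Subtype.forall, Finset.restrict]
    refine forall₂_congr fun v hv => ?_
    simp [hx, hv]
  rw [e, e', measureReal_eq_measureReal_iff] at key
  rw [Measure.map_apply, Measure.map_apply, key]
  · exact measurable_pi_lambda _ fun i => hm' i
  · exact measurableSet_singleton y
  · exact measurable_pi_lambda _ fun i => hm i
  · exact measurableSet_singleton y

end JumpDynamics


/-! ### Load balancing networks as jump processes -/

section Network

variable {c : ℕ}

/-- In discrete spaces left limits at positive instants are attained just before, so they commute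
with arbitrary functions of finitely many paths. -/
theorem leftLim_comp {κ S S' : Type*} [Finite κ] [TopologicalSpace S] [DiscreteTopology S]
    [TopologicalSpace S'] [DiscreteTopology S'] {x : κ → ℝ≥0 → S} (hx : ∀ k, IsCadlag (x k))
    (Φ : (κ → S) → S') (t : ℝ≥0) :
    Function.leftLim (fun u => Φ fun k => x k u) t = Φ fun k => Function.leftLim (x k) t := by
  rcases eq_or_lt_of_le (zero_le (a := t)) with rfl | ht
  · simp only [leftLim_zero]
  · have := neBot_nhdsWithin_Iio ht
    refine leftLim_eq_of_tendsto ?_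
    rw [nhds_discrete, tendsto_pure, eventually_nhdsWithin_iff]
    filter_upwards [eventually_all.2 fun k => (hx k).eventually_nhds t] with u hu hut
    congr 1
    ext k
    exact (hu k).1 hut

theorem IsCountingProcess.leftLim_le {Ω : Type*} {m : MeasurableSpace Ω} {F : Filtration ℝ≥0 m}
    {N : ℝ≥0 → Ω → ℕ} (hN : IsCountingProcess F N) (ω : Ω) (t : ℝ≥0) :
    Function.leftLim (fun u => N u ω) t ≤ N t ω :=
  (hN.mono ω).leftLim_le le_rfl

/-- Turns a bound of one on the total jump into the alternative: no counter jumps, or exactly one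
does, by one. -/
theorem eq_or_exists_of_sum_le {κ : Type*} [Fintype κ] {a b : κ → ℕ} (hab : ∀ k, b k ≤ a k)
    (h : ∑ k, a k ≤ ∑ k, b k + 1) :
    (∀ k, a k = b k) ∨ ∃ k, a k = b k + 1 ∧ ∀ l, l ≠ k → a l = b l := by
  classical
  by_cases hall : ∀ k, a k = b k
  · exact Or.inl hall
  right
  push Not at hall
  obtain ⟨k, hk⟩ := hall
  have hk' : b k + 1 ≤ a k := lt_of_le_of_ne (hab k) (Ne.symm hk)
  rw [← Finset.add_sum_erase _ a (Finset.mem_univ k),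
    ← Finset.add_sum_erase _ b (Finset.mem_univ k)] at h
  have h1 : ∑ l ∈ Finset.univ.erase k, b l ≤ ∑ l ∈ Finset.univ.erase k, a l :=
    Finset.sum_le_sum fun l _ => hab l
  refine ⟨k, by omega, fun l hl => ?_⟩
  have h2 : ∑ l ∈ Finset.univ.erase k, b l = ∑ l ∈ Finset.univ.erase k, a l := by omega
  exact ((Finset.sum_eq_sum_iff_of_le fun l _ => hab l).1 h2 l (by simp [hl])).symm

/-- The types of the events of a network: arrivals and service completions, labelled with the
chosen queue and with the queue which the policy determines. -/
abbrev EventType (c : ℕ) : Type := (Fin c × Fin c) ⊕ (Fin c × Fin c)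

/-- The effect of an event on the state. -/
def eventTarget (c : ℕ) : EventType c → State c → State c
  | .inl p => fun x => x + Pi.single p.2 1
  | .inr p => fun x => x - Pi.single p.2 1

/-- The intensity of an event. -/
def eventRate (lam : ℝ≥0) (pol : Policy c) : EventType c → State c → ℝ
  | .inl p => fun x => lam / c * pol.routeProb x p.1 p.2
  | .inr p => fun x => if 1 ≤ x p.1 then pol.releaseProb x p.1 p.2 else 0

theorem abs_eventRate_le (lam : ℝ≥0) (pol : Policy c) (k : EventType c) (x : State c) :
    |eventRate lam pol k x| ≤ lam / c + 1 := by
  have h0 : (0 : ℝ) ≤ lam / c := by positivity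
  rcases k with p | p
  · simp only [eventRate, Policy.routeProb]
    rw [abs_of_nonneg (by positivity)]
    have : (volume : Measure unitInterval).real {u | pol.route x p.1 u = p.2} ≤ 1 :=
      measureReal_le_one
    nlinarith
  · simp only [eventRate, Policy.releaseProb]
    split_ifs
    · rw [abs_of_nonneg (by positivity)]
      have : (volume : Measure unitInterval).real {u | pol.release x p.1 u = p.2} ≤ 1 :=
        measureReal_le_one
      linarith
    · rw [abs_zero]; positivity

variable {Ω : Type*} {m : MeasurableSpace Ω} {P : Measure Ω} {F : Filtration ℝ≥0 m}
  {lam : ℝ≥0} {pol : Policy c} {X : ℝ≥0 → Ω → State c}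

/-- Since events happen one at a time, each change of state is attributed to one event type, whose
rate depends only on the current state. The uniqueness result for jump processes then applies to
networks. -/
theorem NetworkEvents.jumpDynamics {A S : Fin c → Fin c → ℝ≥0 → Ω → ℕ}
    (hX : Adapted F X) (hc : ∀ ω, IsCadlag fun t => X t ω)
    (h : NetworkEvents F P lam pol X A S) :
    JumpDynamics F P X (Sum.elim (fun p => A p.1 p.2) fun p => S p.1 p.2)
      (eventTarget c) (eventRate lam pol) := by
  have hcount : ∀ k, IsCountingProcess F
      ((Sum.elim (fun p => A p.1 p.2) fun p => S p.1 p.2 : EventType c → ℝ≥0 → Ω → ℕ) k) := by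
    rintro (p | p)
    · exact h.counting_arrival _ _
    · exact h.counting_service _ _
  refine ⟨hX, hc, hcount, ?_, fun ω t => ?_⟩
  · rintro (p | p)
    · exact h.intensity_arrival p.1 p.2
    · exact h.intensity_service p.1 p.2
  · set N : EventType c → ℝ≥0 → Ω → ℕ :=
      Sum.elim (fun p => A p.1 p.2) fun p => S p.1 p.2 with hN
    have hsum : ∀ u, ∑ j, ∑ i, (A j i u ω + S j i u ω) = ∑ k, N k u ω := fun u => by
      rw [Fintype.sum_sum_type, Fintype.sum_prod_type, Fintype.sum_prod_type,
        ← Finset.sum_add_distrib]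
      refine Finset.sum_congr rfl fun j _ => ?_
      rw [← Finset.sum_add_distrib]; rfl
    have hsimple := h.simple ω t
    simp only [hsum] at hsimple
    rw [leftLim_comp (x := fun k u => N k u ω) (fun k => (hcount k).isCadlag ω)
      (fun y => ∑ k, y k)] at hsimple
    rcases eq_or_exists_of_sum_le (fun k => (hcount k).leftLim_le ω t) hsimple with h1 | ⟨k, h1, h2⟩
    · exact Or.inl ⟨h1, h.no_event ω t fun j i => ⟨h1 (.inl (j, i)), h1 (.inr (j, i))⟩⟩
    · refine Or.inr ⟨k, h1, h2, ?_⟩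
      rcases k with p | p
      · exact (h.arrival ω t p.1 p.2 (by
          change _ < N (.inl p) t ω; rw [h1]; exact Nat.lt_succ_self _)).2
      · have := (h.service ω t p.1 p.2 (by
          change _ < N (.inr p) t ω; rw [h1]; exact Nat.lt_succ_self _)).2.2
        -- The truncated subtraction in `eventTarget` is harmless here: the state before is the
        -- state after plus a unit vector.
        rw [← this]
        simp [eventTarget]

theorem NetworkEvents.isMarkov [IsProbabilityMeasure P] {A S : Fin c → Fin c → ℝ≥0 → Ω → ℕ}
    (hX : Adapted F X) (hc : ∀ ω, IsCadlag fun t => X t ω)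
    (h : NetworkEvents F P lam pol X A S) : IsMarkov F P X :=
  (h.jumpDynamics hX hc).isMarkov (abs_eventRate_le lam pol) (by positivity)

theorem IsNetwork.identDistrib [IsProbabilityMeasure P] (h : IsNetwork F P lam pol X)
    {Ω' : Type*} {m' : MeasurableSpace Ω'} {P' : Measure Ω'} {F' : Filtration ℝ≥0 m'}
    [IsProbabilityMeasure P'] {X' : ℝ≥0 → Ω' → State c} (h' : IsNetwork F' P' lam pol X')
    (h0 : P'.map (X' 0) = P.map (X 0)) :
    IdentDistrib (fun ω t => X t ω) (fun ω t => X' t ω) P P' := by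
  obtain ⟨A, S, hA⟩ := h.events
  obtain ⟨A', S', hA'⟩ := h'.events
  exact (hA.jumpDynamics h.adapted h.cadlag).identDistrib (abs_eventRate_le lam pol)
    (by positivity) (hA'.jumpDynamics h'.adapted h'.cadlag) h0

end Network


/-! ### Thinning of marked Poisson processes -/

section PathCount

variable {τ : ℕ → ℝ≥0}

theorem finite_setOf_le (hτ : Tendsto τ atTop atTop) (t : ℝ≥0) : {n | τ n ≤ t}.Finite := by
  obtain ⟨N, hN⟩ := eventually_atTop.1 (hτ.eventually_gt_atTop t)
  refine (Set.finite_lt_nat N).subset fun n hn => ?_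
  by_contra h
  exact absurd (hN n (not_lt.1 h)) (not_lt.2 hn)

/-- Only finitely many points lie below `t + 1`, so near `t` no point other than those at `t` itself
is crossed. -/
theorem eventually_forall_le_iff (hτ : Tendsto τ atTop atTop) (t : ℝ≥0) :
    ∀ᶠ u in 𝓝 t, (u < t → ∀ n, τ n ≤ u ↔ τ n < t) ∧ (t ≤ u → ∀ n, τ n ≤ u ↔ τ n ≤ t) := by
  have h1 : ∀ᶠ u in 𝓝 t, u < t + 1 := Iio_mem_nhds (by simp)
  have h2 : ∀ᶠ u in 𝓝 t, ∀ n ∈ {n | τ n ≤ t + 1}, (τ n < t → τ n < u) ∧ (t < τ n → u < τ n) := by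
    refine (finite_setOf_le hτ (t + 1)).eventually_all.2 fun n _ => ?_
    refine Eventually.and ?_ ?_
    · by_cases h : τ n < t
      · filter_upwards [Ioi_mem_nhds h] with u hu _ using hu
      · exact Eventually.of_forall fun u h' => absurd h' h
    · by_cases h : t < τ n
      · filter_upwards [Iio_mem_nhds h] with u hu _ using hu
      · exact Eventually.of_forall fun u h' => absurd h' h
  filter_upwards [h1, h2] with u hu1 hu2
  refine ⟨fun hut n => ⟨fun h => h.trans_lt hut, fun h => ((hu2 n ?_).1 h).le⟩,
    fun htu n => ⟨fun h => ?_, fun h => h.trans htu⟩⟩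
  · exact h.le.trans (by simp)
  · by_contra hn
    have : τ n ≤ t + 1 := h.trans hu1.le
    exact absurd ((hu2 n this).2 (not_le.1 hn)) (not_lt.2 h)

/-- The number of points with property `p` up to time `t`. -/
def pathCount (τ : ℕ → ℝ≥0) (p : ℕ → Prop) (t : ℝ≥0) : ℕ := Set.ncard {n | τ n ≤ t ∧ p n}

theorem pathCount_mono (hτ : Tendsto τ atTop atTop) (p : ℕ → Prop) : Monotone (pathCount τ p) :=
  fun _ _ h => Set.ncard_le_ncard (fun _ hn => ⟨hn.1.trans h, hn.2⟩)
    ((finite_setOf_le hτ _).subset fun _ hn => hn.1)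

theorem pathCount_zero (hpos : ∀ n, 0 < τ n) (p : ℕ → Prop) : pathCount τ p 0 = 0 := by
  have : {n | τ n ≤ 0 ∧ p n} = ∅ := by
    ext n; simpa using fun h => absurd h (hpos n).ne'
  rw [pathCount, this, Set.ncard_empty]

theorem pathCount_rightContinuous (hτ : Tendsto τ atTop atTop) (p : ℕ → Prop) (t : ℝ≥0) :
    ContinuousWithinAt (pathCount τ p) (Set.Ici t) t := by
  rw [ContinuousWithinAt, nhds_discrete, tendsto_pure, eventually_nhdsWithin_iff]
  filter_upwards [eventually_forall_le_iff hτ t] with u hu htu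
  simp only [pathCount, hu.2 htu]

theorem pathCount_isCadlag (hτ : Tendsto τ atTop atTop) (p : ℕ → Prop) :
    IsCadlag (pathCount τ p) :=
  isCadlag_of_monotone (pathCount_mono hτ p) (pathCount_rightContinuous hτ p)

theorem leftLim_pathCount (hτ : Tendsto τ atTop atTop) (hpos : ∀ n, 0 < τ n) (p : ℕ → Prop)
    (t : ℝ≥0) : Function.leftLim (pathCount τ p) t = Set.ncard {n | τ n < t ∧ p n} := by
  rcases eq_or_lt_of_le (zero_le (a := t)) with rfl | ht
  · rw [leftLim_zero, pathCount_zero hpos]; simp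
  · have := neBot_nhdsWithin_Iio ht
    refine leftLim_eq_of_tendsto ?_
    rw [nhds_discrete, tendsto_pure, eventually_nhdsWithin_iff]
    filter_upwards [eventually_forall_le_iff hτ t] with u hu hut
    simp only [pathCount, hu.1 hut]

theorem pathCount_eq_leftLim_add (hτ : Tendsto τ atTop atTop) (hpos : ∀ n, 0 < τ n)
    (p : ℕ → Prop) (t : ℝ≥0) : pathCount τ p t =
      Function.leftLim (pathCount τ p) t + Set.ncard {n | τ n = t ∧ p n} := by
  have hf := (finite_setOf_le hτ t)
  rw [leftLim_pathCount hτ hpos, pathCount, ← Set.ncard_union_eq ?_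
    (hf.subset fun n hn => hn.1.le) (hf.subset fun n hn => hn.1.le)]
  · congr 1
    ext n
    simp only [Set.mem_ofPred_eq, Set.mem_union, le_iff_lt_or_eq]
    tauto
  · rw [Set.disjoint_left]
    rintro n ⟨h1, -⟩ ⟨h2, -⟩
    exact h1.ne h2

theorem exists_of_leftLim_lt_pathCount (hτ : Tendsto τ atTop atTop) (hpos : ∀ n, 0 < τ n)
    {p : ℕ → Prop} {t : ℝ≥0} (h : Function.leftLim (pathCount τ p) t < pathCount τ p t) :
    ∃ n, τ n = t ∧ p n := by
  by_contra! hcon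
  rw [pathCount_eq_leftLim_add hτ hpos] at h
  have : {n | τ n = t ∧ p n} = ∅ := by ext n; simpa using hcon n
  rw [this] at h
  simp at h

theorem leftLim_lt_pathCount (hτ : Tendsto τ atTop atTop) (hpos : ∀ n, 0 < τ n)
    {p : ℕ → Prop} {n : ℕ} (hn : p n) :
    Function.leftLim (pathCount τ p) (τ n) < pathCount τ p (τ n) := by
  rw [pathCount_eq_leftLim_add hτ hpos]
  have : 0 < Set.ncard {k | τ k = τ n ∧ p k} :=
    (Set.ncard_pos ((finite_setOf_le hτ (τ n)).subset fun k hk => hk.1.le)).2 ⟨n, rfl, hn⟩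
  omega

theorem pathCount_le_leftLim_add_one (hτ : Tendsto τ atTop atTop) (hpos : ∀ n, 0 < τ n)
    (hinj : Function.Injective τ) (p : ℕ → Prop) (t : ℝ≥0) :
    pathCount τ p t ≤ Function.leftLim (pathCount τ p) t + 1 := by
  rw [pathCount_eq_leftLim_add hτ hpos]
  gcongr
  exact (Set.ncard_le_one ((finite_setOf_le hτ t).subset fun k hk => hk.1.le)).2
    fun a ha b hb => hinj (ha.1.trans hb.1.symm)

end PathCount


/-! ### Mean of the Poisson law -/

section Poisson

theorem hasSum_mean_poissonMeasure (r : ℝ≥0) :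
    HasSum (fun n : ℕ => Real.exp (-r) * r ^ n / n.factorial * (n : ℝ)) r := by
  have h := (hasSum_one_poissonMeasure r).mul_left (r : ℝ)
  rw [mul_one] at h
  have h2 : HasSum (fun n : ℕ => Real.exp (-r) * (r : ℝ) ^ (n + 1) / (n + 1).factorial *
      ((n + 1 : ℕ) : ℝ)) r := by
    refine h.congr_fun fun n => ?_
    have h0 : (n.factorial : ℝ) ≠ 0 := by positivity
    have h1 : (n : ℝ) + 1 ≠ 0 := by positivity
    rw [Nat.factorial_succ]
    push_cast
    field_simp
    ring
  simpa using (hasSum_nat_add_iff' (f := fun n : ℕ => Real.exp (-r) * (r : ℝ) ^ n / n.factorial *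
    (n : ℝ)) 1).1 (by simpa using h2)

theorem integrable_cast_poissonMeasure (r : ℝ≥0) :
    Integrable (fun n : ℕ => (n : ℝ)) (poissonMeasure r) := by
  rw [integrable_poissonMeasure_iff]
  simpa using (hasSum_mean_poissonMeasure r).summable

theorem integral_cast_poissonMeasure (r : ℝ≥0) : ∫ n : ℕ, (n : ℝ) ∂(poissonMeasure r) = r := by
  rw [integral_poissonMeasure]
  simpa using (hasSum_mean_poissonMeasure r).tsum_eq

end Poisson

/-! ### State-dependent thinning and its intensity -/

section Thinning

/-- With countably many states, measurability is checked on each event where the state is fixed. -/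
theorem measurable_apply_of_countable {Ω S β : Type*} {mΩ : MeasurableSpace Ω} [MeasurableSpace S]
    [Countable S] [MeasurableSingletonClass S] [MeasurableSpace β] {f : S → Ω → β}
    (hf : ∀ x, Measurable (f x)) {X : Ω → S} (hX : Measurable X) :
    Measurable fun ω => f (X ω) ω :=
  (measurable_from_prod_countable_right (f := fun p : S × Ω => f p.1 p.2) hf).comp
    (hX.prodMk measurable_id)

variable {Ω E : Type*}

theorem MarkedPoints.count_zero_eq {N : MarkedPoints Ω E} {ω : Ω} (hpos : ∀ n, 0 < N.T n ω)
    (t : ℝ≥0) (B : Set E) :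
    N.count 0 t B ω = pathCount (fun n => N.T n ω) (fun n => N.mark n ω ∈ B) t := by
  simp [MarkedPoints.count, pathCount, hpos]

theorem MarkedPoints.count_add {N : MarkedPoints Ω E} {ω : Ω}
    (hT : Tendsto (fun n => N.T n ω) atTop atTop) {s t u : ℝ≥0} (hst : s ≤ t) (htu : t ≤ u)
    (B : Set E) : N.count s t B ω + N.count t u B ω = N.count s u B ω := by
  have hf := fun v => finite_setOf_le hT v
  rw [MarkedPoints.count, MarkedPoints.count, MarkedPoints.count, ← Set.ncard_union_eq ?_
    ((hf t).subset fun n hn => hn.2.1) ((hf u).subset fun n hn => hn.2.1)]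
  · congr 1
    ext n
    simp only [Set.mem_union, Set.mem_ofPred_eq]
    constructor
    · rintro (⟨h1, h2, h3⟩ | ⟨h1, h2, h3⟩)
      · exact ⟨h1, h2.trans htu, h3⟩
      · exact ⟨hst.trans_lt h1, h2, h3⟩
    · rintro ⟨h1, h2, h3⟩
      rcases le_or_gt (N.T n ω) t with h | h
      · exact Or.inl ⟨h1, h, h3⟩
      · exact Or.inr ⟨h, h2, h3⟩
  · rw [Set.disjoint_left]
    rintro n ⟨-, h1, -⟩ ⟨h2, -, -⟩
    exact absurd h1 (not_le.2 h2)

/-- The number of points up to time `t` whose mark belongs to the set `B x`, where `x` is the state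
of `X` just before the point. -/
def MarkedPoints.thinned {S : Type*} [TopologicalSpace S] (N : MarkedPoints Ω E)
    (X : ℝ≥0 → Ω → S) (B : S → Set E) (t : ℝ≥0) (ω : Ω) : ℕ :=
  pathCount (fun n => N.T n ω)
    (fun n => N.mark n ω ∈ B (Function.leftLim (fun u => X u ω) (N.T n ω))) t

variable {m : MeasurableSpace Ω} [MeasurableSpace E] {P : Measure Ω} {F : Filtration ℝ≥0 m}
  {r : ℝ≥0} {ν : Measure E} {N : MarkedPoints Ω E}

theorem IsMarkedPoisson.measurable_count (hN : IsMarkedPoisson F P r ν N) {s t : ℝ≥0} (hst : s ≤ t)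
    {B : Set E} (hB : MeasurableSet B) : Measurable[F t] (N.count s t B) := by
  have : N.count s t B = fun ω => N.count 0 t B ω - N.count 0 s B ω := by
    ext ω
    rw [← MarkedPoints.count_add (hN.tendsto ω) zero_le hst]
    omega
  rw [this]
  exact (hN.adapted t B hB).sub ((hN.adapted s B hB).mono (F.mono hst) le_rfl)

theorem IsMarkedPoisson.sigmaIoc_le (hN : IsMarkedPoisson F P r ν N) (s t : ℝ≥0) :
    N.sigmaIoc s t ≤ m := by
  refine iSup_le fun u => iSup_le fun hu => iSup_le fun B => iSup_le fun hB => ?_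
  exact ((hN.measurable_count hu.1 hB).mono (F.le u) le_rfl).comap_le

theorem MarkedPoints.measurable_count_sigmaIoc (N : MarkedPoints Ω E) {s t u : ℝ≥0} (hsu : s ≤ u)
    (hut : u ≤ t) {B : Set E} (hB : MeasurableSet B) :
    Measurable[N.sigmaIoc s t] (N.count s u B) := by
  rw [measurable_iff_comap_le]
  exact le_iSup_of_le u (le_iSup_of_le ⟨hsu, hut⟩ (le_iSup_of_le B (le_iSup_of_le hB le_rfl)))

theorem IsMarkedPoisson.integrable_count [IsFiniteMeasure P] (hN : IsMarkedPoisson F P r ν N)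
    {s t : ℝ≥0} (hst : s ≤ t) {B : Set E} (hB : MeasurableSet B) :
    Integrable (fun ω => (N.count s t B ω : ℝ)) P := by
  have h := hN.law s t hst B hB
  have h1 := integrable_cast_poissonMeasure (r * (ν B).toNNReal * (t - s))
  rw [← h.map_eq] at h1
  exact h1.comp_aemeasurable h.aemeasurable

theorem IsMarkedPoisson.integral_count [IsFiniteMeasure P] (hN : IsMarkedPoisson F P r ν N)
    {s t : ℝ≥0} (hst : s ≤ t) {B : Set E} (hB : MeasurableSet B) :
    ∫ ω, (N.count s t B ω : ℝ) ∂P = r * ν.real B * (t - s) := by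
  have h := hN.law s t hst B hB
  have h1 := integral_cast_poissonMeasure (r * (ν B).toNNReal * (t - s))
  rw [← h.map_eq, integral_map h.aemeasurable Measurable.of_discrete.aestronglyMeasurable] at h1
  rw [h1]
  push_cast [NNReal.coe_sub hst]
  rfl

/-- The count after `s` is independent of `F s`, so its conditional expectation is its Poisson mean.
-/
theorem IsMarkedPoisson.setIntegral_count [IsProbabilityMeasure P]
    (hN : IsMarkedPoisson F P r ν N) {s t : ℝ≥0} (hst : s ≤ t) {B : Set E} (hB : MeasurableSet B)
    {G : Set Ω} (hG : MeasurableSet[F s] G) :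
    ∫ ω in G, (N.count s t B ω : ℝ) ∂P = P.real G * (r * ν.real B * (t - s)) := by
  have hm : StronglyMeasurable[N.sigmaIoc s t] fun ω => (N.count s t B ω : ℝ) := by
    have h1 := N.measurable_count_sigmaIoc hst le_rfl hB
    have h2 : Measurable[N.sigmaIoc s t] fun ω => (N.count s t B ω : ℝ) :=
      (Measurable.of_discrete (f := fun n : ℕ => (n : ℝ))).comp h1
    exact h2.stronglyMeasurable
  have h1 := condExp_indep_eq (μ := P) (hN.sigmaIoc_le s t) (F.le s) hm (hN.indep s t hst)
  rw [← setIntegral_condExp (F.le s) (hN.integrable_count hst hB) hG,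
    setIntegral_congr_ae (F.le s _ hG) (h1.mono fun ω h _ => h), setIntegral_const,
    hN.integral_count hst hB, smul_eq_mul]

variable {S : Type*} [TopologicalSpace S] [DiscreteTopology S]
  [MeasurableSpace S] [DiscreteMeasurableSpace S] [Countable S]
  {X : ℝ≥0 → Ω → S} {B : S → Set E}

omit [TopologicalSpace S] [DiscreteTopology S] in
theorem IsMarkedPoisson.measurable_count_comp (hN : IsMarkedPoisson F P r ν N) (hX : Adapted F X)
    (hB : ∀ x, MeasurableSet (B x)) {a b : ℝ≥0} (hab : a ≤ b) :
    Measurable[F b] fun ω => N.count a b (B (X a ω)) ω := by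
  exact measurable_apply_of_countable (mΩ := F b) (fun x => hN.measurable_count hab (hB x))
    ((hX a).mono (F.mono hab) le_rfl)

omit [MeasurableSpace E] in
theorem MarkedPoints.count_le_univ (N : MarkedPoints Ω E) {ω : Ω}
    (hT : Tendsto (fun n => N.T n ω) atTop atTop) (s t : ℝ≥0) (B : Set E) :
    N.count s t B ω ≤ N.count s t Set.univ ω :=
  Set.ncard_le_ncard (fun _ hn => ⟨hn.1, hn.2.1, trivial⟩)
    ((finite_setOf_le hT t).subset fun _ hn => hn.2.1)

omit [TopologicalSpace S] [DiscreteTopology S] in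
theorem IsMarkedPoisson.integrable_count_comp [IsProbabilityMeasure P]
    (hN : IsMarkedPoisson F P r ν N) (hX : Adapted F X)
    (hB : ∀ x, MeasurableSet (B x)) {a b : ℝ≥0} (hab : a ≤ b) :
    Integrable (fun ω => (N.count a b (B (X a ω)) ω : ℝ)) P := by
  refine (hN.integrable_count hab MeasurableSet.univ).mono' ?_ (ae_of_all _ fun ω => ?_)
  · have h1 := (hN.measurable_count_comp hX hB hab).mono (F.le b) le_rfl
    have h2 : Measurable fun ω => (N.count a b (B (X a ω)) ω : ℝ) :=
      (Measurable.of_discrete (f := fun n : ℕ => (n : ℝ))).comp h1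
    exact h2.aestronglyMeasurable
  · rw [Real.norm_eq_abs, Nat.abs_cast]
    exact_mod_cast N.count_le_univ (hN.tendsto ω) a b _

omit [TopologicalSpace S] [DiscreteTopology S] in
-- Slicing by the countably many values of `X a` reduces a random set of marks to a deterministic
-- one on each slice, which is itself an event of `F a`.
theorem IsMarkedPoisson.setIntegral_count_comp [IsProbabilityMeasure P] [IsProbabilityMeasure ν]
    (hN : IsMarkedPoisson F P r ν N) (hX : Adapted F X)
    (hB : ∀ x, MeasurableSet (B x)) {a b : ℝ≥0} (hab : a ≤ b)
    {G : Set Ω} (hG : MeasurableSet[F a] G) :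
    ∫ ω in G, (N.count a b (B (X a ω)) ω : ℝ) ∂P =
      ∫ ω in G, (r * ν.real (B (X a ω)) * (b - a)) ∂P := by
  have hm : Measurable (X a) := (hX a).mono (F.le a) le_rfl
  have hGm := F.le a _ hG
  have hU : G = ⋃ x : S, G ∩ X a ⁻¹' {x} := by
    rw [← Set.inter_iUnion]; ext; simp
  have hdisj : Pairwise (Function.onFun Disjoint fun x : S => G ∩ X a ⁻¹' {x}) := by
    intro x y hxy
    rw [Function.onFun, Set.disjoint_left]
    rintro ω ⟨-, h1⟩ ⟨-, h2⟩
    exact hxy (h1.symm.trans h2)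
  have hmeas : ∀ x, MeasurableSet (G ∩ X a ⁻¹' {x}) := fun x =>
    hGm.inter (hm (measurableSet_singleton x))
  have hi1 := hN.integrable_count_comp hX hB hab
  have hi2 : Integrable (fun ω => (r * ν.real (B (X a ω)) * ((b : ℝ) - a))) P := by
    have hba : (0 : ℝ) ≤ b - a := sub_nonneg.2 (NNReal.coe_le_coe.2 hab)
    refine Integrable.of_bound ((Measurable.of_discrete
      (f := fun x => (r * ν.real (B x) * ((b : ℝ) - a)))).comp hm).aestronglyMeasurable
      (r * (b - a)) (ae_of_all _ fun ω => ?_)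
    rw [Real.norm_eq_abs, abs_of_nonneg (by positivity)]
    have : ν.real (B (X a ω)) ≤ 1 := measureReal_le_one
    have h0 : (0 : ℝ) ≤ r := r.2
    calc _ ≤ (r : ℝ) * 1 * (b - a) := by gcongr
      _ = _ := by ring
  rw [hU, integral_iUnion hmeas hdisj hi1.integrableOn, integral_iUnion hmeas hdisj hi2.integrableOn]
  refine tsum_congr fun x => ?_
  have e1 : ∫ ω in G ∩ X a ⁻¹' {x}, (N.count a b (B (X a ω)) ω : ℝ) ∂P =
      ∫ ω in G ∩ X a ⁻¹' {x}, (N.count a b (B x) ω : ℝ) ∂P :=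
    setIntegral_congr_fun (hmeas x) fun ω hω => by
      have : X a ω = x := hω.2
      simp only [this]
  have e2 : ∫ ω in G ∩ X a ⁻¹' {x}, (r * ν.real (B (X a ω)) * ((b : ℝ) - a)) ∂P =
      ∫ ω in G ∩ X a ⁻¹' {x}, (r * ν.real (B x) * ((b : ℝ) - a)) ∂P :=
    setIntegral_congr_fun (hmeas x) fun ω hω => by
      have : X a ω = x := hω.2
      simp only [this]
  rw [e1, e2, hN.setIntegral_count hab (hB x) (hG.inter (hX a (measurableSet_singleton x))),
    setIntegral_const, smul_eq_mul]

omit [MeasurableSpace S] [DiscreteMeasurableSpace S] [Countable S] in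
-- On a fine grid, at a cell which contains a point, the state at the left end of the cell is the
-- state just before that point. The thinning can thus read the state at grid instants, which are
-- deterministic.
theorem IsMarkedPoisson.eventually_thinned_sub (hN : IsMarkedPoisson F P r ν N)
    (hc : ∀ ω, IsCadlag fun t => X t ω) {s t : ℝ≥0} (hst : s ≤ t) (ω : Ω) :
    ∀ᶠ n in atTop, N.thinned X B t ω = N.thinned X B s ω + ∑ k ∈ Finset.range n,
      N.count (grid s t n k) (grid s t n (k + 1)) (B (X (grid s t n k) ω)) ω := by
  set R : ℝ≥0 → ℝ≥0 → Prop := fun a b =>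
    N.thinned X B b ω = N.thinned X B a ω + N.count a b (B (X a ω)) ω with hRdef
  have hT := hN.tendsto ω
  have hconst : ∀ a b, (∀ n, N.T n ω ≤ b ↔ N.T n ω ≤ a) → R a b := by
    intro a b hab
    have h0 : N.count a b (B (X a ω)) ω = 0 := by
      have : {n | a < N.T n ω ∧ N.T n ω ≤ b ∧ N.mark n ω ∈ B (X a ω)} = ∅ :=
        Set.eq_empty_of_forall_notMem fun n hn => not_le.2 hn.1 ((hab n).1 hn.2.1)
      rw [MarkedPoints.count, this, Set.ncard_empty]
    simp [hRdef, h0, MarkedPoints.thinned, pathCount, hab]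
  have hR : ∀ u, ∀ᶠ p in 𝓝 (u, u), p.1 ≤ p.2 → R p.1 p.2 := by
    intro u
    refine local_of_eventually
      (L := fun v => X v ω = Function.leftLim (fun u => X u ω) u ∧
        ∀ n, N.T n ω ≤ v ↔ N.T n ω < u)
      (U := fun v => X v ω = X u ω ∧ ∀ n, N.T n ω ≤ v ↔ N.T n ω ≤ u) ?_ ?_ ?_ ?_
    · filter_upwards [(hc ω).eventually_nhds u, eventually_forall_le_iff hT u] with v h1 h2
      exact ⟨fun hv => ⟨h1.1 hv, h2.1 hv⟩, fun hv => ⟨h1.2 hv, h2.2 hv⟩⟩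
    · rintro a b ⟨-, ha⟩ ⟨-, hb⟩ - -
      exact hconst a b fun n => (hb n).trans (ha n).symm
    · rintro a b ⟨-, ha⟩ ⟨-, hb⟩ - -
      exact hconst a b fun n => (hb n).trans (ha n).symm
    · rintro a b ⟨ha1, ha⟩ ⟨-, hb⟩ - -
      simp only [hRdef, MarkedPoints.thinned, pathCount, MarkedPoints.count, ha, hb, ha1]
      have hf := finite_setOf_le hT u
      rw [← Set.ncard_union_eq ?_ (hf.subset fun n hn => hn.1.le) (hf.subset fun n hn => hn.2.1)]
      · congr 1
        ext n
        simp only [Set.mem_ofPred_eq, Set.mem_union]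
        have ha' : a < N.T n ω ↔ u ≤ N.T n ω := by rw [← not_le, ha n, not_lt]
        rw [ha']
        constructor
        · rintro ⟨h1, h2⟩
          rcases h1.lt_or_eq with h | h
          · exact Or.inl ⟨h, h2⟩
          · exact Or.inr ⟨h.ge, h1, h ▸ h2⟩
        · rintro (⟨h1, h2⟩ | ⟨h1, h2, h3⟩)
          · exact ⟨h1.le, h2⟩
          · have : N.T n ω = u := le_antisymm h2 h1
            exact ⟨h2, this.symm ▸ h3⟩
      · rw [Set.disjoint_left]
        rintro n ⟨h1, -⟩ ⟨h2, -, -⟩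
        exact absurd ((ha n).2 h1) (not_le.2 h2)
  filter_upwards [eventually_grid hR hst, eventually_gt_atTop 0] with n hn hpos
  have : ∀ j ≤ n, N.thinned X B (grid s t n j) ω = N.thinned X B s ω + ∑ k ∈ Finset.range j,
      N.count (grid s t n k) (grid s t n (k + 1)) (B (X (grid s t n k) ω)) ω := by
    intro j
    induction j with
    | zero => simp
    | succ j ih =>
      intro hj
      rw [hn j hj, ih (by omega), Finset.sum_range_succ, add_assoc]
  have h := this n le_rfl
  rwa [grid_self hst hpos.ne'] at h

theorem IsMarkedPoisson.isCountingProcess_thinned (hN : IsMarkedPoisson F P r ν N)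
    (hX : Adapted F X) (hc : ∀ ω, IsCadlag fun t => X t ω) (hB : ∀ x, MeasurableSet (B x)) :
    IsCountingProcess F (N.thinned X B) := by
  refine ⟨fun t => ?_, fun ω => pathCount_zero (fun n => hN.pos n ω) _,
    fun ω => pathCount_mono (hN.tendsto ω) _, fun ω t => pathCount_rightContinuous (hN.tendsto ω) _ t⟩
  refine @measurable_of_tendsto_metrizable _ _ (F t) _ _ _ _
    (fun n ω => ∑ k ∈ Finset.range n,
      N.count (grid 0 t n k) (grid 0 t n (k + 1)) (B (X (grid 0 t n k) ω)) ω) _ (fun n => ?_) ?_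
  · refine Finset.measurable_sum _ fun k hk => ?_
    exact (hN.measurable_count_comp hX hB (grid_mono 0 t n k.le_succ)).mono
      (F.mono (grid_le zero_le (Finset.mem_range.1 hk))) le_rfl
  · refine tendsto_pi_nhds.2 fun ω => tendsto_const_nhds.congr' ?_
    filter_upwards [hN.eventually_thinned_sub (B := B) hc (zero_le (a := t)) ω] with n hn
    rw [hn, show N.thinned X B 0 ω = 0 from pathCount_zero (fun n => hN.pos n ω) _, zero_add]

omit [DiscreteTopology S] [MeasurableSpace S] [DiscreteMeasurableSpace S] [Countable S] in
theorem IsMarkedPoisson.thinned_le (hN : IsMarkedPoisson F P r ν N) (t : ℝ≥0) (ω : Ω) :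
    N.thinned X B t ω ≤ N.count 0 t Set.univ ω := by
  rw [MarkedPoints.count_zero_eq fun n => hN.pos n ω]
  exact Set.ncard_le_ncard (fun _ hn => ⟨hn.1, trivial⟩)
    ((finite_setOf_le (hN.tendsto ω) t).subset fun _ hn => hn.1)

/-- The thinned process has intensity `r * ν (B (X t))`. -/
theorem IsMarkedPoisson.hasIntensity_thinned [IsProbabilityMeasure P] [IsProbabilityMeasure ν]
    (hN : IsMarkedPoisson F P r ν N) (hX : Adapted F X) (hc : ∀ ω, IsCadlag fun t => X t ω)
    (hB : ∀ x, MeasurableSet (B x)) :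
    HasIntensity F P (N.thinned X B) fun t ω => r * ν.real (B (X t ω)) := by
  have hC := hN.isCountingProcess_thinned hX hc hB
  have hρ : ∀ x, |(r : ℝ) * ν.real (B x)| ≤ r := fun x => by
    rw [abs_of_nonneg (by positivity)]
    have : ν.real (B x) ≤ 1 := measureReal_le_one
    have h0 : (0 : ℝ) ≤ r := r.2
    nlinarith
  have hCint : ∀ t, Integrable (fun ω => (N.thinned X B t ω : ℝ)) P := fun t => by
    refine (hN.integrable_count (zero_le (a := t)) MeasurableSet.univ).mono' ?_
      (ae_of_all _ fun ω => ?_)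
    · have h2 : Measurable fun ω => (N.thinned X B t ω : ℝ) :=
        (Measurable.of_discrete (f := fun n : ℕ => (n : ℝ))).comp
          ((hC.adapted t).mono (F.le t) le_rfl)
      exact h2.aestronglyMeasurable
    · rw [Real.norm_eq_abs, Nat.abs_cast]
      exact_mod_cast hN.thinned_le t ω
  have hIm : ∀ {s t : ℝ≥0}, s ≤ t →
      Measurable[F t] fun ω => ∫ u in (s : ℝ)..t, (r : ℝ) * ν.real (B (X u.toNNReal ω)) :=
    fun hst => measurable_intervalIntegral (r := fun x => (r : ℝ) * ν.real (B x)) hX hc hρ hst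
  have hIint : ∀ {s t : ℝ≥0}, s ≤ t →
      Integrable (fun ω => ∫ u in (s : ℝ)..t, (r : ℝ) * ν.real (B (X u.toNNReal ω))) P :=
    fun {s t} hst => by
      refine Integrable.of_bound (C := r * (t - s))
        ((hIm hst).mono (F.le t) le_rfl).aestronglyMeasurable (ae_of_all _ fun ω => ?_)
      exact abs_intervalIntegral_le (x := fun u => X u ω) (a := fun x => (r : ℝ) * ν.real (B x)) hρ
        (NNReal.coe_le_coe.2 hst)
  have hkey : ∀ {s t : ℝ≥0}, s ≤ t → ∀ G, MeasurableSet[F s] G →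
      ∫ ω in G, ((N.thinned X B t ω : ℝ) - N.thinned X B s ω) ∂P =
        ∫ ω in G, (∫ u in (s : ℝ)..t, (r : ℝ) * ν.real (B (X u.toNNReal ω))) ∂P := by
    intro s t hst G hG
    have h1 : Tendsto (fun n => ∫ ω in G, ((∑ k ∈ Finset.range n, N.count (grid s t n k)
        (grid s t n (k + 1)) (B (X (grid s t n k) ω)) ω : ℕ) : ℝ) ∂P) atTop
        (𝓝 (∫ ω in G, ((N.thinned X B t ω : ℝ) - N.thinned X B s ω) ∂P)) := by
      refine tendsto_integral_of_dominated_convergence (fun ω => (N.count s t Set.univ ω : ℝ))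
        (fun n => ?_) (hN.integrable_count hst MeasurableSet.univ).integrableOn
        (fun n => ae_of_all _ fun ω => ?_) (ae_of_all _ fun ω => ?_)
      · simp only [Nat.cast_sum]
        exact (integrable_finsetSum _ fun k _ => hN.integrable_count_comp hX hB
          (grid_mono s t n k.le_succ)).aestronglyMeasurable.restrict
      · rw [Real.norm_eq_abs, Nat.abs_cast]
        norm_cast
        refine (Finset.sum_le_sum fun k _ => N.count_le_univ (hN.tendsto ω) _ _ _).trans ?_
        have : ∀ j, ∑ k ∈ Finset.range j, N.count (grid s t n k) (grid s t n (k + 1)) Set.univ ω =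
            N.count s (grid s t n j) Set.univ ω := by
          intro j
          induction j with
          | zero => simp [MarkedPoints.count, ← not_le]
          | succ j ih =>
            rw [Finset.sum_range_succ, ih, MarkedPoints.count_add (hN.tendsto ω)
              (le_grid s t n j) (grid_mono s t n j.le_succ)]
        rw [this, ← MarkedPoints.count_add (hN.tendsto ω) (le_grid s t n n) (grid_le hst le_rfl)]
        exact Nat.le_add_right _ _
      · refine tendsto_const_nhds.congr' ?_
        filter_upwards [hN.eventually_thinned_sub (B := B) hc hst ω] with n hn
        rw [hn]; push_cast; ring
    -- With `r` constantly one the inner integrals are the lengths of the cells, and the frozen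
    -- factor `g` carries the intensity.
    have h2 := tendsto_setIntegral_sum_grid (P := P) (r := fun _ : S => (1 : ℝ)) (K := 1) hX hc
      (by simp) hst (g := fun x => (r : ℝ) * ν.real (B x)) hρ G
    refine (tendsto_nhds_unique h1 (h2.congr fun n => ?_)).trans ?_
    · simp only [Nat.cast_sum]
      rw [integral_finsetSum _ fun k _ => (hN.integrable_count_comp hX hB
        (grid_mono s t n k.le_succ)).integrableOn, integral_finsetSum]
      · refine Finset.sum_congr rfl fun k _ => ?_
        rw [hN.setIntegral_count_comp hX hB (grid_mono s t n k.le_succ)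
          (F.mono (le_grid s t n k) _ hG)]
        simp
      · intro k _
        refine Integrable.integrableOn (Integrable.mul_const ?_ _)
        exact Integrable.of_bound ((Measurable.of_discrete
          (f := fun x => (r * ν.real (B x) : ℝ))).comp
          ((hX _).mono (F.le _) le_rfl)).aestronglyMeasurable _ (ae_of_all _ fun ω => hρ _)
    · simp
  refine ⟨fun t => Measurable.stronglyMeasurable ?_, fun s t hst => ?_⟩
  · have h2 : Measurable[F t] fun ω => (N.thinned X B t ω : ℝ) :=
      (Measurable.of_discrete (f := fun n : ℕ => (n : ℝ))).comp (hC.adapted t)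
    exact h2.sub (by simpa using hIm (zero_le (a := t)))
  · have hMint : ∀ t : ℝ≥0, Integrable (fun ω => (N.thinned X B t ω : ℝ) -
        ∫ u in (0 : ℝ)..t, (r : ℝ) * ν.real (B (X u.toNNReal ω))) P := fun t =>
      (hCint t).sub (by simpa using hIint (zero_le (a := t)))
    refine (ae_eq_condExp_of_forall_setIntegral_eq (F.le s) (hMint t)
      (fun G _ _ => (hMint s).integrableOn) (fun G hG _ => ?_) ?_).symm
    · rw [← sub_eq_zero, ← neg_sub, neg_eq_zero,
        ← integral_sub (hMint t).integrableOn (hMint s).integrableOn]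
      have h3 := hkey hst G hG
      have h4 : Integrable (fun ω => (N.thinned X B t ω : ℝ) - N.thinned X B s ω) P :=
        (hCint t).sub (hCint s)
      rw [← sub_eq_zero, ← integral_sub h4.integrableOn (hIint hst).integrableOn] at h3
      refine Eq.trans ?_ h3
      refine integral_congr_ae (ae_of_all _ fun ω => ?_)
      have := intervalIntegral.integral_add_adjacent_intervals
        ((hc ω).intervalIntegrable (a := fun x => (r : ℝ) * ν.real (B x)) hρ 0 s)
        ((hc ω).intervalIntegrable (a := fun x => (r : ℝ) * ν.real (B x)) hρ s t)
      simp only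
      rw [← this]; ring
    · have h2 : Measurable[F s] fun ω => (N.thinned X B s ω : ℝ) :=
        (Measurable.of_discrete (f := fun n : ℕ => (n : ℝ))).comp (hC.adapted s)
      have h3 : StronglyMeasurable[F s] fun ω => (N.thinned X B s ω : ℝ) -
          ∫ u in (0 : ℝ)..s, (r : ℝ) * ν.real (B (X u.toNNReal ω)) :=
        (h2.sub (by simpa using hIm (zero_le (a := s)))).stronglyMeasurable
      exact h3.aestronglyMeasurable

end Thinning


/-! ### The coupled processes are queue length processes -/

section Coupling

open scoped Classical in
theorem pathCount_eq_sum {τ : ℕ → ℝ≥0} (hτ : Tendsto τ atTop atTop) (p : ℕ → Prop) (t : ℝ≥0) :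
    pathCount τ p t = ∑ n ∈ (finite_setOf_le hτ t).toFinset, if p n then 1 else 0 := by
  rw [← Finset.card_filter, pathCount, ← Set.ncard_coe_finset]
  congr 1
  ext n
  simp

/-- Each counted point bears exactly one label, namely its pair `(a n, b n)`, so the labelled counts
partition the total. -/
theorem sum_sum_pathCount {τ : ℕ → ℝ≥0} (hτ : Tendsto τ atTop atTop) {c : ℕ}
    {p : Fin c → Fin c → ℕ → Prop} {q : ℕ → Prop} {a b : ℕ → Fin c}
    (h : ∀ j i n, p j i n ↔ q n ∧ a n = j ∧ b n = i) (t : ℝ≥0) :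
    ∑ j, ∑ i, pathCount τ (p j i) t = pathCount τ q t := by
  classical
  simp only [pathCount_eq_sum hτ]
  simp_rw [Finset.sum_comm (s := Finset.univ) (t := (finite_setOf_le hτ t).toFinset)]
  refine Finset.sum_congr rfl fun n _ => ?_
  simp only [h]
  by_cases hq : q n
  · simp [hq, ite_and]
  · simp [hq]

variable {c : ℕ}

/-- The marks for which the chosen queue is `j`, and the task is routed to queue `i`. -/
def arrivalMarks (pol : Policy c) (j i : Fin c) (x : State c) : Set (Mark c) :=
  {p | rankedQueue x p.1 = j ∧ pol.route x j p.2 = i}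

/-- The marks for which queue `j` completes a service, and the length of queue `i` is reduced. -/
def serviceMarks (pol : Policy c) (j i : Fin c) (x : State c) : Set (Mark c) :=
  {p | rankedQueue x p.1 = j ∧ 1 ≤ x j ∧ pol.release x j p.2 = i}

/-- Sorting being a permutation, exactly one rank designates queue `j`. The product form then gives
probability `1 / c` times that of the policy's choice. -/
theorem arrivalMarks_eq_prod (pol : Policy c) (j i : Fin c) (x : State c) :
    arrivalMarks pol j i x = {(Tuple.sort x).symm j} ×ˢ {u | pol.route x j u = i} := by
  ext ⟨k, u⟩
  simp [arrivalMarks, rankedQueue, Equiv.eq_symm_apply]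

theorem serviceMarks_eq_prod (pol : Policy c) (j i : Fin c) {x : State c} (hx : 1 ≤ x j) :
    serviceMarks pol j i x = {(Tuple.sort x).symm j} ×ˢ {u | pol.release x j u = i} := by
  ext ⟨k, u⟩
  simp [serviceMarks, rankedQueue, Equiv.eq_symm_apply, hx]

theorem serviceMarks_eq_empty (pol : Policy c) (j i : Fin c) {x : State c} (hx : ¬ 1 ≤ x j) :
    serviceMarks pol j i x = ∅ := by
  ext ⟨k, u⟩
  simp [serviceMarks, hx]

theorem measurableSet_arrivalMarks (pol : Policy c) (j i : Fin c) (x : State c) :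
    MeasurableSet (arrivalMarks pol j i x) := by
  rw [arrivalMarks_eq_prod]
  exact (measurableSet_singleton _).prod (pol.measurable_route x j (measurableSet_singleton i))

theorem measurableSet_serviceMarks (pol : Policy c) (j i : Fin c) (x : State c) :
    MeasurableSet (serviceMarks pol j i x) := by
  by_cases hx : 1 ≤ x j
  · rw [serviceMarks_eq_prod pol j i hx]
    exact (measurableSet_singleton _).prod (pol.measurable_release x j (measurableSet_singleton i))
  · rw [serviceMarks_eq_empty pol j i hx]
    exact MeasurableSet.empty

theorem isProbabilityMeasure_markLaw (hc : c ≠ 0) : IsProbabilityMeasure (markLaw c) := by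
  have : NeZero c := ⟨hc⟩
  have : IsProbabilityMeasure (uniformOn (Set.univ : Set (Fin c))) :=
    isProbabilityMeasure_uniformOn Set.finite_univ Set.univ_nonempty
  unfold markLaw
  infer_instance

theorem markLaw_real_prod (k : Fin c) (U : Set unitInterval) :
    (markLaw c).real ({k} ×ˢ U) = 1 / c * (volume : Measure unitInterval).real U := by
  rw [markLaw, measureReal_prod_prod]
  congr 1
  rw [measureReal_def, uniformOn_univ]
  simp

variable {Ω : Type*} {m : MeasurableSpace Ω} {P : Measure Ω} {F : Filtration ℝ≥0 m}
  {lam : ℝ≥0} {pol : Policy c} {arr srv : MarkedPoints Ω (Mark c)} {X : ℝ≥0 → Ω → State c}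

theorem IsMarkedPoisson.isPoissonProcess {E : Type*} [MeasurableSpace E] {r : ℝ≥0} {ν : Measure E}
    [IsProbabilityMeasure ν] {N : MarkedPoints Ω E} (hN : IsMarkedPoisson F P r ν N) :
    IsPoissonProcess F P r fun t ω => N.count 0 t Set.univ ω := by
  have hsub : ∀ s t : ℝ≥0, s ≤ t → (fun ω => N.count 0 t Set.univ ω - N.count 0 s Set.univ ω) =
      N.count s t Set.univ := fun s t hst => by
    ext ω
    rw [← MarkedPoints.count_add (hN.tendsto ω) zero_le hst]
    omega
  have hcount : ∀ ω, (fun t => N.count 0 t Set.univ ω) =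
      pathCount (fun n => N.T n ω) fun n => N.mark n ω ∈ Set.univ := fun ω => by
    ext t; exact MarkedPoints.count_zero_eq (fun n => hN.pos n ω) t _
  refine ⟨⟨fun t => hN.adapted t _ MeasurableSet.univ, fun ω => ?_, fun ω => ?_, fun ω t => ?_⟩,
    fun s t hst => ?_, fun s t hst => ?_⟩
  · exact (congrFun (hcount ω) 0).trans (pathCount_zero (fun n => hN.pos n ω) _)
  · rw [hcount]; exact pathCount_mono (hN.tendsto ω) _
  · rw [hcount]; exact pathCount_rightContinuous (hN.tendsto ω) _ t
  · rw [hsub s t hst]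
    simpa using hN.law s t hst Set.univ MeasurableSet.univ
  · rw [hsub s t hst]
    exact indep_of_indep_of_le_left (hN.indep s t hst)
      (N.measurable_count_sigmaIoc hst le_rfl MeasurableSet.univ).comap_le

/-- The events are the points of the driving processes, thinned according to the queue that their
rank designates and the queue that the policy determines in the state just before. Idle service
points fall in none of the classes. -/
theorem Follows.networkEvents [IsProbabilityMeasure P] (hc : c ≠ 0)
    (harr : IsMarkedPoisson F P lam (markLaw c) arr) (hsrv : IsMarkedPoisson F P c (markLaw c) srv)
    (hno : ∀ ω n n', arr.T n ω ≠ srv.T n' ω) (hX : Adapted F X) (h : Follows pol arr srv X) :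
    NetworkEvents F P lam pol X (fun j i => arr.thinned X (arrivalMarks pol j i))
      (fun j i => srv.thinned X (serviceMarks pol j i)) := by
  have := isProbabilityMeasure_markLaw hc
  have hc' : (c : ℝ) ≠ 0 := by exact_mod_cast hc
  have hA := fun j i => harr.isCountingProcess_thinned hX h.cadlag (measurableSet_arrivalMarks pol j i)
  have hS := fun j i => hsrv.isCountingProcess_thinned hX h.cadlag (measurableSet_serviceMarks pol j i)
  set pre : ℝ≥0 → Ω → State c := fun t ω => Function.leftLim (fun u => X u ω) t with hpre
  have hAsum : ∀ ω t, ∑ j, ∑ i, arr.thinned X (arrivalMarks pol j i) t ω =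
      pathCount (fun n => arr.T n ω) (fun _ => True) t := fun ω t =>
    sum_sum_pathCount (harr.tendsto ω)
      (a := fun n => rankedQueue (pre (arr.T n ω) ω) (arr.mark n ω).1)
      (b := fun n => pol.route (pre (arr.T n ω) ω)
        (rankedQueue (pre (arr.T n ω) ω) (arr.mark n ω).1) (arr.mark n ω).2)
      (fun j i n => by
        simp only [arrivalMarks, Set.mem_ofPred_eq, true_and]
        exact and_congr_right fun h => by rw [← h]) t
  have hSsum : ∀ ω t, ∑ j, ∑ i, srv.thinned X (serviceMarks pol j i) t ω =
      pathCount (fun n => srv.T n ω) (fun n => 1 ≤ pre (srv.T n ω) ω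
        (rankedQueue (pre (srv.T n ω) ω) (srv.mark n ω).1)) t := fun ω t =>
    sum_sum_pathCount (hsrv.tendsto ω)
      (a := fun n => rankedQueue (pre (srv.T n ω) ω) (srv.mark n ω).1)
      (b := fun n => pol.release (pre (srv.T n ω) ω)
        (rankedQueue (pre (srv.T n ω) ω) (srv.mark n ω).1) (srv.mark n ω).2)
      (fun j i n => by
        simp only [serviceMarks, Set.mem_ofPred_eq]
        constructor
        · rintro ⟨rfl, h1, h2⟩; exact ⟨h1, rfl, h2⟩
        · rintro ⟨h1, rfl, h2⟩; exact ⟨rfl, h1, h2⟩) t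
  refine ⟨hA, hS, fun ω t => ?_, fun ω t hev => ?_, fun ω t j i hlt => ?_, fun ω t j i hlt => ?_,
    ?_, fun j i => ?_, fun j i => ?_⟩
  · simp only [Finset.sum_add_distrib, hAsum, hSsum]
    set p : ℕ → Prop := fun _ => True
    set q : ℕ → Prop := fun n => 1 ≤ pre (srv.T n ω) ω
        (rankedQueue (pre (srv.T n ω) ω) (srv.mark n ω).1)
    have h1 := pathCount_le_leftLim_add_one (harr.tendsto ω) (fun n => harr.pos n ω)
      (harr.strictMono ω).injective p t
    have h2 := pathCount_le_leftLim_add_one (hsrv.tendsto ω) (fun n => hsrv.pos n ω)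
      (hsrv.strictMono ω).injective q t
    have h3 : Function.leftLim (fun u => pathCount (fun n => arr.T n ω) p u +
        pathCount (fun n => srv.T n ω) q u) t = Function.leftLim (pathCount (fun n => arr.T n ω) p) t +
        Function.leftLim (pathCount (fun n => srv.T n ω) q) t :=
      leftLim_comp (κ := Bool) (x := fun b => cond b (pathCount (fun n => arr.T n ω) p)
        (pathCount (fun n => srv.T n ω) q))
        (by
          rintro (_ | _)
          · exact pathCount_isCadlag (hsrv.tendsto ω) q
          · exact pathCount_isCadlag (harr.tendsto ω) p) (fun y => y true + y false) t
    rw [h3]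
    -- Each stream jumps by at most one, so a total jump of two would put an arrival and a service
    -- point at the same instant.
    by_contra hcon
    obtain ⟨n, hn, -⟩ := exists_of_leftLim_lt_pathCount (harr.tendsto ω) (fun n => harr.pos n ω)
      (p := p) (t := t) (by omega)
    obtain ⟨n', hn', -⟩ := exists_of_leftLim_lt_pathCount (hsrv.tendsto ω) (fun n => hsrv.pos n ω)
      (p := q) (t := t) (by omega)
    exact hno ω n n' (hn.trans hn'.symm)
  · have ha : ∀ n, t ≠ arr.T n ω := by
      rintro n rfl
      have h1 := (hev (rankedQueue (pre (arr.T n ω) ω) (arr.mark n ω).1)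
        (pol.route (pre (arr.T n ω) ω)
          (rankedQueue (pre (arr.T n ω) ω) (arr.mark n ω).1) (arr.mark n ω).2)).1
      exact (leftLim_lt_pathCount (harr.tendsto ω) (fun n => harr.pos n ω)
        (p := fun n' => arr.mark n' ω ∈ arrivalMarks pol _ _ (pre (arr.T n' ω) ω)) (n := n)
        (by exact ⟨rfl, rfl⟩)).ne' h1
    by_cases hs : ∃ n, t = srv.T n ω
    · obtain ⟨n, rfl⟩ := hs
      refine h.idle ω n _ rfl (Nat.eq_zero_of_not_pos fun hpos => ?_)
      have h1 := (hev (rankedQueue (pre (srv.T n ω) ω) (srv.mark n ω).1)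
        (pol.release (pre (srv.T n ω) ω)
          (rankedQueue (pre (srv.T n ω) ω) (srv.mark n ω).1) (srv.mark n ω).2)).2
      exact (leftLim_lt_pathCount (hsrv.tendsto ω) (fun n => hsrv.pos n ω)
        (p := fun n' => srv.mark n' ω ∈ serviceMarks pol _ _ (pre (srv.T n' ω) ω)) (n := n)
        (by exact ⟨rfl, hpos, rfl⟩)).ne' h1
    · exact h.no_event ω t ha (by simpa using hs)
  · obtain ⟨n, rfl, h1, h2⟩ := exists_of_leftLim_lt_pathCount (harr.tendsto ω)
      (fun n => harr.pos n ω) hlt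
    refine ⟨?_, ?_⟩
    · rw [← h2]; exact pol.route_le _ _ _
    · rw [h.arrival ω n _ rfl, h1, h2]
  · obtain ⟨n, rfl, h1, h2, h3⟩ := exists_of_leftLim_lt_pathCount (hsrv.tendsto ω)
      (fun n => hsrv.pos n ω) hlt
    refine ⟨h2, ?_, ?_⟩
    · rw [← h3]; exact pol.le_release _ _ _ h2
    · have := h.service ω n _ rfl (by rw [h1]; exact h2)
      rwa [h1, h3] at this
  · have : (fun t ω => ∑ j, ∑ i, arr.thinned X (arrivalMarks pol j i) t ω) =
        fun t ω => arr.count 0 t Set.univ ω := by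
      ext t ω
      rw [hAsum, MarkedPoints.count_zero_eq fun n => harr.pos n ω]
      rfl
    rw [this]
    exact harr.isPoissonProcess
  · have h1 := harr.hasIntensity_thinned hX h.cadlag (measurableSet_arrivalMarks pol j i)
    convert h1 using 3 with t ω
    rw [arrivalMarks_eq_prod, markLaw_real_prod, Policy.routeProb]
    ring
  · have h1 := hsrv.hasIntensity_thinned hX h.cadlag (measurableSet_serviceMarks pol j i)
    convert h1 using 3 with t ω
    split_ifs with hx
    · rw [serviceMarks_eq_prod pol j i hx, markLaw_real_prod, Policy.releaseProb, NNReal.coe_natCast]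
      -- The total service intensity `c` cancels the probability `1 / c` of the rank, leaving
      -- intensity one per nonempty queue.
      field_simp
    · rw [serviceMarks_eq_empty pol j i hx]; simp

theorem Follows.isNetwork [IsProbabilityMeasure P] (hc : c ≠ 0)
    (harr : IsMarkedPoisson F P lam (markLaw c) arr) (hsrv : IsMarkedPoisson F P c (markLaw c) srv)
    (hno : ∀ ω n n', arr.T n ω ≠ srv.T n' ω) (hX : Adapted F X) (h : Follows pol arr srv X) :
    IsNetwork F P lam pol X :=
  have hev := h.networkEvents hc harr hsrv hno hX
  ⟨hX, h.cadlag, hev.isMarkov hX h.cadlag, _, _, hev⟩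

end Coupling


/-! ### Poisson point clouds -/

section Cloud

variable {κ Z : Type*}

/-- Finite clouds of points of `Z` in the blocks `k : κ`: the numbers of points, and sequences
which start with the points. -/
abbrev Cloud (κ Z : Type*) : Type _ := κ → ℕ × (ℕ → Z)

/-- The sum of `g k z` over the points `z` of the blocks `k ∈ K`. -/
def cloudSum (K : Finset κ) (g : κ → Z → ℝ) (w : Cloud κ Z) : ℝ :=
  ∑ k ∈ K, ∑ i ∈ Finset.range (w k).1, g k ((w k).2 i)

/-- The number of points of the blocks `k ∈ K` in `C k`. -/
def cloudCount (K : Finset κ) (C : κ → Set Z) (w : Cloud κ Z) : ℕ :=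
  ∑ k ∈ K, ∑ i ∈ Finset.range (w k).1, (C k).indicator 1 ((w k).2 i)

theorem cast_cloudCount (K : Finset κ) (C : κ → Set Z) (w : Cloud κ Z) :
    (cloudCount K C w : ℝ) = cloudSum K (fun k => (C k).indicator 1) w := by
  simp only [cloudCount, cloudSum]
  push_cast
  refine Finset.sum_congr rfl fun k _ => Finset.sum_congr rfl fun i _ => ?_
  by_cases h : (w k).2 i ∈ C k <;> simp [h]

/-- Lets finitely many sums over different sets of blocks be regarded as sums over one common set.
-/
theorem cloudSum_mono_blocks {K K' : Finset κ} (hK : K ⊆ K') (g : κ → Z → ℝ) (w : Cloud κ Z) :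
    cloudSum K' (fun k z => (K : Set κ).indicator (fun k => g k z) k) w = cloudSum K g w := by
  unfold cloudSum
  rw [← Finset.sum_subset hK fun k _ hk => ?_]
  · refine Finset.sum_congr rfl fun k hk => Finset.sum_congr rfl fun i _ => ?_
    exact Set.indicator_of_mem (s := (K : Set κ)) hk fun k => g k ((w k).2 i)
  · refine Finset.sum_eq_zero fun i _ => ?_
    exact Set.indicator_of_notMem (s := (K : Set κ)) hk _

theorem cloudSum_sum {ι : Type*} (s : Finset ι) (K : Finset κ) (g : ι → κ → Z → ℝ)
    (w : Cloud κ Z) :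
    cloudSum K (fun k z => ∑ i ∈ s, g i k z) w = ∑ i ∈ s, cloudSum K (g i) w := by
  unfold cloudSum
  rw [Finset.sum_comm]
  refine Finset.sum_congr rfl fun k _ => ?_
  rw [Finset.sum_comm]

theorem cloudSum_const_mul (K : Finset κ) (a : ℝ) (g : κ → Z → ℝ) (w : Cloud κ Z) :
    cloudSum K (fun k z => a * g k z) w = a * cloudSum K g w := by
  simp only [cloudSum, Finset.mul_sum]

variable [MeasurableSpace Z]

theorem measurable_range_sum {g : Z → ℝ} (hg : Measurable g) :
    Measurable fun p : ℕ × (ℕ → Z) => ∑ i ∈ Finset.range p.1, g (p.2 i) :=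
  measurable_from_prod_countable_right fun n =>
    Finset.measurable_sum (Finset.range n) fun i _ => hg.comp (measurable_pi_apply i)

theorem measurable_cloudSum (K : Finset κ) {g : κ → Z → ℝ} (hg : ∀ k, Measurable (g k)) :
    Measurable (cloudSum K g) :=
  Finset.measurable_sum _ fun k _ => (measurable_range_sum (hg k)).comp (measurable_pi_apply k)

theorem measurable_cloudCount (K : Finset κ) {C : κ → Set Z} (hC : ∀ k, MeasurableSet (C k)) :
    Measurable (cloudCount K C) := by
  have h : cloudCount K C = fun w => ⌊cloudSum K (fun k => (C k).indicator 1) w⌋₊ := by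
    ext w; rw [← cast_cloudCount, Nat.floor_natCast]
  rw [h]
  exact Nat.measurable_floor.comp
    (measurable_cloudSum K fun k => measurable_one.indicator (hC k))

/-- The law of a Poisson number of independent points of law `μ`. -/
def blockLaw (r : ℝ≥0) (μ : Measure Z) : Measure (ℕ × (ℕ → Z)) :=
  (poissonMeasure r).prod (Measure.infinitePi fun _ => μ)

instance (r : ℝ≥0) (μ : Measure Z) [IsProbabilityMeasure μ] :
    IsProbabilityMeasure (blockLaw r μ) := by
  unfold blockLaw; infer_instance

theorem integral_prod_infinitePi {μ : Measure Z} [IsProbabilityMeasure μ] {h : Z → ℂ}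
    (hm : Measurable h) (n : ℕ) :
    ∫ z : ℕ → Z, ∏ i ∈ Finset.range n, h (z i) ∂(Measure.infinitePi fun _ => μ) =
      (∫ z, h z ∂μ) ^ n := by
  have h1 := integral_restrict_infinitePi (fun _ : ℕ => μ) (s := Finset.range n)
    (f := fun z => ∏ i, h (z i))
    (Finset.measurable_prod _ fun i _ => hm.comp (measurable_pi_apply i)).aestronglyMeasurable
  rw [integral_fintype_prod_eq_pow] at h1
  simp only [Fintype.card_coe, Finset.card_range] at h1
  rw [← h1]
  refine integral_congr_ae (ae_of_all _ fun z => ?_)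
  simp only [Finset.restrict]
  exact (Finset.prod_coe_sort (Finset.range n) fun i => h (z i)).symm

/-- Given the number `n` of points, independence gives the `n`-th power of the integral of `h`.
Averaging over `n` is the generating function of the Poisson law. -/
theorem integral_blockLaw (r : ℝ≥0) {μ : Measure Z} [IsProbabilityMeasure μ] {h : Z → ℂ}
    (hm : Measurable h) (h1 : ∀ z, ‖h z‖ ≤ 1) :
    ∫ p : ℕ × (ℕ → Z), ∏ i ∈ Finset.range p.1, h (p.2 i) ∂(blockLaw r μ) =
      Complex.exp (r * (∫ z, h z ∂μ - 1)) := by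
  have hmeas : Measurable fun p : ℕ × (ℕ → Z) => ∏ i ∈ Finset.range p.1, h (p.2 i) :=
    measurable_from_prod_countable_right fun n =>
      Finset.measurable_prod (Finset.range n) fun i _ => hm.comp (measurable_pi_apply i)
  have hint : Integrable (fun p : ℕ × (ℕ → Z) => ∏ i ∈ Finset.range p.1, h (p.2 i))
      ((poissonMeasure r).prod (Measure.infinitePi fun _ => μ)) := by
    refine Integrable.of_bound hmeas.aestronglyMeasurable 1 (ae_of_all _ fun p => ?_)
    rw [norm_prod]
    exact Finset.prod_le_one (fun _ _ => norm_nonneg _) fun i _ => h1 _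
  rw [blockLaw, integral_prod _ hint]
  simp only [integral_prod_infinitePi hm]
  rw [integral_poissonMeasure]
  set q := ∫ z, h z ∂μ
  have h2 : HasSum (fun n : ℕ => ((r : ℂ) * q) ^ n / n.factorial) (Complex.exp (r * q)) := by
    rw [Complex.exp_eq_exp_ℂ]
    exact NormedSpace.expSeries_div_hasSum_exp _
  rw [mul_sub, mul_one, sub_eq_neg_add, Complex.exp_add, ← (h2.mul_left _).tsum_eq]
  refine tsum_congr fun n => ?_
  rw [Complex.real_smul]
  push_cast
  rw [mul_pow]
  ring

variable (ρ : κ → ℝ≥0) (η : κ → Measure Z)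

/-- The law of independent blocks of points. -/
def cloudLaw : Measure (Cloud κ Z) := Measure.infinitePi fun k => blockLaw (ρ k) (η k)

variable [∀ k, IsProbabilityMeasure (η k)]

instance : IsProbabilityMeasure (cloudLaw ρ η) := by
  unfold cloudLaw; infer_instance

/-- The characteristic functional of the cloud, the product of those of its independent blocks. All
laws and independence of counts below are read off from it. -/
theorem integral_exp_cloudSum (K : Finset κ) {g : κ → Z → ℝ} (hg : ∀ k, Measurable (g k)) :
    ∫ w, Complex.exp (cloudSum K g w * Complex.I) ∂(cloudLaw ρ η) =
      Complex.exp (∑ k ∈ K, ρ k * ∫ z, (Complex.exp (g k z * Complex.I) - 1) ∂(η k)) := by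
  have hm : ∀ k, Measurable fun z => Complex.exp (g k z * Complex.I) := fun k => by
    have := hg k
    fun_prop
  have hb : ∀ k z, ‖Complex.exp (g k z * Complex.I)‖ ≤ 1 := fun k z =>
    (Complex.norm_exp_ofReal_mul_I _).le
  have hmk : ∀ k, Measurable fun p : ℕ × (ℕ → Z) =>
      ∏ i ∈ Finset.range p.1, Complex.exp (g k (p.2 i) * Complex.I) := fun k =>
    measurable_from_prod_countable_right fun n =>
      Finset.measurable_prod (Finset.range n) fun i _ => (hm k).comp (measurable_pi_apply i)
  have h1 := integral_restrict_infinitePi (fun k => blockLaw (ρ k) (η k)) (s := K)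
    (f := fun w => ∏ k : K, ∏ i ∈ Finset.range (w k).1,
      Complex.exp (g k ((w k).2 i) * Complex.I))
    (Finset.measurable_prod Finset.univ fun (k : K) _ =>
      (hmk k).comp (measurable_pi_apply k)).aestronglyMeasurable
  rw [integral_fintype_prod_eq_prod (fun (k : K) (p : ℕ × (ℕ → Z)) =>
    ∏ i ∈ Finset.range p.1, Complex.exp (g k (p.2 i) * Complex.I))] at h1
  simp only [integral_blockLaw _ (hm _) (hb _)] at h1
  rw [Finset.prod_coe_sort K fun k =>
    Complex.exp (ρ k * (∫ z, Complex.exp (g k z * Complex.I) ∂(η k) - 1)), ← Complex.exp_sum] at h1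
  convert h1 using 1
  · refine integral_congr_ae (ae_of_all _ fun w => ?_)
    simp only [Finset.restrict, cloudSum]
    rw [Finset.prod_coe_sort K fun k => ∏ i ∈ Finset.range (w k).1,
      Complex.exp (g k ((w k).2 i) * Complex.I)]
    simp only [← Complex.exp_sum]
    congr 1
    push_cast
    simp only [Finset.sum_mul]
  · congr 1
    refine Finset.sum_congr rfl fun k _ => ?_
    rw [integral_sub ?_ (integrable_const _)]
    · simp
    · exact Integrable.of_bound (hm k).aestronglyMeasurable 1 (ae_of_all _ (hb k))

/-- Sums of families of functions with disjoint supports are independent. -/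
theorem iIndepFun_cloudSum {ι : Type*} [Fintype ι] {T : ι → Type*} [∀ i, Fintype (T i)]
    (K : Finset κ) {g : ∀ i, T i → κ → Z → ℝ} (hg : ∀ i j k, Measurable (g i j k))
    (hd : ∀ i i', i ≠ i' → ∀ j j' k z, g i j k z = 0 ∨ g i' j' k z = 0) :
    iIndepFun (fun i w j => cloudSum K (g i j) w) (cloudLaw ρ η) := by
  classical
  have hmX : ∀ i, Measurable fun (w : Cloud κ Z) (j : T i) => cloudSum K (g i j) w := fun i =>
    measurable_pi_iff.2 fun j => measurable_cloudSum K (hg i j)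
  rw [iIndepFun_iff_charFunDual_pi fun i => (hmX i).aemeasurable]
  intro L
  -- A linear form in several sums over the cloud is again a sum over the cloud, of the combined
  -- function. Joint characteristic functions thus reduce to the characteristic functional.
  set G : ι → κ → Z → ℝ := fun i k z =>
    ∑ j, L (Pi.single i (Pi.single j 1)) * g i j k z with hG
  have hGm : ∀ i k, Measurable (G i k) := fun i k =>
    Finset.measurable_sum _ fun j _ => (hg i j k).const_mul _
  have hsingle : ∀ i (v : T i → ℝ),
      L (Pi.single i v) = ∑ j, L (Pi.single i (Pi.single j 1)) * v j := by
    intro i v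
    have hv : v = ∑ j, v j • (Pi.single j (1 : ℝ) : T i → ℝ) := by
      ext j'
      simp [Finset.sum_apply, Pi.single_apply]
    have h1 := congrArg (L.comp (ContinuousLinearMap.single ℝ (fun i => T i → ℝ) i)) hv
    rw [map_sum] at h1
    simp only [ContinuousLinearMap.map_smul, smul_eq_mul] at h1
    simp only [ContinuousLinearMap.comp_apply, ContinuousLinearMap.single_apply] at h1
    rw [h1]
    exact Finset.sum_congr rfl fun j _ => mul_comm _ _
  have hsum : ∀ v : ∀ i, T i → ℝ, L v = ∑ i, L (Pi.single i (v i)) := by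
    intro v
    rw [← map_sum, Finset.univ_sum_single]
  have hLi : ∀ i (w : Cloud κ Z),
      L (Pi.single i fun j => cloudSum K (g i j) w) = cloudSum K (G i) w := by
    intro i w
    rw [hsingle, hG]
    simp only [cloudSum_sum, cloudSum_const_mul]
  have hL : ∀ w : Cloud κ Z, L (fun i j => cloudSum K (g i j) w) =
      cloudSum K (fun k z => ∑ i, G i k z) w := by
    intro w
    rw [hsum, cloudSum_sum]
    exact Finset.sum_congr rfl fun i _ => hLi i w
  rw [charFunDual_apply, integral_map (measurable_pi_iff.2 hmX).aemeasurable
    (by fun_prop)]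
  have hR : ∀ i, charFunDual ((cloudLaw ρ η).map fun w j => cloudSum K (g i j) w)
      (L.comp (.single ℝ (fun i => T i → ℝ) i)) =
      ∫ w, Complex.exp (cloudSum K (G i) w * Complex.I) ∂(cloudLaw ρ η) := by
    intro i
    rw [charFunDual_apply, integral_map (hmX i).aemeasurable (by fun_prop)]
    simp only [ContinuousLinearMap.comp_apply, ContinuousLinearMap.single_apply, hLi]
  simp only [hL, hR]
  rw [integral_exp_cloudSum ρ η K fun k => Finset.measurable_sum _ fun i _ => hGm i k]
  simp only [integral_exp_cloudSum ρ η K (hGm _)]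
  rw [← Complex.exp_sum, Finset.sum_comm]
  congr 1
  refine Finset.sum_congr rfl fun k _ => ?_
  rw [← Finset.mul_sum, ← integral_finsetSum]
  · congr 1
    refine integral_congr_ae (ae_of_all _ fun z => ?_)
    -- At each point at most one `G i` is nonzero, so the exponential of the sum, minus one, is the
    -- sum of the exponentials, each minus one. The exponent splits over `i`, which is independence.
    by_cases h : ∃ i, G i k z ≠ 0
    · obtain ⟨i, hi⟩ := h
      have h0 : ∀ i', i' ≠ i → G i' k z = 0 := by
        intro i' hne
        obtain ⟨j, -, hj⟩ := Finset.exists_ne_zero_of_sum_ne_zero hi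
        refine Finset.sum_eq_zero fun j' _ => ?_
        rcases hd i i' hne.symm j j' k z with h | h
        · simp [h] at hj
        · simp [h]
      simp only
      rw [Fintype.sum_eq_single i h0, Fintype.sum_eq_single i]
      intro i' hne
      simp [h0 i' hne]
    · push Not at h
      simp [h]
  · intro i _
    refine Integrable.sub ?_ (integrable_const _)
    exact Integrable.of_bound (by have := hGm i k; fun_prop) 1
      (ae_of_all _ fun z => (Complex.norm_exp_ofReal_mul_I _).le)

/-- The counts of points in disjoint sets are independent. -/
theorem iIndep_cloudCount {ι : Type*} (D : ι → Set (Finset κ × (κ → Set Z)))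
    (hm : ∀ i, ∀ C ∈ D i, ∀ k, MeasurableSet (C.2 k))
    (hd : ∀ i i', i ≠ i' → ∀ C ∈ D i, ∀ C' ∈ D i', ∀ k ∈ C.1, k ∈ C'.1 →
      Disjoint (C.2 k) (C'.2 k)) :
    iIndep (fun i => ⨆ (C) (_ : C ∈ D i),
      MeasurableSpace.comap (cloudCount C.1 C.2) inferInstance) (cloudLaw ρ η) := by
  classical
  have key : iIndepFun (fun i w (C : D i) => (cloudCount C.1.1 C.1.2 w : ℝ)) (cloudLaw ρ η) := by
    refine iIndepFun.iIndepFun_process (𝓧 := fun _ _ => ℝ)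
      (X := fun i (C : D i) w => (cloudCount C.1.1 C.1.2 w : ℝ)) ?_ fun I J => ?_
    · intro i C
      exact measurable_from_top.comp (measurable_cloudCount _ (hm i C.1 C.2))
    set K : Finset κ := Finset.univ.biUnion fun i : I => (J i).biUnion fun C => C.1.1 with hK
    have hsub : ∀ (i : I) (C : J i), C.1.1.1 ⊆ K := fun i C k hk =>
      Finset.mem_biUnion.2 ⟨i, Finset.mem_univ _, Finset.mem_biUnion.2 ⟨C.1, C.2, hk⟩⟩
    have h := iIndepFun_cloudSum ρ η K (ι := I) (T := fun i => J i)
      (g := fun i C k z => (C.1.1.1 : Set κ).indicator (fun k => (C.1.1.2 k).indicator 1 z) k)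
      (fun i C k => ?_) ?_
    · simp only [cloudSum_mono_blocks (hsub _ _)] at h
      simpa only [cast_cloudCount] using h
    · by_cases hk : k ∈ (C.1.1.1 : Set κ)
      · simp only [Set.indicator_of_mem hk]
        exact measurable_one.indicator (hm i _ C.1.2 k)
      · simp only [Set.indicator_of_notMem hk]
        exact measurable_const
    · intro i i' hne C C' k z
      by_contra! hcon
      have h1 := Set.mem_of_indicator_ne_zero hcon.1
      have h2 := Set.mem_of_indicator_ne_zero hcon.2
      rw [Set.indicator_of_mem h1, Set.indicator_of_mem h2] at hcon
      exact Set.disjoint_left.1 (hd i i' (fun h => hne (Subtype.ext h)) _ C.1.2 _ C'.1.2 k h1 h2)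
        (Set.mem_of_indicator_ne_zero hcon.1) (Set.mem_of_indicator_ne_zero hcon.2)
  rw [iIndepFun_iff_iIndep] at key
  refine iIndep_of_iIndep_of_le key fun i => iSup_le fun C => iSup_le fun hC => ?_
  have h1 : cloudCount C.1 C.2 = (fun v : D i → ℝ => ⌊v ⟨C, hC⟩⌋₊) ∘
      fun w (C : D i) => (cloudCount C.1.1 C.1.2 w : ℝ) := by
    ext w; simp
  conv_lhs => rw [h1]
  rw [← MeasurableSpace.comap_comp]
  exact MeasurableSpace.comap_mono
    (Nat.measurable_floor.comp (measurable_pi_apply _)).comap_le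

/-- The characteristic functional at `a` times the indicator of `C` is the characteristic function
at `a` of a Poisson law whose parameter sums those of the blocks. -/
theorem hasLaw_cloudCount (K : Finset κ) {C : κ → Set Z} (hC : ∀ k, MeasurableSet (C k)) :
    HasLaw (cloudCount K C) (poissonMeasure (∑ k ∈ K, ρ k * (η k (C k)).toNNReal))
      (cloudLaw ρ η) := by
  have hm := measurable_cloudCount K hC
  refine ⟨hm.aemeasurable, ?_⟩
  have hcast : MeasurableEmbedding (Nat.cast : ℕ → ℝ) :=
    ⟨Nat.cast_injective, measurable_from_top, fun {s} _ =>
      (s.to_countable.image _).measurableSet⟩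
  refine hcast.map_injective ?_
  have := Measure.isProbabilityMeasure_map (μ := cloudLaw ρ η) hm.aemeasurable
  have h1 := Measure.isProbabilityMeasure_map
    (μ := (cloudLaw ρ η).map (cloudCount K C)) hcast.measurable.aemeasurable
  have h2 := Measure.isProbabilityMeasure_map
    (μ := poissonMeasure (∑ k ∈ K, ρ k * (η k (C k)).toNNReal)) hcast.measurable.aemeasurable
  refine Measure.ext_of_charFun ?_
  ext a
  rw [charFun_map_cast_poissonMeasure, Measure.map_map hcast.measurable hm, charFun_apply,
    integral_map (hcast.measurable.comp hm).aemeasurable (by fun_prop)]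
  have h3 := integral_exp_cloudSum ρ η K (g := fun k z => a * (C k).indicator 1 z)
    fun k => (measurable_one.indicator (hC k)).const_mul a
  simp only [cloudSum_const_mul] at h3
  simp only [Function.comp_apply, cast_cloudCount, Real.inner_apply, mul_comm _ a]
  rw [h3]
  congr 1
  push_cast
  rw [Finset.sum_mul]
  refine Finset.sum_congr rfl fun k _ => ?_
  rw [mul_assoc]
  congr 1
  have h4 : ∀ z, Complex.exp ((a : ℂ) * ((C k).indicator 1 z : ℝ) * Complex.I) - 1 =
      (C k).indicator (fun _ => Complex.exp (a * Complex.I) - 1) z := by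
    intro z
    by_cases hz : z ∈ C k <;> simp [hz]
  rw [integral_congr_ae (ae_of_all _ h4), integral_indicator_const _ (hC k), Complex.real_smul]
  rfl

end Cloud


/-! ### Poisson processes on the half-line -/

section Enumeration

/-- A set with finitely many elements below each level of an injective function to a linear order
can be enumerated in increasing order. -/
theorem exists_enumeration {I α : Type*} [LinearOrder α] (A : Set I) (hA : A.Infinite) (f : I → α)
    (hinj : Set.InjOn f A) (hfin : ∀ t, {i ∈ A | f i ≤ t}.Finite) :
    ∃ e : ℕ → I, Set.range e = A ∧ StrictMono fun n => f (e n) := by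
  -- The rank of an element is the finite number of elements below it. It is strictly monotone for
  -- `f`, so its range is an infinite set of integers, listed in increasing order.
  set rank : A → ℕ := fun i => Set.ncard {j ∈ A | f j < f i} with hrank
  have hfin' : ∀ i : A, {j ∈ A | f j < f i}.Finite := fun i =>
    (hfin (f i)).subset fun j hj => ⟨hj.1, hj.2.le⟩
  have hmono : ∀ i j : A, f i ≤ f j → rank i ≤ rank j := fun i j h =>
    Set.ncard_le_ncard (fun k hk => ⟨hk.1, hk.2.trans_le h⟩) (hfin' j)
  have hstrict : ∀ i j : A, f i < f j → rank i < rank j := fun i j h => by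
    refine Set.ncard_lt_ncard ⟨fun k hk => ⟨hk.1, hk.2.trans h⟩, fun hsub => ?_⟩ (hfin' j)
    exact lt_irrefl _ (hsub ⟨i.2, h⟩).2
  have hrinj : Function.Injective rank := fun i j h => by
    by_contra hne
    rcases lt_or_gt_of_ne fun h' => hne (Subtype.ext (hinj i.2 j.2 h')) with h' | h'
    · exact (hstrict i j h').ne h
    · exact (hstrict j i h').ne h.symm
  have : Infinite A := hA.to_subtype
  have : Infinite (Set.range rank) := (Set.infinite_range_of_injective hrinj).to_subtype
  set o := Nat.Subtype.orderIsoOfNat (Set.range rank)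
  set e := Equiv.ofInjective rank hrinj
  have hr : ∀ n, rank (e.symm (o n)) = o n := fun n =>
    congrArg Subtype.val (e.apply_symm_apply (o n))
  refine ⟨fun n => (e.symm (o n)).1, ?_, fun n n' h => ?_⟩
  · ext i
    constructor
    · rintro ⟨n, rfl⟩
      exact (e.symm (o n)).2
    · intro hi
      refine ⟨o.symm (e ⟨i, hi⟩), ?_⟩
      simp
  · by_contra! hle
    have h1 := hmono _ _ hle
    rw [hr, hr] at h1
    exact absurd (o.strictMono h) (not_lt.2 h1)

theorem tendsto_atTop_of_injective {τ : ℕ → ℝ≥0} (h : ∀ t, {n | τ n ≤ t}.Finite) :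
    Tendsto τ atTop atTop := by
  refine tendsto_atTop.2 fun t => ?_
  rw [← Nat.cofinite_eq_atTop, eventually_cofinite]
  exact (h t).subset fun n hn => (not_le.1 hn).le

end Enumeration

/-! ### Poisson clouds cut into unit intervals -/

section HalfLine

/-- The Lebesgue measure of an intersection with `(0, n]`, as a sum over unit intervals. -/
theorem sum_volume_inter_Ioc {s t : ℝ≥0} (hst : s ≤ t) {n : ℕ} (htn : t ≤ n) :
    ∑ k ∈ Finset.range n, (volume.restrict (Set.Ioc (k : ℝ) (k + 1))) (Set.Ioc (s : ℝ) t) =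
      ((t - s : ℝ≥0) : ℝ≥0∞) := by
  have h : ∀ n : ℕ, ∑ k ∈ Finset.range n,
      (volume.restrict (Set.Ioc (k : ℝ) (k + 1))) (Set.Ioc (s : ℝ) t) =
      volume (Set.Ioc (s : ℝ) t ∩ Set.Ioc (0 : ℝ) n) := by
    intro n
    induction n with
    | zero => simp
    | succ n ih =>
      have hu : Set.Ioc (0 : ℝ) ((n + 1 : ℕ) : ℝ) = Set.Ioc (0 : ℝ) n ∪ Set.Ioc (n : ℝ) (n + 1) := by
        rw [Set.Ioc_union_Ioc_eq_Ioc (by positivity) (by linarith)]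
        push_cast
        rfl
      rw [Finset.sum_range_succ, ih, Measure.restrict_apply measurableSet_Ioc, hu,
        Set.inter_union_distrib_left, measure_union ?_ (by measurability)]
      exact Disjoint.mono Set.inter_subset_right Set.inter_subset_right
        (Set.Ioc_disjoint_Ioc_of_le le_rfl)
  rw [h, Set.inter_eq_left.2, Real.volume_Ioc]
  · rw [← NNReal.coe_sub hst, ENNReal.ofReal_coe_nnreal]
  · have : (t : ℝ) ≤ n := by exact_mod_cast htn
    exact Set.Ioc_subset_Ioc s.2 this

variable {E : Type*} [MeasurableSpace E]

/-- The law of a point with a uniform instant in `(k, k + 1]` and a mark of law `ν`. -/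
def pointLaw (k : ℕ) (ν : Measure E) : Measure (ℝ≥0 × E) :=
  ((volume.restrict (Set.Ioc (k : ℝ) (k + 1))).map Real.toNNReal).prod ν

theorem toNNReal_preimage_Ioc (a b : ℝ≥0) :
    Real.toNNReal ⁻¹' Set.Ioc a b = Set.Ioc (a : ℝ) b := by
  ext x
  simp [Real.lt_toNNReal_iff_coe_lt, Real.toNNReal_le_iff_le_coe]

theorem map_toNNReal_Ioc (k : ℕ) (a b : ℝ≥0) :
    ((volume.restrict (Set.Ioc (k : ℝ) (k + 1))).map Real.toNNReal) (Set.Ioc a b) =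
      (volume.restrict (Set.Ioc (k : ℝ) (k + 1))) (Set.Ioc (a : ℝ) b) := by
  rw [Measure.map_apply measurable_real_toNNReal measurableSet_Ioc, toNNReal_preimage_Ioc]

instance (k : ℕ) :
    IsProbabilityMeasure ((volume.restrict (Set.Ioc (k : ℝ) (k + 1))).map Real.toNNReal) := by
  have : IsProbabilityMeasure (volume.restrict (Set.Ioc (k : ℝ) (k + 1))) :=
    ⟨by simp⟩
  exact Measure.isProbabilityMeasure_map measurable_real_toNNReal.aemeasurable

instance (k : ℕ) (ν : Measure E) [IsProbabilityMeasure ν] : IsProbabilityMeasure (pointLaw k ν) := by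
  unfold pointLaw; infer_instance

variable (ν : Measure E) [IsProbabilityMeasure ν]

theorem map_fst_pointLaw (k : ℕ) : (pointLaw k ν).map Prod.fst =
    (volume.restrict (Set.Ioc (k : ℝ) (k + 1))).map Real.toNNReal := by
  rw [pointLaw, Measure.map_fst_prod, measure_univ, one_smul]

theorem pointLaw_mem_Ioc (k : ℕ) : ∀ᵐ z ∂(pointLaw k ν), z.1 ∈ Set.Ioc (k : ℝ≥0) (k + 1) := by
  have h : ∀ᵐ x ∂((pointLaw k ν).map Prod.fst), x ∈ Set.Ioc (k : ℝ≥0) (k + 1) := by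
    rw [map_fst_pointLaw]
    refine (ae_map_iff measurable_real_toNNReal.aemeasurable
      (p := fun x => x ∈ Set.Ioc (k : ℝ≥0) (k + 1)) measurableSet_Ioc).2 ?_
    filter_upwards [ae_restrict_mem measurableSet_Ioc] with x hx
    have := toNNReal_preimage_Ioc k (k + 1)
    push_cast at this
    rwa [← this] at hx
  exact ae_of_ae_map measurable_fst.aemeasurable h

theorem pointLaw_singleton (k : ℕ) (x : ℝ≥0) : ((pointLaw k ν).map Prod.fst) {x} = 0 := by
  rw [map_fst_pointLaw, Measure.map_apply measurable_real_toNNReal (measurableSet_singleton x)]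
  refine le_antisymm ?_ zero_le
  rcases eq_or_ne x 0 with rfl | hx
  · have : Real.toNNReal ⁻¹' {0} = Set.Iic 0 := by ext y; simp
    rw [this, Measure.restrict_apply measurableSet_Iic]
    have h0 : Set.Iic (0 : ℝ) ∩ Set.Ioc (k : ℝ) (k + 1) = ∅ := by
      ext y
      simp only [Set.mem_inter_iff, Set.mem_Iic, Set.mem_Ioc, Set.mem_empty_iff_false, iff_false]
      rintro ⟨h1, h2, -⟩
      have : (0 : ℝ) ≤ k := by positivity
      linarith
    rw [h0, measure_empty]
  · have : Real.toNNReal ⁻¹' {x} ⊆ {(x : ℝ)} := by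
      intro y hy
      simp only [Set.mem_preimage, Set.mem_singleton_iff] at hy ⊢
      rw [← hy, Real.coe_toNNReal']
      refine (max_eq_left ?_).symm
      by_contra! h
      exact hx (by rw [← hy, Real.toNNReal_of_nonpos h.le])
    refine (measure_mono this).trans ?_
    refine (Measure.restrict_apply_le _ _).trans ?_
    simp

/-- By Fubini the diagonal is null for a product law whose second factor has no atoms. -/
theorem IndepFun.ae_ne {Ω : Type*} {m : MeasurableSpace Ω} {P : Measure Ω} [IsProbabilityMeasure P]
    {U V : Ω → ℝ≥0} (hU : Measurable U) (hV : Measurable V) (h : IndepFun U V P)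
    (h0 : ∀ x, (P.map V) {x} = 0) : ∀ᵐ ω ∂P, U ω ≠ V ω := by
  have h1 := (indepFun_iff_map_prod_eq_prod_map_map hU.aemeasurable hV.aemeasurable).1 h
  have hd : MeasurableSet {p : ℝ≥0 × ℝ≥0 | p.1 = p.2} :=
    measurableSet_eq_fun measurable_fst measurable_snd
  have h2 : (P.map fun ω => (U ω, V ω)) {p | p.1 = p.2} = 0 := by
    have := Measure.isProbabilityMeasure_map (μ := P) hV.aemeasurable
    rw [h1, Measure.measure_prod_null hd]
    refine ae_of_all _ fun x => ?_
    have : Prod.mk x ⁻¹' {p : ℝ≥0 × ℝ≥0 | p.1 = p.2} = {x} := by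
      ext y; simp [eq_comm]
    simp only [this, h0, Pi.zero_apply]
  rw [Measure.map_apply (hU.prodMk hV) hd] at h2
  rw [ae_iff]
  simpa using h2

variable (r : Bool → ℝ≥0)

/-- The law of two independent Poisson clouds of points of the half-line marked by draws of law `ν`,
split into unit intervals. -/
def halfLineLaw : Measure (Cloud (Bool × ℕ) (ℝ≥0 × E)) :=
  cloudLaw (fun k => r k.1) fun k => pointLaw k.2 ν

instance : IsProbabilityMeasure (halfLineLaw ν r) := by
  unfold halfLineLaw; infer_instance

/-- The blocks which make up the interval `(0, n]`. -/
def halfLineBlocks (b : Bool) (n : ℕ) : Finset (Bool × ℕ) :=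
  (Finset.range n).map (Function.Embedding.sectR b ℕ)

theorem measurePreserving_block (k : Bool × ℕ) :
    MeasurePreserving (fun w : Cloud (Bool × ℕ) (ℝ≥0 × E) => w k) (halfLineLaw ν r)
      (blockLaw (r k.1) (pointLaw k.2 ν)) :=
  measurePreserving_eval_infinitePi _ k

theorem measurePreserving_snd_blockLaw (a : ℝ≥0) (μ : Measure (ℝ≥0 × E)) [IsProbabilityMeasure μ] :
    MeasurePreserving Prod.snd (blockLaw a μ) (Measure.infinitePi fun _ : ℕ => μ) :=
  measurePreserving_snd

theorem measurePreserving_point (k : Bool × ℕ) (i : ℕ) :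
    MeasurePreserving (fun w : Cloud (Bool × ℕ) (ℝ≥0 × E) => (w k).2 i) (halfLineLaw ν r)
      (pointLaw k.2 ν) :=
  (measurePreserving_eval_infinitePi (fun _ : ℕ => pointLaw k.2 ν) i).comp
    ((measurePreserving_snd_blockLaw _ _).comp (measurePreserving_block ν r k))

theorem ae_mem_Ioc : ∀ᵐ w ∂(halfLineLaw ν r), ∀ (k : Bool × ℕ) (i : ℕ),
    ((w k).2 i).1 ∈ Set.Ioc (k.2 : ℝ≥0) (k.2 + 1) := by
  refine ae_all_iff.2 fun k => ae_all_iff.2 fun i => ?_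
  exact (measurePreserving_point ν r k i).quasiMeasurePreserving.ae (pointLaw_mem_Ioc ν k.2)

theorem ae_instant_ne : ∀ᵐ w ∂(halfLineLaw ν r), ∀ x y : (Bool × ℕ) × ℕ, x ≠ y →
    ((w x.1).2 x.2).1 ≠ ((w y.1).2 y.2).1 := by
  refine ae_all_iff.2 fun x => ae_all_iff.2 fun y => ?_
  by_cases hxy : x = y
  · exact ae_of_all _ fun w h => absurd hxy h
  simp only [hxy, ne_eq, not_false_eq_true, forall_const]
  -- Two points of the same block are independent coordinates of its sequence; points of different
  -- blocks are independent because the blocks are.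
  by_cases h1 : x.1 = y.1
  · have h2 : x.2 ≠ y.2 := fun h => hxy (Prod.ext h1 h)
    have hI : IndepFun (fun z : ℕ → ℝ≥0 × E => (z x.2).1) (fun z => (z y.2).1)
        (Measure.infinitePi fun _ : ℕ => pointLaw x.1.2 ν) :=
      (iIndepFun_infinitePi (P := fun _ : ℕ => pointLaw x.1.2 ν)
        (X := fun _ z => z.1) fun _ => measurable_fst).indepFun h2
    have h3 := IndepFun.ae_ne (by fun_prop) (by fun_prop) hI fun a => by
      have := (measurePreserving_eval_infinitePi (fun _ : ℕ => pointLaw x.1.2 ν) y.2).map_eq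
      have h4 : (fun z : ℕ → ℝ≥0 × E => (z y.2).1) = Prod.fst ∘ Function.eval y.2 := rfl
      rw [h4, ← Measure.map_map measurable_fst (measurable_pi_apply _), this, pointLaw_singleton]
    rw [← h1]
    exact ((measurePreserving_snd_blockLaw _ _).comp
      (measurePreserving_block ν r x.1)).quasiMeasurePreserving.ae h3
  · have hI : IndepFun (fun w : Cloud (Bool × ℕ) (ℝ≥0 × E) => w x.1) (fun w => w y.1)
        (halfLineLaw ν r) :=
      (iIndepFun_infinitePi (P := fun k : Bool × ℕ => blockLaw (r k.1) (pointLaw k.2 ν))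
        (X := fun _ z => z) fun _ => measurable_id).indepFun h1
    refine IndepFun.ae_ne (by fun_prop) (by fun_prop) (hI.comp
      (φ := fun p : ℕ × (ℕ → ℝ≥0 × E) => (p.2 x.2).1)
      (ψ := fun p : ℕ × (ℕ → ℝ≥0 × E) => (p.2 y.2).1) (by fun_prop) (by fun_prop)) fun a => ?_
    have h4 : (fun p : ℕ × (ℕ → ℝ≥0 × E) => (p.2 y.2).1) ∘
      (fun w : Cloud (Bool × ℕ) (ℝ≥0 × E) => w y.1) =
        Prod.fst ∘ fun w : Cloud (Bool × ℕ) (ℝ≥0 × E) => (w y.1).2 y.2 := rfl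
    have h5 := (measurePreserving_point ν r y.1 y.2)
    change (Measure.map (Prod.fst ∘ fun w : Cloud (Bool × ℕ) (ℝ≥0 × E) => (w y.1).2 y.2) _) {a} = 0
    rw [← Measure.map_map measurable_fst h5.measurable, h5.map_eq, pointLaw_singleton]

theorem ae_exists_block (hr : ∀ b, 0 < r b) :
    ∀ᵐ w ∂(halfLineLaw ν r), ∀ (b : Bool) (n : ℕ), ∃ k ≥ n, 1 ≤ (w (b, k)).1 := by
  refine ae_all_iff.2 fun b => ae_all_iff.2 fun n => ?_
  -- If all blocks from `n` on are empty, so are the first `M` of them, which has probability `exp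
  -- (-r b) ^ M`. This tends to zero with `M`.
  have hlaw : ∀ M : ℕ, halfLineLaw ν r {w | ¬ ∃ k ≥ n, 1 ≤ (w (b, k)).1} ≤
      ENNReal.ofReal (Real.exp (-(r b)) ^ M) := by
    intro M
    set K : Finset (Bool × ℕ) := (Finset.Ico n (n + M)).map (Function.Embedding.sectR b ℕ)
    have h := hasLaw_cloudCount (fun k : Bool × ℕ => r k.1) (fun k => pointLaw k.2 ν) K
      (C := fun _ => Set.univ) fun _ => MeasurableSet.univ
    have h1 : {w : Cloud (Bool × ℕ) (ℝ≥0 × E) | ¬ ∃ k ≥ n, 1 ≤ (w (b, k)).1} ⊆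
        cloudCount K (fun _ => Set.univ) ⁻¹' {0} := by
      intro w hw
      push Not at hw
      simp only [Set.mem_preimage, Set.mem_singleton_iff, cloudCount, K, Finset.sum_map]
      refine Finset.sum_eq_zero fun k hk => ?_
      have := hw k (Finset.mem_Ico.1 hk).1
      have h0 : (w (b, k)).1 = 0 := by omega
      simp [h0]
    refine (measure_mono h1).trans ?_
    rw [halfLineLaw, ← Measure.map_apply (measurable_cloudCount K fun _ => MeasurableSet.univ)
      (measurableSet_singleton 0), h.map_eq, poissonMeasure_singleton]
    refine (congrArg ENNReal.ofReal ?_).le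
    simp only [measure_univ, K, Finset.sum_map, Function.Embedding.sectR_apply]
    simp [← Real.exp_nat_mul]
  rw [ae_iff]
  refine le_antisymm (ge_of_tendsto' (x := atTop) ?_ hlaw) zero_le
  have h2 : Tendsto (fun M : ℕ => Real.exp (-(r b)) ^ M) atTop (𝓝 0) :=
    tendsto_pow_atTop_nhds_zero_of_lt_one (Real.exp_pos _).le
      (Real.exp_lt_one_iff.2 (by simpa using hr b))
  simpa using ENNReal.tendsto_ofReal h2

end HalfLine


/-! ### Enumeration of the points of a cloud -/

section PointsOfCloud

variable {E : Type*}

/-- The properties which allow to enumerate the points of a cloud of the half-line. -/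
structure IsSimpleCloud (w : Cloud (Bool × ℕ) (ℝ≥0 × E)) : Prop where
  mem_Ioc : ∀ (k : Bool × ℕ) (i : ℕ), ((w k).2 i).1 ∈ Set.Ioc (k.2 : ℝ≥0) (k.2 + 1)
  instant_ne : ∀ x y : (Bool × ℕ) × ℕ, x ≠ y → ((w x.1).2 x.2).1 ≠ ((w y.1).2 y.2).1
  exists_block : ∀ (b : Bool) (n : ℕ), ∃ k ≥ n, 1 ≤ (w (b, k)).1

/-- The indices (block and rank in the block) of the points of one half of the cloud. -/
def cloudIndices (b : Bool) (w : Cloud (Bool × ℕ) (ℝ≥0 × E)) : Set (Σ _ : ℕ, ℕ) :=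
  {x | x.2 < (w (b, x.1)).1}

theorem IsSimpleCloud.finite_cloudIndices {w : Cloud (Bool × ℕ) (ℝ≥0 × E)} (hw : IsSimpleCloud w)
    (b : Bool) (t : ℝ≥0) : {x ∈ cloudIndices b w | ((w (b, x.1)).2 x.2).1 ≤ t}.Finite := by
  refine ((Finset.range (⌈t⌉₊)).sigma fun k => Finset.range (w (b, k)).1).finite_toSet.subset
    fun x hx => ?_
  simp only [Finset.coe_sigma, Set.mem_sigma_iff, Finset.coe_range, Set.mem_Iio]
  refine ⟨?_, hx.1⟩
  have h1 := (hw.mem_Ioc (b, x.1) x.2).1.trans_le (hx.2.trans (Nat.le_ceil t))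
  exact_mod_cast h1

theorem IsSimpleCloud.exists_enumeration {w : Cloud (Bool × ℕ) (ℝ≥0 × E)} (hw : IsSimpleCloud w)
    (b : Bool) : ∃ e : ℕ → (Σ _ : ℕ, ℕ), Set.range e = cloudIndices b w ∧
      StrictMono fun n => ((w (b, (e n).1)).2 (e n).2).1 := by
  refine LoadBalancing.exists_enumeration (cloudIndices b w) ?_
    (fun x => ((w (b, x.1)).2 x.2).1) ?_ (hw.finite_cloudIndices b)
  · refine Set.Infinite.of_image Sigma.fst (Set.infinite_of_not_bddAbove ?_)
    rintro ⟨n, hn⟩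
    obtain ⟨k, hk, h1⟩ := hw.exists_block b (n + 1)
    have := hn ⟨⟨k, 0⟩, h1, rfl⟩
    simp only at this
    omega
  · rintro ⟨k, i⟩ - ⟨k', i'⟩ - h
    by_contra hne
    exact hw.instant_ne ((b, k), i) ((b, k'), i') (fun h' => hne (by
      simp only [Prod.mk.injEq, true_and] at h'
      rw [h'.1, h'.2])) h

theorem cloudCount_halfLine_eq_ncard (w : Cloud (Bool × ℕ) (ℝ≥0 × E)) (b : Bool) (n : ℕ)
    (C : Set (ℝ≥0 × E)) : cloudCount (halfLineBlocks b n) (fun _ => C) w =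
      Set.ncard {x ∈ cloudIndices b w | x.1 < n ∧ (w (b, x.1)).2 x.2 ∈ C} := by
  classical
  have h : {x ∈ cloudIndices b w | x.1 < n ∧ (w (b, x.1)).2 x.2 ∈ C} =
      ((Finset.range n).sigma fun k => (Finset.range (w (b, k)).1).filter fun i =>
        (w (b, k)).2 i ∈ C : Finset (Σ _ : ℕ, ℕ)) := by
    ext x
    simp only [cloudIndices, Set.mem_ofPred_eq, Finset.coe_sigma, Set.mem_sigma_iff, Finset.coe_range,
      Set.mem_Iio, Finset.coe_filter, Finset.mem_range]
    tauto
  rw [h, Set.ncard_coe_finset, Finset.card_sigma, cloudCount, halfLineBlocks, Finset.sum_map]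
  refine Finset.sum_congr rfl fun k _ => ?_
  rw [Finset.card_filter]
  refine Finset.sum_congr rfl fun i _ => ?_
  simp [Set.indicator_apply]

/-- Block `k` lives in `(k, k + 1]`, so the points up to `t ≤ n` all lie in the first `n` blocks,
and enumerating them does not change their number. -/
theorem IsSimpleCloud.ncard_eq_cloudCount {w : Cloud (Bool × ℕ) (ℝ≥0 × E)} (hw : IsSimpleCloud w)
    {b : Bool} {e : ℕ → (Σ _ : ℕ, ℕ)} (he : Set.range e = cloudIndices b w)
    (hinj : Function.Injective e) {s t : ℝ≥0} {n : ℕ} (htn : t ≤ n) (B : Set E) :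
    Set.ncard {i | s < ((w (b, (e i).1)).2 (e i).2).1 ∧ ((w (b, (e i).1)).2 (e i).2).1 ≤ t ∧
      ((w (b, (e i).1)).2 (e i).2).2 ∈ B} =
      cloudCount (halfLineBlocks b n) (fun _ => Set.Ioc s t ×ˢ B) w := by
  rw [cloudCount_halfLine_eq_ncard, ← Set.ncard_image_of_injective _ hinj]
  congr 1
  ext x
  rw [← he]
  constructor
  · rintro ⟨i, ⟨h1, h2, h3⟩, rfl⟩
    refine ⟨⟨i, rfl⟩, ?_, ⟨⟨h1, h2⟩, h3⟩⟩
    have := (hw.mem_Ioc (b, (e i).1) (e i).2).1.trans_le (h2.trans htn)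
    exact_mod_cast this
  · rintro ⟨⟨i, rfl⟩, -, ⟨h1, h2⟩, h3⟩
    exact ⟨i, ⟨h1, h2, h3⟩, rfl⟩

variable [MeasurableSpace E]

theorem ae_isSimpleCloud (ν : Measure E) [IsProbabilityMeasure ν] {r : Bool → ℝ≥0}
    (hr : ∀ b, 0 < r b) : ∀ᵐ w ∂(halfLineLaw ν r), IsSimpleCloud w := by
  filter_upwards [ae_mem_Ioc ν r, ae_instant_ne ν r, ae_exists_block ν r hr] with w h1 h2 h3
  exact ⟨h1, h2, h3⟩

/-- The marked points of a cloud, enumerated in increasing order of their instants. -/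
theorem exists_markedPoints (ν : Measure E) [IsProbabilityMeasure ν] {r : Bool → ℝ≥0}
    (hr : ∀ b, 0 < r b) : ∃ N : Bool → MarkedPoints (Cloud (Bool × ℕ) (ℝ≥0 × E)) E,
      (∀ b n w, 0 < (N b).T n w) ∧ (∀ b w, StrictMono fun n => (N b).T n w) ∧
      (∀ b w, Tendsto (fun n => (N b).T n w) atTop atTop) ∧
      (∀ w n n', (N true).T n w ≠ (N false).T n' w) ∧
      ∀ᵐ w ∂(halfLineLaw ν r), ∀ (b : Bool) (s t : ℝ≥0) (n : ℕ), t ≤ n → ∀ B,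
        (N b).count s t B w = cloudCount (halfLineBlocks b n) (fun _ => Set.Ioc s t ×ˢ B) w := by
  classical
  obtain ⟨w₀, hw₀⟩ := (ae_isSimpleCloud ν hr).exists
  -- Exceptional clouds are replaced by one fixed simple cloud, so that the properties of the points
  -- hold on every path. The counts are altered on a null event only.
  set v : Cloud (Bool × ℕ) (ℝ≥0 × E) → Cloud (Bool × ℕ) (ℝ≥0 × E) := fun w =>
    if IsSimpleCloud w then w else w₀ with hv
  have hsv : ∀ w, IsSimpleCloud (v w) := fun w => by
    by_cases h : IsSimpleCloud w <;> simp [hv, h, hw₀]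
  choose e he hmono using fun w b => (hsv w).exists_enumeration b
  have hinj : ∀ w b, Function.Injective (e w b) := fun w b i j h => by
    refine (hmono w b).injective ?_
    simp only [h]
  refine ⟨fun b => ⟨fun n w => ((v w (b, (e w b n).1)).2 (e w b n).2).1,
    fun n w => ((v w (b, (e w b n).1)).2 (e w b n).2).2⟩, fun b n w => ?_, fun b w => hmono w b,
    fun b w => ?_, fun w n n' => ?_, ?_⟩
  · exact zero_le.trans_lt ((hsv w).mem_Ioc (b, (e w b n).1) (e w b n).2).1
  · refine tendsto_atTop_of_injective fun t => ?_
    refine Set.Finite.of_finite_image (((hsv w).finite_cloudIndices b t).subset ?_)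
      (hinj w b).injOn
    rintro _ ⟨n, hn, rfl⟩
    exact ⟨he w b ▸ ⟨n, rfl⟩, hn⟩
  · exact (hsv w).instant_ne ((true, _), _) ((false, _), _) (by simp)
  · filter_upwards [ae_isSimpleCloud ν hr] with w hw b s t n htn B
    have hvw : v w = w := by simp [hv, hw]
    have h1 := (hsv w).ncard_eq_cloudCount (he w b) (hinj w b) (s := s) htn B
    rw [MarkedPoints.count, h1, hvw]

theorem sum_halfLineBlocks (ν : Measure E) [IsProbabilityMeasure ν] (r : Bool → ℝ≥0) (b : Bool)
    {s t : ℝ≥0} (hst : s ≤ t) {n : ℕ} (htn : t ≤ n) (B : Set E) :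
    ∑ k ∈ halfLineBlocks b n, r k.1 * (pointLaw k.2 ν (Set.Ioc s t ×ˢ B)).toNNReal =
      r b * (ν B).toNNReal * (t - s) := by
  have h := congrArg ENNReal.toNNReal (sum_volume_inter_Ioc hst htn)
  rw [ENNReal.toNNReal_coe, ENNReal.toNNReal_sum fun k _ => ?_] at h
  · rw [halfLineBlocks, Finset.sum_map, ← h, Finset.mul_sum]
    refine Finset.sum_congr rfl fun k _ => ?_
    simp only [Function.Embedding.sectR_apply, pointLaw]
    rw [Measure.prod_prod, map_toNNReal_Ioc, ENNReal.toNNReal_mul]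
    ring
  · rw [← map_toNNReal_Ioc]
    exact measure_ne_top _ _

theorem hasLaw_cloudCount_halfLine (ν : Measure E) [IsProbabilityMeasure ν] (r : Bool → ℝ≥0)
    (b : Bool) {s t : ℝ≥0} (hst : s ≤ t) {n : ℕ} (htn : t ≤ n) {B : Set E}
    (hB : MeasurableSet B) :
    HasLaw (cloudCount (halfLineBlocks b n) fun _ => Set.Ioc s t ×ˢ B)
      (poissonMeasure (r b * (ν B).toNNReal * (t - s))) (halfLineLaw ν r) := by
  rw [← sum_halfLineBlocks ν r b hst htn B]
  exact hasLaw_cloudCount _ _ _ fun _ => measurableSet_Ioc.prod hB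

end PointsOfCloud


/-! ### Paths driven by given points -/

section PathConstruction

variable {c : ℕ}

/-- The transition at an arrival with mark `p`. -/
def arrivalStep (pol : Policy c) (p : Mark c) (x : State c) : State c :=
  x + Pi.single (pol.route x (rankedQueue x p.1) p.2) 1

open Classical in
/-- The transition at a potential service completion with mark `p`. -/
def serviceStep (pol : Policy c) (p : Mark c) (x : State c) : State c :=
  if 1 ≤ x (rankedQueue x p.1) then x - Pi.single (pol.release x (rankedQueue x p.1) p.2) 1 else x

theorem serviceStep_add (pol : Policy c) (p : Mark c) {x : State c}
    (hx : 1 ≤ x (rankedQueue x p.1)) :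
    serviceStep pol p x + Pi.single (pol.release x (rankedQueue x p.1) p.2) 1 = x := by
  have h := hx.trans (pol.le_release x (rankedQueue x p.1) p.2 hx)
  rw [serviceStep, if_pos hx]
  ext i
  by_cases hi : i = pol.release x (rankedQueue x p.1) p.2
  · subst hi
    simp only [Pi.add_apply, Pi.sub_apply, Pi.single_eq_same]
    omega
  · simp [Pi.single_eq_of_ne hi]

theorem pathCount_apply_strictMono {τ : ℕ → ℝ≥0} (hτ : StrictMono τ) (n : ℕ) :
    pathCount τ (fun _ => True) (τ n) = n + 1 := by
  have : {k | τ k ≤ τ n ∧ True} = (Finset.range (n + 1) : Set ℕ) := by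
    ext k; simp [hτ.le_iff_le]
  rw [pathCount, this, Set.ncard_coe_finset, Finset.card_range]

/-- Paths which evolve by given transitions at given instants. -/
theorem exists_path {S : Type*} [TopologicalSpace S] [DiscreteTopology S] {τ : ℕ → ℝ≥0}
    (hτ : StrictMono τ) (hpos : ∀ n, 0 < τ n) (hlim : Tendsto τ atTop atTop) (step : ℕ → S → S)
    (x₀ : S) : ∃ x : ℝ≥0 → S, x 0 = x₀ ∧ IsCadlag x ∧
      (∀ n, x (τ n) = step n (Function.leftLim x (τ n))) ∧
      ∀ t, (∀ n, t ≠ τ n) → x t = Function.leftLim x t := by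
  -- The path is `y` evaluated at the number of instants passed so far: at `τ n` this number goes
  -- from `n` to `n + 1`.
  set y : ℕ → S := fun n => Nat.rec x₀ (fun k a => step k a) n with hy
  set N := pathCount τ (fun _ => True) with hN
  have hcad : IsCadlag N := pathCount_isCadlag hlim _
  have hleft : ∀ t, Function.leftLim (fun u => y (N u)) t = y (Function.leftLim N t) :=
    fun t =>
    leftLim_comp (κ := Unit) (x := fun _ => N) (fun _ => hcad) (fun v => y (v ())) t
  refine ⟨fun t => y (N t), ?_, ?_, fun n => ?_, fun t ht => ?_⟩
  · simp [hN, pathCount_zero hpos, hy]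
  · exact ⟨fun t => (continuous_of_discreteTopology (f := y)).continuousAt.comp_continuousWithinAt
      (hcad.1 t), fun t => (hcad.2 t).imp' y fun l hl =>
        ((continuous_of_discreteTopology (f := y)).tendsto l).comp hl⟩
  · have h1 : N (τ n) = n + 1 := pathCount_apply_strictMono hτ n
    have h2 := pathCount_eq_leftLim_add hlim hpos (fun _ => True) (τ n)
    have h3 : {k | τ k = τ n ∧ True} = {n} := by ext k; simp [hτ.injective.eq_iff]
    rw [h3, Set.ncard_singleton, ← hN, h1] at h2
    rw [hleft, ← Nat.succ.inj h2]
    simp only [h1, hy]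
  · have h2 := pathCount_eq_leftLim_add hlim hpos (fun _ => True) t
    have h3 : {k | τ k = t ∧ True} = ∅ := by ext k; simpa using (ht k).symm
    rw [h3, Set.ncard_empty, add_zero, ← hN] at h2
    rw [hleft, ← h2]

variable {Ω : Type*} {arr srv : MarkedPoints Ω (Mark c)}

/-- The evolution from given initial states. -/
theorem exists_follows (pol : Policy c)
    (hpos₁ : ∀ n ω, 0 < arr.T n ω) (hmono₁ : ∀ ω, StrictMono fun n => arr.T n ω)
    (hlim₁ : ∀ ω, Tendsto (fun n => arr.T n ω) atTop atTop)
    (hpos₂ : ∀ n ω, 0 < srv.T n ω) (hmono₂ : ∀ ω, StrictMono fun n => srv.T n ω)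
    (hlim₂ : ∀ ω, Tendsto (fun n => srv.T n ω) atTop atTop)
    (hno : ∀ ω n n', arr.T n ω ≠ srv.T n' ω) (x₀ : Ω → State c) :
    ∃ X : ℝ≥0 → Ω → State c, X 0 = x₀ ∧ Follows pol arr srv X := by
  have key : ∀ ω, ∃ x : ℝ≥0 → State c, x 0 = x₀ ω ∧ IsCadlag x ∧
      (∀ n, x (arr.T n ω) = arrivalStep pol (arr.mark n ω) (Function.leftLim x (arr.T n ω))) ∧
      (∀ n, x (srv.T n ω) = serviceStep pol (srv.mark n ω) (Function.leftLim x (srv.T n ω))) ∧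
      ∀ t, (∀ n, t ≠ arr.T n ω) → (∀ n, t ≠ srv.T n ω) → x t = Function.leftLim x t := by
    intro ω
    -- Arrivals and services have no common instant, so their disjoint union can be listed in one
    -- increasing sequence along which the recursion runs.
    set f : ℕ ⊕ ℕ → ℝ≥0 := Sum.elim (fun n => arr.T n ω) (fun n => srv.T n ω) with hf
    set st : ℕ ⊕ ℕ → State c → State c :=
      Sum.elim (fun n => arrivalStep pol (arr.mark n ω)) (fun n => serviceStep pol (srv.mark n ω))
      with hst
    have hfin : ∀ t, {i ∈ (Set.univ : Set (ℕ ⊕ ℕ)) | f i ≤ t}.Finite := by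
      intro t
      refine (((finite_setOf_le (hlim₁ ω) t).image Sum.inl).union
        ((finite_setOf_le (hlim₂ ω) t).image Sum.inr)).subset ?_
      rintro (n | n) ⟨-, h⟩
      · exact Or.inl ⟨n, h, rfl⟩
      · exact Or.inr ⟨n, h, rfl⟩
    obtain ⟨e, he, hmono⟩ := exists_enumeration Set.univ Set.infinite_univ f
      ((hmono₁ ω).injective.sumElim (hmono₂ ω).injective (hno ω)).injOn hfin
    have hpos : ∀ i, 0 < f i := by
      rintro (n | n)
      exacts [hpos₁ n ω, hpos₂ n ω]
    have heinj : Function.Injective e := fun i j h => hmono.injective (congrArg f h)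
    have hlim : Tendsto (fun n => f (e n)) atTop atTop :=
      tendsto_atTop_of_injective fun t => Set.Finite.of_finite_image
        ((hfin t).subset (by rintro _ ⟨n, hn, rfl⟩; exact ⟨trivial, hn⟩)) heinj.injOn
    obtain ⟨x, h0, hcad, hstep, hconst⟩ :=
      exists_path hmono (fun n => hpos _) hlim (fun n => st (e n)) (x₀ ω)
    have hall : ∀ i, x (f i) = st i (Function.leftLim x (f i)) := by
      intro i
      obtain ⟨n, rfl⟩ : i ∈ Set.range e := he ▸ trivial
      exact hstep n
    refine ⟨x, h0, hcad, fun n => hall (.inl n), fun n => hall (.inr n), fun t h1 h2 =>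
      hconst t fun n => ?_⟩
    rcases e n with k | k
    exacts [h1 k, h2 k]
  choose x h0 hcad harr hsrv hconst using key
  refine ⟨fun t ω => x ω t, funext h0, hcad, ?_, ?_, ?_, hconst⟩
  · rintro ω n _ rfl
    exact harr ω n
  · rintro ω n _ rfl hx
    rw [hsrv ω n]
    exact serviceStep_add pol _ hx
  · rintro ω n _ rfl hx
    rw [hsrv ω n, serviceStep, if_neg (by rw [hx]; omega)]

end PathConstruction


/-! ### Adaptedness through an exact Euler scheme -/

section Adapted

theorem MarkedPoints.count_eq_zero_of_iff {Ω E : Type*} {N : MarkedPoints Ω E} {ω : Ω} {a b : ℝ≥0}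
    (h : ∀ n, N.T n ω ≤ b ↔ N.T n ω ≤ a) (B : Set E) : N.count a b B ω = 0 := by
  have : {n | a < N.T n ω ∧ N.T n ω ≤ b ∧ N.mark n ω ∈ B} = ∅ :=
    Set.eq_empty_of_forall_notMem fun n hn => not_le.2 hn.1 ((h n).1 hn.2.1)
  rw [MarkedPoints.count, this, Set.ncard_empty]

/-- The count over an interval in which only the instant `u` may bear a point. -/
theorem MarkedPoints.count_of_jump {Ω E : Type*} {N : MarkedPoints Ω E} {ω : Ω} {a b u : ℝ≥0}
    (ha : ∀ n, N.T n ω ≤ a ↔ N.T n ω < u) (hb : ∀ n, N.T n ω ≤ b ↔ N.T n ω ≤ u) (B : Set E) :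
    N.count a b B ω = Set.ncard {n | N.T n ω = u ∧ N.mark n ω ∈ B} := by
  rw [MarkedPoints.count]
  congr 1
  ext n
  simp only [Set.mem_ofPred_eq, hb n, ← not_le (a := N.T n ω), ha n, not_lt]
  rw [← and_assoc, and_comm (a := u ≤ _), ← le_antisymm_iff]

variable {c : ℕ}

/-- The marks for which an arriving task is routed to queue `i`. -/
def joinMarks (pol : Policy c) (i : Fin c) (x : State c) : Set (Mark c) :=
  {p | pol.route x (rankedQueue x p.1) p.2 = i}

/-- The marks for which a potential service completion reduces the length of queue `i`. -/
def leaveMarks (pol : Policy c) (i : Fin c) (x : State c) : Set (Mark c) :=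
  {p | 1 ≤ x (rankedQueue x p.1) ∧ pol.release x (rankedQueue x p.1) p.2 = i}

theorem measurableSet_joinMarks (pol : Policy c) (i : Fin c) (x : State c) :
    MeasurableSet (joinMarks pol i x) := by
  have : joinMarks pol i x = ⋃ j, arrivalMarks pol j i x := by
    ext p; simp [joinMarks, arrivalMarks]
  rw [this]
  exact MeasurableSet.iUnion fun j => measurableSet_arrivalMarks pol j i x

theorem measurableSet_leaveMarks (pol : Policy c) (i : Fin c) (x : State c) :
    MeasurableSet (leaveMarks pol i x) := by
  have : leaveMarks pol i x = ⋃ j, serviceMarks pol j i x := by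
    ext p; simp [leaveMarks, serviceMarks]
  rw [this]
  exact MeasurableSet.iUnion fun j => measurableSet_serviceMarks pol j i x

variable {Ω : Type*} {arr srv : MarkedPoints Ω (Mark c)} {pol : Policy c}
  {X : ℝ≥0 → Ω → State c}

/-- The Euler step from state `x` over the interval `(a, b]`. -/
def eulerStep (pol : Policy c) (arr srv : MarkedPoints Ω (Mark c)) (a b : ℝ≥0) (x : State c)
    (ω : Ω) : State c :=
  fun i => x i + arr.count a b (joinMarks pol i x) ω - srv.count a b (leaveMarks pol i x) ω

theorem eulerStep_of_iff {a b : ℝ≥0} {ω : Ω} (h₁ : ∀ n, arr.T n ω ≤ b ↔ arr.T n ω ≤ a)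
    (h₂ : ∀ n, srv.T n ω ≤ b ↔ srv.T n ω ≤ a) (x : State c) :
    eulerStep pol arr srv a b x ω = x := by
  ext i
  simp [eulerStep, MarkedPoints.count_eq_zero_of_iff h₁, MarkedPoints.count_eq_zero_of_iff h₂]

open Classical in
theorem ncard_instant {Ω E : Type*} {N : MarkedPoints Ω E} {ω : Ω}
    (hinj : Function.Injective fun n => N.T n ω) (n : ℕ) (B : Set E) :
    Set.ncard {k | N.T k ω = N.T n ω ∧ N.mark k ω ∈ B} = if N.mark n ω ∈ B then 1 else 0 := by
  split_ifs with h
  · have : {k | N.T k ω = N.T n ω ∧ N.mark k ω ∈ B} = {n} := by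
      ext k
      simp only [Set.mem_ofPred_eq, Set.mem_singleton_iff]
      exact ⟨fun hk => hinj hk.1, fun hk => by rw [hk]; exact ⟨rfl, h⟩⟩
    rw [this, Set.ncard_singleton]
  · have : {k | N.T k ω = N.T n ω ∧ N.mark k ω ∈ B} = ∅ := by
      ext k
      simp only [Set.mem_ofPred_eq, Set.mem_empty_iff_false, iff_false]
      rintro ⟨h1, h2⟩
      exact h (hinj h1 ▸ h2)
    rw [this, Set.ncard_empty]

theorem ncard_no_instant {Ω E : Type*} {N : MarkedPoints Ω E} {ω : Ω} {u : ℝ≥0}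
    (h : ∀ n, u ≠ N.T n ω) (B : Set E) : Set.ncard {k | N.T k ω = u ∧ N.mark k ω ∈ B} = 0 := by
  have : {k | N.T k ω = u ∧ N.mark k ω ∈ B} = ∅ := by
    ext k; simpa using fun h' => absurd h'.symm (h k)
  rw [this, Set.ncard_empty]

/-- If `(a, b]` contains no instant of a point other than `u`, the counts are zero or one and an
Euler step from the left limit reproduces the transition at `u`. -/
theorem Follows.eulerStep_of_jump (h : Follows pol arr srv X) {ω : Ω}
    (hinj₁ : Function.Injective fun n => arr.T n ω) (hinj₂ : Function.Injective fun n => srv.T n ω)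
    (hno : ∀ n n', arr.T n ω ≠ srv.T n' ω) {a b u : ℝ≥0}
    (ha₁ : ∀ n, arr.T n ω ≤ a ↔ arr.T n ω < u) (hb₁ : ∀ n, arr.T n ω ≤ b ↔ arr.T n ω ≤ u)
    (ha₂ : ∀ n, srv.T n ω ≤ a ↔ srv.T n ω < u) (hb₂ : ∀ n, srv.T n ω ≤ b ↔ srv.T n ω ≤ u) :
    X u ω = eulerStep pol arr srv a b (Function.leftLim (fun v => X v ω) u) ω := by
  classical
  ext i
  rw [eulerStep, MarkedPoints.count_of_jump ha₁ hb₁, MarkedPoints.count_of_jump ha₂ hb₂]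
  by_cases h1 : ∃ n, u = arr.T n ω
  · obtain ⟨n, rfl⟩ := h1
    rw [ncard_instant hinj₁, ncard_no_instant (hno n), h.arrival ω n _ rfl]
    simp [joinMarks, Pi.single_apply, eq_comm]
  push Not at h1
  rw [ncard_no_instant h1]
  by_cases h2 : ∃ n, u = srv.T n ω
  · obtain ⟨n, rfl⟩ := h2
    rw [ncard_instant hinj₂]
    by_cases h3 : 1 ≤ Function.leftLim (fun v => X v ω) (srv.T n ω)
      (rankedQueue (Function.leftLim (fun v => X v ω) (srv.T n ω)) (srv.mark n ω).1)
    · have h4 := congrFun (h.service ω n _ rfl h3) i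
      rw [Pi.add_apply, Pi.single_apply] at h4
      simp only [leaveMarks, Set.mem_ofPred_eq, h3, true_and, eq_comm (b := i)]
      omega
    · have h4 := congrFun (h.idle ω n _ rfl (by omega)) i
      simp only [leaveMarks, Set.mem_ofPred_eq, h3, false_and, if_false]
      omega
  · push Not at h2
    rw [ncard_no_instant h2, h.no_event ω u h1 h2]
    rfl

/-- The states on grids, starting from the exact initial state. -/
def eulerScheme (pol : Policy c) (arr srv : MarkedPoints Ω (Mark c)) (x₀ : Ω → State c) (t : ℝ≥0)
    (n : ℕ) : ℕ → Ω → State c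
  | 0, ω => x₀ ω
  | k + 1, ω => eulerStep pol arr srv (grid 0 t n k) (grid 0 t n (k + 1))
      (eulerScheme pol arr srv x₀ t n k ω) ω

variable {m : MeasurableSpace Ω} {P : Measure Ω} {F : Filtration ℝ≥0 m} {r₁ r₂ : ℝ≥0}
  {ν : Measure (Mark c)}

theorem measurable_eulerScheme (harr : IsMarkedPoisson F P r₁ ν arr)
    (hsrv : IsMarkedPoisson F P r₂ ν srv) {x₀ : Ω → State c} (h0 : Measurable[F 0] x₀) (t : ℝ≥0)
    (n k : ℕ) : Measurable[F (grid 0 t n k)] (eulerScheme pol arr srv x₀ t n k) := by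
  induction k with
  | zero => rw [grid_zero]; exact h0
  | succ k ih =>
    have hle : grid 0 t n k ≤ grid 0 t n (k + 1) := grid_mono 0 t n k.le_succ
    refine measurable_apply_of_countable (mΩ := F (grid 0 t n (k + 1)))
      (f := fun x => eulerStep pol arr srv (grid 0 t n k) (grid 0 t n (k + 1)) x) (fun x => ?_)
      (ih.mono (F.mono hle) le_rfl)
    refine @measurable_pi_lambda _ _ _ (F (grid 0 t n (k + 1))) _ _ fun i => ?_
    exact (measurable_const.add (harr.measurable_count hle (measurableSet_joinMarks pol i x))).sub
      (hsrv.measurable_count hle (measurableSet_leaveMarks pol i x))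

/-- The evolution is specified path by path, with no measurability built in. On each path the Euler
scheme agrees exactly with `X` on all sufficiently fine grids, so `X t` is a pointwise limit of
functions of the initial state and of counts up to `t`. -/
theorem Follows.adapted (harr : IsMarkedPoisson F P r₁ ν arr) (hsrv : IsMarkedPoisson F P r₂ ν srv)
    (hno : ∀ ω n n', arr.T n ω ≠ srv.T n' ω) (h : Follows pol arr srv X)
    (h0 : Measurable[F 0] (X 0)) : Adapted F X := by
  intro t
  refine @measurable_of_tendsto_metrizable _ _ (F t) _ _ _ _
    (fun n => eulerScheme pol arr srv (X 0) t n n) _ (fun n => ?_) ?_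
  · exact (measurable_eulerScheme harr hsrv h0 t n n).mono (F.mono (grid_le zero_le le_rfl)) le_rfl
  refine tendsto_pi_nhds.2 fun ω => ?_
  refine tendsto_nhds_of_eventually_eq ?_
  have hT₁ := harr.tendsto ω
  have hT₂ := hsrv.tendsto ω
  set R : ℝ≥0 → ℝ≥0 → Prop := fun a b => X b ω = eulerStep pol arr srv a b (X a ω) ω with hRdef
  have hconst : ∀ a b, X b ω = X a ω → (∀ n, arr.T n ω ≤ b ↔ arr.T n ω ≤ a) →
      (∀ n, srv.T n ω ≤ b ↔ srv.T n ω ≤ a) → R a b := fun a b hX h1 h2 => by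
    simp only [hRdef, eulerStep_of_iff h1 h2, hX]
  have hR : ∀ u, ∀ᶠ p in 𝓝 (u, u), p.1 ≤ p.2 → R p.1 p.2 := by
    intro u
    refine local_of_eventually
      (L := fun v => X v ω = Function.leftLim (fun u => X u ω) u ∧
        (∀ n, arr.T n ω ≤ v ↔ arr.T n ω < u) ∧ ∀ n, srv.T n ω ≤ v ↔ srv.T n ω < u)
      (U := fun v => X v ω = X u ω ∧
        (∀ n, arr.T n ω ≤ v ↔ arr.T n ω ≤ u) ∧ ∀ n, srv.T n ω ≤ v ↔ srv.T n ω ≤ u) ?_ ?_ ?_ ?_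
    · filter_upwards [(h.cadlag ω).eventually_nhds u, eventually_forall_le_iff hT₁ u,
        eventually_forall_le_iff hT₂ u] with v h1 h2 h3
      exact ⟨fun hv => ⟨h1.1 hv, h2.1 hv, h3.1 hv⟩, fun hv => ⟨h1.2 hv, h2.2 hv, h3.2 hv⟩⟩
    · rintro a b ⟨ha, ha₁, ha₂⟩ ⟨hb, hb₁, hb₂⟩ - -
      exact hconst a b (hb.trans ha.symm) (fun n => (hb₁ n).trans (ha₁ n).symm)
        fun n => (hb₂ n).trans (ha₂ n).symm
    · rintro a b ⟨ha, ha₁, ha₂⟩ ⟨hb, hb₁, hb₂⟩ - -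
      exact hconst a b (hb.trans ha.symm) (fun n => (hb₁ n).trans (ha₁ n).symm)
        fun n => (hb₂ n).trans (ha₂ n).symm
    · rintro a b ⟨ha, ha₁, ha₂⟩ ⟨hb, hb₁, hb₂⟩ - -
      simp only [hRdef]
      rw [hb, ha]
      exact h.eulerStep_of_jump (harr.strictMono ω).injective (hsrv.strictMono ω).injective
        (hno ω) ha₁ hb₁ ha₂ hb₂
  filter_upwards [eventually_grid hR (zero_le (a := t)), eventually_gt_atTop 0] with n hn hpos
  have : ∀ j ≤ n, eulerScheme pol arr srv (X 0) t n j ω = X (grid 0 t n j) ω := by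
    intro j
    induction j with
    | zero => intro _; rw [grid_zero]; rfl
    | succ j ih =>
      intro hj
      rw [eulerScheme, ih (by omega)]
      exact (hn j hj).symm
  have h1 := this n le_rfl
  rwa [grid_self zero_le hpos.ne'] at h1

end Adapted


/-! ### Completion and the usual conditions -/

section Completion

variable {Ω : Type*} {m₀ : MeasurableSpace Ω} (P : Measure Ω)

/-- The sets which are almost surely equal to sets of the σ-algebra `m`. -/
abbrev augment (m : MeasurableSpace Ω) : MeasurableSpace Ω := eventuallyMeasurableSpace m (ae P)

theorem augment_mono {m m' : MeasurableSpace Ω} (h : m ≤ m') : augment P m ≤ augment P m' :=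
  fun _ ⟨t, ht, hst⟩ => ⟨t, h t ht, hst⟩

/-- The completion of `P`, on the same space. -/
def completed : @Measure Ω (augment P m₀) := P.completion

theorem completed_apply (s : Set Ω) : completed P s = P s := rfl

instance [IsProbabilityMeasure P] : IsProbabilityMeasure (completed P) :=
  ⟨(completed_apply P _).trans measure_univ⟩

variable {P}

theorem measurable_augment {β : Type*} [MeasurableSpace β] {m : MeasurableSpace Ω} {f g : Ω → β}
    (hf : Measurable[m] f) (h : g =ᵐ[P] f) : Measurable[augment P m] g :=
  hf.eventuallyMeasurable_of_eventuallyEq h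

theorem indep_augment {m₁ m₂ : MeasurableSpace Ω} (h : Indep m₁ m₂ P) :
    Indep (augment P m₁) (augment P m₂) (completed P) := by
  rw [Indep_iff] at h ⊢
  rintro A B ⟨A', hA', hA⟩ ⟨B', hB', hB⟩
  simp only [completed_apply]
  rw [measure_congr (hA.inter hB), measure_congr hA, measure_congr hB, h A' B' hA' hB']

theorem iIndep_augment {ι : Type*} {m : ι → MeasurableSpace Ω} (h : iIndep m P) :
    iIndep (fun i => augment P (m i)) (completed P) := by
  classical
  rw [iIndep_iff] at h ⊢
  intro s f hf
  have hf' : ∀ i, ∃ t, (i ∈ s → MeasurableSet[m i] t) ∧ (i ∈ s → f i =ᵐ[P] t) := by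
    intro i
    by_cases hi : i ∈ s
    · obtain ⟨t, ht, hft⟩ := hf i hi
      exact ⟨t, fun _ => ht, fun _ => hft⟩
    · exact ⟨∅, fun h => absurd h hi, fun h => absurd h hi⟩
  choose t ht hft using hf'
  simp only [completed_apply]
  have h1 : (⋂ i ∈ s, f i : Set Ω) =ᵐ[P] (⋂ i ∈ s, t i : Set Ω) :=
    Filter.EventuallyEq.countable_bInter s.countable_toSet hft
  rw [measure_congr h1, h s ht]
  exact Finset.prod_congr rfl fun i hi => (measure_congr (hft i hi)).symm

theorem hasLaw_completed {β : Type*} [MeasurableSpace β] {μ : Measure β} {f g : Ω → β}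
    (hf : Measurable f) (h : HasLaw f μ P) (hg : g =ᵐ[P] f) : HasLaw g μ (completed P) := by
  have hm := measurable_augment hf hg
  refine ⟨hm.aemeasurable, ?_⟩
  rw [← h.map_eq]
  ext s hs
  rw [Measure.map_apply hm hs, Measure.map_apply hf hs, completed_apply]
  exact measure_congr (hg.preimage s)

variable (P)

/-- The filtration augmented by the null sets. -/
def augmentedFiltration (G : Filtration ℝ≥0 m₀) : @Filtration Ω ℝ≥0 _ (augment P m₀) where
  seq t := augment P (G t)
  mono' _ _ h := augment_mono P (G.mono h)
  le' t := augment_mono P (G.le t)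

/-- The smallest filtration which contains a given one and satisfies the usual conditions. -/
def usualFiltration (G : Filtration ℝ≥0 m₀) : @Filtration Ω ℝ≥0 _ (augment P m₀) :=
  (augmentedFiltration P G).rightCont

theorem augment_le_usualFiltration (G : Filtration ℝ≥0 m₀) (t : ℝ≥0) :
    augment P (G t) ≤ usualFiltration P G t :=
  (augmentedFiltration P G).le_rightCont t

theorem usualConditions (G : Filtration ℝ≥0 m₀) :
    UsualConditions (usualFiltration P G) (completed P) where
  right_continuous := by unfold usualFiltration; infer_instance
  complete B hB := augment_le_usualFiltration P G 0 B
    ⟨∅, @MeasurableSet.empty _ (G 0), ae_eq_empty.2 hB⟩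

theorem usualFiltration_le {G : Filtration ℝ≥0 m₀} {s u : ℝ≥0} (h : s < u) :
    usualFiltration P G s ≤ augment P (G u) := by
  rw [usualFiltration, Filtration.rightCont_eq]
  exact iInf₂_le u h

/-- Independence of the increments after each later time implies independence of the right limit of
the filtration. -/
theorem indep_usualFiltration [IsProbabilityMeasure P] {G : Filtration ℝ≥0 m₀}
    {M : ℝ≥0 → MeasurableSpace Ω} (hM : Antitone M) (hle : ∀ u, M u ≤ m₀)
    (h : ∀ u, Indep (M u) (G u) P) (s : ℝ≥0) :
    Indep (⨆ u : Set.Ioi s, augment P (M u)) (usualFiltration P G s) (completed P) := by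
  -- For each `u > s` the right limit at `s` is contained in the augmented σ-algebra at `u`, hence
  -- independent of `M u`. These form a directed family as `u` decreases to `s`, and independence
  -- passes to the supremum.
  refine indep_iSup_of_directed_le (fun u => ?_) (fun u => augment_mono P (hle u))
    ((usualFiltration P G).le s) ?_
  · exact indep_of_indep_of_le_right (indep_augment (h u)) (usualFiltration_le P u.2)
  · intro u v
    refine ⟨⟨min u.1 v.1, Set.mem_Ioi.2 (lt_min u.2 v.2)⟩, augment_mono P (hM (min_le_left _ _)),
      augment_mono P (hM (min_le_right _ _))⟩

/-- Points are locally finite, so none lies just after `s`: counts over `(s, v]` are limits of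
counts started slightly later. This recovers independence from the right-continuous filtration at
`s` itself. -/
theorem MarkedPoints.sigmaIoc_le_iSup {E : Type*} [MeasurableSpace E] {N : MarkedPoints Ω E}
    (hlim : ∀ ω, Tendsto (fun n => N.T n ω) atTop atTop) {M : ℝ≥0 → MeasurableSpace Ω}
    (h : ∀ (u v : ℝ≥0) (B : Set E), MeasurableSet B → Measurable[M u] (N.count u v B))
    (s t : ℝ≥0) : N.sigmaIoc s t ≤ ⨆ u : Set.Ioi s, M u := by
  refine iSup_le fun v => iSup_le fun hv => iSup_le fun B => iSup_le fun hB => ?_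
  rw [← measurable_iff_comap_le]
  obtain ⟨a, -, ha, hlima⟩ := exists_seq_strictAnti_tendsto s
  refine @measurable_of_tendsto_metrizable _ _ (⨆ u : Set.Ioi s, M u) _ _ _ _
    (fun n => N.count (a n) v B) _ (fun n => ?_) ?_
  · exact (h (a n) v B hB).mono (le_iSup (fun u : Set.Ioi s => M u) ⟨a n, ha n⟩) le_rfl
  · refine tendsto_pi_nhds.2 fun ω => tendsto_nhds_of_eventually_eq ?_
    filter_upwards [hlima.eventually (eventually_forall_le_iff (hlim ω) s)] with n hn
    have h1 : ∀ k, a n < N.T k ω ↔ s < N.T k ω := fun k => by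
      rw [← not_le, hn.2 (ha n).le k, not_le]
    simp only [MarkedPoints.count, h1]

end Completion


/-! ### Independence under preimages and products -/

section Independence

theorem iIndep_comap {Ω Ω' ι : Type*} {mΩ : MeasurableSpace Ω} {mΩ' : MeasurableSpace Ω'}
    {P : Measure Ω} {Q : Measure Ω'} {f : Ω → Ω'} (hf : MeasurePreserving f P Q)
    {m : ι → MeasurableSpace Ω'} (hm : ∀ i, m i ≤ mΩ') (h : iIndep m Q) :
    iIndep (fun i => MeasurableSpace.comap f (m i)) P := by
  rw [iIndep_iff] at h ⊢
  intro s A hA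
  have hA' : ∀ i, ∃ B, i ∈ s → MeasurableSet[m i] B ∧ f ⁻¹' B = A i := by
    intro i
    by_cases hi : i ∈ s
    · obtain ⟨B, hB⟩ := hA i hi
      exact ⟨B, fun _ => hB⟩
    · exact ⟨∅, fun h => absurd h hi⟩
  choose B hB using hA'
  have h1 : ⋂ i ∈ s, A i = f ⁻¹' ⋂ i ∈ s, B i := by
    rw [Set.preimage_iInter₂]
    exact Set.iInter₂_congr fun i hi => (hB i hi).2.symm
  rw [h1, hf.measure_preimage (Finset.measurableSet_biInter s fun i hi =>
    hm i _ (hB i hi).1).nullMeasurableSet, h s fun i hi => (hB i hi).1]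
  refine Finset.prod_congr rfl fun i hi => ?_
  rw [← (hB i hi).2, hf.measure_preimage (hm i _ (hB i hi).1).nullMeasurableSet]

theorem indep_comap {Ω Ω' : Type*} {m₁ m₂ : MeasurableSpace Ω'} {mΩ : MeasurableSpace Ω}
    {mΩ' : MeasurableSpace Ω'} {P : Measure Ω} {Q : Measure Ω'} {f : Ω → Ω'}
    (hf : MeasurePreserving f P Q) (h₁ : m₁ ≤ mΩ') (h₂ : m₂ ≤ mΩ') (h : Indep m₁ m₂ Q) :
    Indep (MeasurableSpace.comap f m₁) (MeasurableSpace.comap f m₂) P := by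
  rw [Indep_iff] at h ⊢
  rintro _ _ ⟨A, hA, rfl⟩ ⟨B, hB, rfl⟩
  rw [← Set.preimage_inter, hf.measure_preimage ((h₁ _ hA).inter (h₂ _ hB)).nullMeasurableSet,
    hf.measure_preimage (h₁ _ hA).nullMeasurableSet,
    hf.measure_preimage (h₂ _ hB).nullMeasurableSet, h A B hA hB]

/-- On a product space, a σ-algebra of the second factor which is independent of another one is
also independent of the latter joined with the first factor. -/
theorem indep_comap_snd_prod {S W : Type*} {m₁ m₂ : MeasurableSpace W} {mS : MeasurableSpace S}
    {mW : MeasurableSpace W} {π : Measure S} {Q : Measure W} [IsProbabilityMeasure π]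
    [IsProbabilityMeasure Q] (h₁ : m₁ ≤ mW) (h₂ : m₂ ≤ mW) (h : Indep m₁ m₂ Q) :
    Indep (MeasurableSpace.comap Prod.snd m₁) (mS.prod m₂) (π.prod Q) := by
  have hle : mS.prod m₂ ≤ mS.prod mW := sup_le_sup le_rfl (MeasurableSpace.comap_mono h₂)
  set m' : MeasurableSpace (S × W) := MeasurableSpace.comap Prod.snd m₁
  have hle' : m' ≤ mS.prod mW := le_sup_of_le_right (MeasurableSpace.comap_mono h₁)
  refine IndepSets.indep (p1 := {s | MeasurableSet[m'] s})
    (p2 := Set.image2 (· ×ˢ ·) {s : Set S | MeasurableSet s} {t : Set W | MeasurableSet[m₂] t})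
    hle' hle (@MeasurableSpace.isPiSystem_measurableSet _ m') (@isPiSystem_prod _ _ mS m₂)
    (@MeasurableSpace.generateFrom_measurableSet _ m').symm (@generateFrom_prod _ _ mS m₂).symm ?_
  rw [IndepSets_iff]
  rintro _ _ ⟨C, hC, rfl⟩ ⟨A, hA, B, hB, rfl⟩
  have e1 : (Prod.snd ⁻¹' C : Set (S × W)) = Set.univ ×ˢ C := by ext; simp
  rw [e1, Set.prod_inter_prod, Set.univ_inter, Measure.prod_prod, Measure.prod_prod,
    Measure.prod_prod, (Indep_iff _ _ _).1 h C B hC hB, measure_univ, one_mul]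
  ring

end Independence

/-! ### Past and future of a cloud -/

section CloudSigma

variable {E : Type*} [MeasurableSpace E]

/-- The σ-algebra generated by some counts. -/
@[reducible] def cloudSigma {κ Z : Type*} (D : Set (Finset κ × (κ → Set Z))) : MeasurableSpace (Cloud κ Z) :=
  ⨆ (C) (_ : C ∈ D), MeasurableSpace.comap (cloudCount C.1 C.2) inferInstance

theorem cloudSigma_mono {κ Z : Type*} {D D' : Set (Finset κ × (κ → Set Z))} (h : D ⊆ D') :
    cloudSigma D ≤ cloudSigma D' :=
  biSup_mono h

theorem measurable_cloudSigma {κ Z : Type*} {D : Set (Finset κ × (κ → Set Z))}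
    {C : Finset κ × (κ → Set Z)} (hC : C ∈ D) : Measurable[cloudSigma D] (cloudCount C.1 C.2) := by
  rw [measurable_iff_comap_le]
  exact le_iSup₂_of_le C hC le_rfl

theorem cloudSigma_le {κ Z : Type*} [MeasurableSpace Z] {D : Set (Finset κ × (κ → Set Z))}
    (hD : ∀ C ∈ D, ∀ k, MeasurableSet (C.2 k)) :
    cloudSigma D ≤ (inferInstance : MeasurableSpace (Cloud κ Z)) :=
  iSup₂_le fun C hC => (measurable_cloudCount C.1 (hD C hC)).comap_le

/-- The counts in one half of the cloud after time `s`. -/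
def futureCounts (E : Type*) [MeasurableSpace E] (b : Bool) (s : ℝ≥0) :
    Set (Finset (Bool × ℕ) × (Bool × ℕ → Set (ℝ≥0 × E))) :=
  {C | ∃ (n : ℕ) (u v : ℝ≥0) (B : Set E), s ≤ u ∧ MeasurableSet B ∧
    C = (halfLineBlocks b n, fun _ => Set.Ioc u v ×ˢ B)}

/-- The counts up to time `t`. -/
def pastCounts (E : Type*) [MeasurableSpace E] (t : ℝ≥0) :
    Set (Finset (Bool × ℕ) × (Bool × ℕ → Set (ℝ≥0 × E))) :=
  {C | ∃ (b : Bool) (n : ℕ) (u v : ℝ≥0) (B : Set E), v ≤ t ∧ MeasurableSet B ∧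
    C = (halfLineBlocks b n, fun _ => Set.Ioc u v ×ˢ B)}

theorem measurableSet_of_mem_futureCounts {b : Bool} {s : ℝ≥0} :
    ∀ C ∈ futureCounts E b s, ∀ k, MeasurableSet (C.2 k) := by
  rintro _ ⟨n, u, v, B, -, hB, rfl⟩ k
  exact measurableSet_Ioc.prod hB

theorem measurableSet_of_mem_pastCounts {t : ℝ≥0} :
    ∀ C ∈ pastCounts E t, ∀ k, MeasurableSet (C.2 k) := by
  rintro _ ⟨b, n, u, v, B, -, hB, rfl⟩ k
  exact measurableSet_Ioc.prod hB

theorem disjoint_of_mem_counts {b : Bool} {s : ℝ≥0} : ∀ C ∈ futureCounts E b s,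
    ∀ C' ∈ pastCounts E s, ∀ k, Disjoint (C.2 k) (C'.2 k) := by
  rintro _ ⟨n, u, v, B, hu, -, rfl⟩ _ ⟨b', n', u', v', B', hv, -, rfl⟩ k
  refine Set.Disjoint.set_prod_left ?_ _ _
  exact (Set.Ioc_disjoint_Ioc_of_le (hv.trans hu)).symm

variable (ν : Measure E) [IsProbabilityMeasure ν] (r : Bool → ℝ≥0)

/-- Future and past counts use disjoint time windows, in whichever blocks. -/
theorem indep_cloudSigma_future_past (b : Bool) (s : ℝ≥0) :
    Indep (cloudSigma (futureCounts E b s)) (cloudSigma (pastCounts E s)) (halfLineLaw ν r) := by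
  refine (iIndep_cloudCount (fun k : Bool × ℕ => r k.1) (fun k => pointLaw k.2 ν)
    (fun i : Bool => if i then futureCounts E b s else pastCounts E s) ?_ ?_).indep
      (i := true) (j := false) (by simp)
  · rintro (_ | _) C hC
    · exact measurableSet_of_mem_pastCounts C (by simpa using hC)
    · exact measurableSet_of_mem_futureCounts C (by simpa using hC)
  · rintro (_ | _) (_ | _) hne C hC C' hC' k - -
    · exact absurd rfl hne
    · exact (disjoint_of_mem_counts C' (by simpa using hC') C (by simpa using hC) k).symm
    · exact disjoint_of_mem_counts C (by simpa using hC) C' (by simpa using hC') k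
    · exact absurd rfl hne

/-- Here the time windows may overlap, but the two halves have no block in common. -/
theorem indep_cloudSigma_halves :
    Indep (cloudSigma (futureCounts E true 0)) (cloudSigma (futureCounts E false 0))
      (halfLineLaw ν r) := by
  refine (iIndep_cloudCount (fun k : Bool × ℕ => r k.1) (fun k => pointLaw k.2 ν)
    (fun i : Bool => futureCounts E i 0) (fun i => measurableSet_of_mem_futureCounts) ?_).indep
      (i := true) (j := false) (by simp)
  rintro i i' hne _ ⟨n, u, v, B, -, -, rfl⟩ _ ⟨n', u', v', B', -, -, rfl⟩ k hk hk'
  simp only [halfLineBlocks, Finset.mem_map, Function.Embedding.sectR_apply] at hk hk'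
  obtain ⟨a, -, rfl⟩ := hk
  obtain ⟨a', -, h⟩ := hk'
  exact absurd (congrArg Prod.fst h).symm hne

end CloudSigma

/-! ### Driving processes on the product with the initial states -/

section Driven

variable {S E : Type*} [MeasurableSpace S] [MeasurableSpace E]

/-- The filtration generated by the first factor and by the points of the cloud. -/
def cloudFiltration (S E : Type*) [mS : MeasurableSpace S] [MeasurableSpace E] :
    Filtration ℝ≥0 (inferInstance : MeasurableSpace (S × Cloud (Bool × ℕ) (ℝ≥0 × E))) where
  seq t := mS.prod (cloudSigma (pastCounts E t))
  mono' s t h := sup_le_sup le_rfl (MeasurableSpace.comap_mono (cloudSigma_mono (by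
    rintro _ ⟨b, n, u, v, B, hv, hB, rfl⟩
    exact ⟨b, n, u, v, B, hv.trans h, hB, rfl⟩)))
  le' t := sup_le_sup le_rfl (MeasurableSpace.comap_mono
    (cloudSigma_le measurableSet_of_mem_pastCounts))

variable {N : MarkedPoints (Cloud (Bool × ℕ) (ℝ≥0 × E)) E}

/-- Marked points on a product, which depend on the second factor. -/
def MarkedPoints.onSnd {W : Type*} (S : Type*) (N : MarkedPoints W E) : MarkedPoints (S × W) E :=
  ⟨fun n ω => N.T n ω.2, fun n ω => N.mark n ω.2⟩

variable {π : Measure S} [IsProbabilityMeasure π] {ν : Measure E} [IsProbabilityMeasure ν]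
  {r : Bool → ℝ≥0} {b : Bool}

/-- The equality is only almost sure, since exceptional clouds were replaced. Counts are therefore
measurable for augmented σ-algebras. The ceiling of `t` supplies enough blocks. -/
theorem MarkedPoints.count_onSnd_ae (h : ∀ᵐ w ∂(halfLineLaw ν r), ∀ (s t : ℝ≥0) (n : ℕ), t ≤ n →
      ∀ B, N.count s t B w = cloudCount (halfLineBlocks b n) (fun _ => Set.Ioc s t ×ˢ B) w)
    (s t : ℝ≥0) (B : Set E) :
    (N.onSnd S).count s t B =ᵐ[π.prod (halfLineLaw ν r)]
      cloudCount (halfLineBlocks b ⌈t⌉₊) (fun _ => Set.Ioc s t ×ˢ B) ∘ Prod.snd := by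
  filter_upwards [(measurePreserving_snd (μ := π)
    (ν := halfLineLaw ν r)).quasiMeasurePreserving.ae h] with ω hω
  exact hω s t _ (Nat.le_ceil t) B

theorem MarkedPoints.measurable_count_onSnd (h : ∀ᵐ w ∂(halfLineLaw ν r),
      ∀ (s t : ℝ≥0) (n : ℕ), t ≤ n → ∀ B,
        N.count s t B w = cloudCount (halfLineBlocks b n) (fun _ => Set.Ioc s t ×ˢ B) w)
    (s t : ℝ≥0) {B : Set E} (hB : MeasurableSet B) :
    Measurable[augment (π.prod (halfLineLaw ν r))
      (MeasurableSpace.comap Prod.snd (cloudSigma (futureCounts E b s)))]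
      ((N.onSnd S).count s t B) := by
  refine measurable_augment ?_ (MarkedPoints.count_onSnd_ae h s t B)
  have hC : (halfLineBlocks b ⌈t⌉₊, fun _ => Set.Ioc s t ×ˢ B) ∈ futureCounts E b s :=
    ⟨_, s, t, B, le_rfl, hB, rfl⟩
  exact (measurable_cloudSigma hC).comp (comap_measurable _)

/-- Laws and independence are those of cloud counts, carried through the product and the completion.
Independence of the past is first obtained strictly after `s`, then extended to `s` by right limits.
-/
theorem isMarkedPoisson_onSnd (hpos : ∀ n w, 0 < N.T n w)
    (hmono : ∀ w, StrictMono fun n => N.T n w) (hlim : ∀ w, Tendsto (fun n => N.T n w) atTop atTop)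
    (h : ∀ᵐ w ∂(halfLineLaw ν r), ∀ (s t : ℝ≥0) (n : ℕ), t ≤ n → ∀ B,
      N.count s t B w = cloudCount (halfLineBlocks b n) (fun _ => Set.Ioc s t ×ˢ B) w) :
    IsMarkedPoisson (usualFiltration (π.prod (halfLineLaw ν r)) (cloudFiltration S E))
      (completed (π.prod (halfLineLaw ν r))) (r b) ν (N.onSnd S) where
  pos n ω := hpos n ω.2
  strictMono ω := hmono ω.2
  tendsto ω := hlim ω.2
  adapted t B hB := by
    refine Measurable.mono ?_ (augment_le_usualFiltration _ _ t) le_rfl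
    refine measurable_augment ?_ (MarkedPoints.count_onSnd_ae h 0 t B)
    have hC : (halfLineBlocks b ⌈t⌉₊, fun _ => Set.Ioc 0 t ×ˢ B) ∈ pastCounts E t :=
      ⟨b, _, 0, t, B, le_rfl, hB, rfl⟩
    exact (measurable_cloudSigma hC).comp (@measurable_snd _ _ _ (cloudSigma (pastCounts E t)))
  indep s t _ := by
    refine indep_of_indep_of_le_left (indep_usualFiltration _
      (M := fun u => MeasurableSpace.comap Prod.snd (cloudSigma (futureCounts E b u)))
      (fun u v huv => MeasurableSpace.comap_mono (cloudSigma_mono ?_))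
      (fun u => le_sup_of_le_right (MeasurableSpace.comap_mono
        (cloudSigma_le measurableSet_of_mem_futureCounts)))
      (fun u => indep_comap_snd_prod (cloudSigma_le measurableSet_of_mem_futureCounts)
        (cloudSigma_le measurableSet_of_mem_pastCounts) (indep_cloudSigma_future_past ν r b u)) s) ?_
    · rintro _ ⟨n, u', v', B, hu, hB, rfl⟩
      exact ⟨n, u', v', B, huv.trans hu, hB, rfl⟩
    · exact MarkedPoints.sigmaIoc_le_iSup
        (M := fun u => augment _ (MeasurableSpace.comap Prod.snd (cloudSigma (futureCounts E b u))))
        (fun ω => hlim ω.2) (fun u v B hB => MarkedPoints.measurable_count_onSnd h u v hB) s t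
  law s t hst B hB := by
    refine hasLaw_completed ?_ ?_ (MarkedPoints.count_onSnd_ae h s t B)
    · exact (measurable_cloudCount _ fun _ => measurableSet_Ioc.prod hB).comp measurable_snd
    · have h1 := hasLaw_cloudCount_halfLine ν r b hst (Nat.le_ceil t) hB
      refine ⟨((measurable_cloudCount _ fun _ => measurableSet_Ioc.prod hB).comp
        measurable_snd).aemeasurable, ?_⟩
      rw [← Measure.map_map (measurable_cloudCount _ fun _ => measurableSet_Ioc.prod hB)
        measurable_snd, (measurePreserving_snd (μ := π)).map_eq, h1.map_eq]
  indep_marks s t _ k B hB hd := by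
    rw [iIndepFun_iff_iIndep]
    have h1 := iIndep_cloudCount (fun k : Bool × ℕ => r k.1) (fun k => pointLaw k.2 ν)
      (fun l : Fin k => {(halfLineBlocks b ⌈t⌉₊, fun _ => Set.Ioc s t ×ˢ B l)}) ?_ ?_
    · refine iIndep_of_iIndep_of_le (iIndep_augment (iIndep_comap
        (measurePreserving_snd (μ := π) (ν := halfLineLaw ν r)) (fun l => ?_) h1)) fun l => ?_
      · refine cloudSigma_le (D := {(halfLineBlocks b ⌈t⌉₊, fun _ => Set.Ioc s t ×ˢ B l)}) ?_
        rintro _ rfl _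
        exact measurableSet_Ioc.prod (hB l)
      · rw [← measurable_iff_comap_le]
        refine measurable_augment ?_ (MarkedPoints.count_onSnd_ae h s t (B l))
        exact (measurable_cloudSigma
          (D := {(halfLineBlocks b ⌈t⌉₊, fun _ => Set.Ioc s t ×ˢ B l)}) rfl).comp
            (comap_measurable _)
    · rintro l _ rfl _
      exact measurableSet_Ioc.prod (hB l)
    · rintro l l' hne _ rfl _ rfl _ - -
      exact Set.Disjoint.set_prod_right (hd hne) _ _

end Driven

/-! ### Existence of the coupling -/

section Existence

/-- The initial pair is the first factor of a product whose second factor is the cloud. It may have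
any joint law, is known at time zero, and is independent of the driving points. -/
theorem exists_coupling {c : ℕ} (hc : c ≠ 0) {lam : ℝ≥0} (hlam : 0 < lam) (pol : Policy c)
    (π : Measure (State c × State c)) [IsProbabilityMeasure π] :
    ∃ (Ω : Type) (m : MeasurableSpace Ω) (P : Measure Ω) (F : Filtration ℝ≥0 m)
      (arr srv : MarkedPoints Ω (Mark c)) (X Y : ℝ≥0 → Ω → State c),
      IsProbabilityMeasure P ∧ UsualConditions F P ∧ IsCoupling F P lam pol arr srv X Y ∧
      HasLaw (fun ω => (X 0 ω, Y 0 ω)) π P := by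
  have := isProbabilityMeasure_markLaw hc
  set r : Bool → ℝ≥0 := fun b => if b then lam else c with hr
  have hr0 : ∀ b, 0 < r b := by
    rintro (_ | _)
    · simpa [hr] using Nat.pos_of_ne_zero hc
    · simpa [hr] using hlam
  obtain ⟨N, hpos, hmono, hlim, hno, hcount⟩ := exists_markedPoints (markLaw c) hr0
  set D := State c × State c
  set P₀ : Measure (D × Cloud (Bool × ℕ) (ℝ≥0 × Mark c)) := π.prod (halfLineLaw (markLaw c) r)
  have hcount' : ∀ b, ∀ᵐ w ∂(halfLineLaw (markLaw c) r), ∀ (s t : ℝ≥0) (n : ℕ), t ≤ n → ∀ B,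
      (N b).count s t B w = cloudCount (halfLineBlocks b n) (fun _ => Set.Ioc s t ×ˢ B) w :=
    fun b => hcount.mono fun w hw => hw b
  have hN : ∀ b, IsMarkedPoisson (usualFiltration P₀ (cloudFiltration D (Mark c))) (completed P₀)
      (r b) (markLaw c) ((N b).onSnd D) := fun b =>
    isMarkedPoisson_onSnd (hpos b) (hmono b) (hlim b) (hcount' b)
  have hex := fun pol' (x₀ : D × Cloud (Bool × ℕ) (ℝ≥0 × Mark c) → State c) =>
    exists_follows (arr := (N true).onSnd D) (srv := (N false).onSnd D) pol'
      (hN true).pos (hN true).strictMono (hN true).tendsto (hN false).pos (hN false).strictMono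
      (hN false).tendsto (fun ω => hno ω.2) x₀
  obtain ⟨X, hX0, hX⟩ := hex pol fun ω => ω.1.1
  obtain ⟨Y, hY0, hY⟩ := hex (Policy.uniformRouting c) fun ω => ω.1.2
  have hfst : Measurable[usualFiltration P₀ (cloudFiltration D (Mark c)) 0]
      fun ω : D × Cloud (Bool × ℕ) (ℝ≥0 × Mark c) => ω.1 := by
    refine Measurable.mono ?_ (augment_le_usualFiltration _ _ 0) le_rfl
    exact measurable_augment (@measurable_fst _ _ _ (cloudSigma (pastCounts (Mark c) 0)))
      EventuallyEq.rfl
  refine ⟨_, _, completed P₀, usualFiltration P₀ (cloudFiltration D (Mark c)),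
    (N true).onSnd D, (N false).onSnd D, X, Y, inferInstance, usualConditions _ _, ?_, ?_⟩
  · exact
      { arrivals := hN true
        services := hN false
        indep := by
          refine indep_of_indep_of_le_left (indep_of_indep_of_le_right (indep_augment
            (indep_comap (measurePreserving_snd (μ := π) (ν := halfLineLaw (markLaw c) r))
              (cloudSigma_le measurableSet_of_mem_futureCounts)
              (cloudSigma_le measurableSet_of_mem_futureCounts)
              (indep_cloudSigma_halves (markLaw c) r))) ?_) ?_ <;>
          · refine iSup_le fun t => iSup_le fun u => iSup_le fun hu => iSup_le fun B =>
              iSup_le fun hB => ?_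
            rw [← measurable_iff_comap_le]
            exact MarkedPoints.measurable_count_onSnd (hcount' _) 0 u hB
        no_common := fun ω => hno ω.2
        adapted_fst := hX.adapted (hN true) (hN false) (fun ω => hno ω.2)
          (by rw [hX0]; exact measurable_fst.comp hfst)
        adapted_snd := hY.adapted (hN true) (hN false) (fun ω => hno ω.2)
          (by rw [hY0]; exact measurable_snd.comp hfst)
        follows_fst := hX
        follows_snd := hY }
  · refine hasLaw_completed measurable_fst ?_ (ae_of_all _ fun ω => ?_)
    · exact ⟨measurable_fst.aemeasurable, measurePreserving_fst.map_eq⟩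
    · simp only [hX0, hY0]
      rfl

end Existence


end LoadBalancing

end

theorem theorem2 {c : ℕ} (hc : 2 ≤ c) (lam : ℝ≥0) (hlam : 0 < lam)
    (pol : LoadBalancing.Policy c) :
    -- the construction can be carried out from any joint law of the initial states
    (∀ π : Measure (LoadBalancing.State c × LoadBalancing.State c), IsProbabilityMeasure π →
      ∃ (Ω : Type) (m : MeasurableSpace Ω) (P : Measure Ω) (F : Filtration ℝ≥0 m)
        (arr srv : LoadBalancing.MarkedPoints Ω (LoadBalancing.Mark c))
        (X Y : ℝ≥0 → Ω → LoadBalancing.State c),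
        IsProbabilityMeasure P ∧ LoadBalancing.UsualConditions F P ∧
        LoadBalancing.IsCoupling F P lam pol arr srv X Y ∧
        HasLaw (fun ω => (X 0 ω, Y 0 ω)) π P) ∧
    -- whenever it is carried out, it yields a coupling which preserves the preorder
    (∀ (Ω : Type*) (m : MeasurableSpace Ω) (P : Measure Ω) (F : Filtration ℝ≥0 m)
      (arr srv : LoadBalancing.MarkedPoints Ω (LoadBalancing.Mark c))
      (X Y : ℝ≥0 → Ω → LoadBalancing.State c),
      IsProbabilityMeasure P → LoadBalancing.IsCoupling F P lam pol arr srv X Y →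
      -- `X` is the queue length process of a network with policy `pol`, with the law of any such
      -- process with the same initial law
      LoadBalancing.IsNetwork F P lam pol X ∧
      (∀ (Ω' : Type*) (m' : MeasurableSpace Ω') (P' : Measure Ω') (F' : Filtration ℝ≥0 m')
        (X' : ℝ≥0 → Ω' → LoadBalancing.State c), IsProbabilityMeasure P' →
        LoadBalancing.IsNetwork F' P' lam pol X' → P'.map (X' 0) = P.map (X 0) →
        IdentDistrib (fun ω t => X t ω) (fun ω t => X' t ω) P P') ∧
      -- `Y` is the queue length process of a uniform routing network, with the law of any such
      -- process with the same initial law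
      LoadBalancing.IsNetwork F P lam (LoadBalancing.Policy.uniformRouting c) Y ∧
      (∀ (Ω' : Type*) (m' : MeasurableSpace Ω') (P' : Measure Ω') (F' : Filtration ℝ≥0 m')
        (Y' : ℝ≥0 → Ω' → LoadBalancing.State c), IsProbabilityMeasure P' →
        LoadBalancing.IsNetwork F' P' lam (LoadBalancing.Policy.uniformRouting c) Y' →
        P'.map (Y' 0) = P.map (Y 0) →
        IdentDistrib (fun ω t => Y t ω) (fun ω t => Y' t ω) P P') ∧
      -- the preorder is preserved along every path
      ∀ ω, LoadBalancing.Preceq (X 0 ω) (Y 0 ω) →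
        ∀ t, LoadBalancing.Preceq (X t ω) (Y t ω)) := by
  have hc0 : c ≠ 0 := by omega
  refine ⟨?_, ?_⟩
  · exact fun π hπ => LoadBalancing.exists_coupling hc0 hlam pol π
  intro Ω m P F arr srv X Y hP h
  have hX := h.follows_fst.isNetwork hc0 h.arrivals h.services h.no_common h.adapted_fst
  have hY := h.follows_snd.isNetwork hc0 h.arrivals h.services h.no_common h.adapted_snd
  exact ⟨hX, fun Ω' m' P' F' X' hP' hX' h0 => hX.identDistrib hX' h0,
    hY, fun Ω' m' P' F' Y' hP' hY' h0 => hY.identDistrib hY' h0,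
    h.follows_fst.preceq h.follows_snd⟩
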